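/- Let $K$ be a field of characteristic $0$, let $N,k\ge 1$, $n=Nk$, let $q\in K^\times$ not be a root of unity, put $t=q^N$ and $Y=q^{1-N^2}$, and assume that $K$ contains a primitive $n$-th root of unity $a$. **The algebra.** Let $\mathbb H$ be the double affine Hecke algebra of $SL_n$: the $K$-algebra generated by $T_i$ ($i\in\mathbb Z/n$), $\pi^{\pm1}$ and pairwise commuting $Z_1^{\pm1},\dots,Z_n^{\pm1}$, with relations $(T_i-t)(T_i+t^{-1})=0$; $T_iT_{i+1}T_i=T_{i+1}T_iT_{i+1}$ and $T_iT_j=T_jT_i$ for $j\not\equiv i\pm1$ (these two dropped for $n=2$); $\pi T_i\pi^{-1}=T_{i+1}$; $T_iZ_iT_i=Z_{i+1}$ ($1\le i<n$), $T_0Z_nT_0=q^{2n}Z_1$; $T_iZ_j=Z_jT_i$ ($j\not\equiv i,i+1$); $Z_1\cdots Z_n=q^{n(n-1)}Y^n$; $\pi^n=1$; $\pi Z_i\pi^{-1}=q^{-2}Z_{i+1}$ ($1\le i<n$), $\pi Z_n\pi^{-1}=q^{2n-2}Z_1$. Let $H(\mathcal Z)$ be the subalgebra generated by $T_1,\dots,T_{n-1}$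 and the $Z_i^{\pm1}$. For an $n$-th root of unity $b\in K$, the twist $M^b$ of an $\mathbb H$-module $M$ is its pullback along the automorphism fixing all $T_i,Z_i$ and sending $\pi\mapsto b\pi$. For $z\in K^n$ let $M[z]=\{m: Z_im=z_im \text{ for all } i\}$, and let $\operatorname{supp}(M)=\{z: M[z]\ne0\}$. **The module $\mathrm{rect}$.** Let $\mathrm{rect}$ be the $H(\mathcal Z)$-module with basis $v_R$, $R$ a standard Young tableau of shape $(k^N)$ ($N$ rows, $k$ columns), on which the finite Hecke algebra acts by its irreducible representation of shape $(k^N)$ in seminormal form, $T_iv_R=\alpha v_R+(t^{-1}+\alpha)v_{s_iR}$ with $\alpha=\frac{t-t^{-1}}{1-t^{2(c(i)-c(i+1))}}$ (where $c(j)$ is the content, column minus row, of the box of $R$ containing $j$; $s_iR$ is $R$ with $i$ and $i+1$ exchanged; and $v_{s_iR}=0$ if $s_iR$ is not standard), and on which $Z_1$ acts as the identity. Let $\overline M(k^N)=\mathbb H\otimes_{H(\mathcal Z)}\mathrm{rect}$. **The module $\overline L(k^N)$.** A standard periodic tableau is a bijection $R$ from $\mathbb Z$ to the boxes $(j,m)$,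 row $1\le j\le N$, column $m\in\mathbb Z$, of the $N\times\infty$ strip, whose fillings increase along rows and down columns, and such that $i+n$ lies $k$ columns to the right of $i$, in the same row, for all $i$. Let $p(R)\in\mathbb Z$ be such that the entries in columns $1,\dots,k$ have sum $\frac{n(n+1)}2+n\,p(R)$. If $i$ lies in row $j$ and column $m$, put $\operatorname{diag}_R(i)=m-j+\frac{p(R)}N$; this is unchanged by horizontal shifts of the strip. Put $\operatorname{wt}(R)=(t^{2\operatorname{diag}_R(1)},\dots,t^{2\operatorname{diag}_R(n)})$ with $t^{1/N}=q$. Let $R_0$ be the periodic tableau with entry $j+N(m-1)$ in row $j$, column $m$. Then $\overline L(k^N)$ is the irreducible $\mathbb H$-module with basis $v_{\overline R}$, $\overline R$ running over the standard periodic tableaux up to horizontal shift, such that each $v_{\overline R}$ has weight $\operatorname{wt}(R)$, and such that $\pi^Nv_{\overline R_0}=v_{\overline R_0}$. **Theorem.** The module $\mathrm{rect}$ is well defined and uniquely determined by the above formulas; the module $\overline L(k^N)$ exists and is unique up to isomorphism. Moreover: 1. The maximal semisimple quotient of $\overline M(k^N)$ is $\bigoplus_{j=0}^{k-1}\overline L(k^N)^{a^j}$.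 2. For $n$-th roots of unity $b,c\in K$, $\overline L(k^N)^b\cong\overline L(k^N)^c$ if and only if $b^N=c^N$. In particular the $k$ twists in (1) are pairwise non-isomorphic. 3. All twists $\overline L(k^N)^b$ have the same support as $\overline L(k^N)$, and $\pi^Nv_{\overline R_0}=b^Nv_{\overline R_0}$ in $\overline L(k^N)^b$. Conversely, if $M$ is a simple $\mathbb H$-module with $\operatorname{supp}(M)=\operatorname{supp}(\overline L(k^N))$, then $M\cong\overline L(k^N)^{a^j}$ for some $0\le j<k$, the weight space $M[\operatorname{wt}(R_0)]$ is one-dimensional, and, for every $n$-th root of unity $b\in K$, $M\cong\overline L(k^N)^b$ if and only if $\pi^N$ acts on $M[\operatorname{wt}(R_0)]$ as the scalar $b^N$. -/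

import Mathlib

open scoped TensorProduct

noncomputable section

/-! ## Generalities on representations -/

section Representations

variable {K A V : Type*} [Field K] [Ring A] [Algebra K A] [AddCommGroup V] [Module K V]

/-- The vector space `V`, regarded as a left `A`-module through a representation
`ρ : A → End_K(V)`. -/
def RepMod (_ρ : A →ₐ[K] Module.End K V) : Type _ := V

variable (ρ : A →ₐ[K] Module.End K V)

instance RepMod.instAddCommGroup : AddCommGroup (RepMod ρ) := inferInstanceAs (AddCommGroup V)

instance RepMod.instModuleBase : Module K (RepMod ρ) := inferInstanceAs (Module K V)

instance RepMod.instModule : Module A (RepMod ρ) := Module.compHom V ρ.toRingHom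

theorem RepMod.smul_def (x : A) (v : RepMod ρ) : x • v = (ρ x : V → V) v := rfl

instance RepMod.instIsScalarTower : IsScalarTower K A (RepMod ρ) where
  smul_assoc c x v := by
    simp only [RepMod.smul_def, map_smul]
    rfl

/-- The induced module `A ⊗_B V`, for a subalgebra `B` of `A` and a representation
`σ : B → End_K(V)`: the quotient of `A ⊗_K V` by the left `A`-submodule generated by all
`b ⊗ v - 1 ⊗ σ(b) v` with `b ∈ B` and `v ∈ V`. -/
abbrev IndMod (B : Subalgebra K A) (σ : B →ₐ[K] Module.End K V) : Type _ :=
  (A ⊗[K] V) ⧸ Submodule.span A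
    {x : A ⊗[K] V | ∃ (b : B) (v : V), x = (b : A) ⊗ₜ[K] v - (1 : A) ⊗ₜ[K] (σ b v)}

/-- `Q` is the maximal semisimple quotient of `M`: it is semisimple, and there is a surjection
`M → Q` through which every semisimple quotient `M → M ⧸ W` factors. -/
def IsMaximalSemisimpleQuotient (A M Q : Type*) [Ring A] [AddCommGroup M] [Module A M]
    [AddCommGroup Q] [Module A Q] : Prop :=
  IsSemisimpleModule A Q ∧
    ∃ f : M →ₗ[A] Q, Function.Surjective f ∧
      ∀ W : Submodule A M, IsSemisimpleModule A (M ⧸ W) → LinearMap.ker f ≤ W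

end Representations

/-! ## The double affine Hecke algebra of `SL_n` -/

/-- Generators of the algebra.  All indices are taken in `ℤ/n`; in particular `Z 0` stands for
`Z_n`. -/
inductive DAHAGen (n : ℕ) : Type
  | T (i : ZMod n)
  | pi
  | piInv
  | Z (i : ZMod n)
  | Zinv (i : ZMod n)

/-- Defining relations of the algebra with parameters `S`, `t`, `Y` (`S` is the parameter usually
called `q`, normalized for `SL_n`, and `Y` is the inessential parameter that fixes the product of
the `Z_i`).  The braid relations are dropped for `n = 2`. -/
inductive DAHARel {K : Type*} [Field K] (n : ℕ) (S t Y : K) :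
    FreeAlgebra K (DAHAGen n) → FreeAlgebra K (DAHAGen n) → Prop
  | pi_piInv : DAHARel n S t Y (FreeAlgebra.ι K .pi * FreeAlgebra.ι K .piInv) 1
  | piInv_pi : DAHARel n S t Y (FreeAlgebra.ι K .piInv * FreeAlgebra.ι K .pi) 1
  | Z_Zinv (i : ZMod n) :
      DAHARel n S t Y (FreeAlgebra.ι K (.Z i) * FreeAlgebra.ι K (.Zinv i)) 1
  | Zinv_Z (i : ZMod n) :
      DAHARel n S t Y (FreeAlgebra.ι K (.Zinv i) * FreeAlgebra.ι K (.Z i)) 1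
  | Z_comm (i j : ZMod n) :
      DAHARel n S t Y (FreeAlgebra.ι K (.Z i) * FreeAlgebra.ι K (.Z j))
        (FreeAlgebra.ι K (.Z j) * FreeAlgebra.ι K (.Z i))
  | hecke (i : ZMod n) :
      DAHARel n S t Y
        ((FreeAlgebra.ι K (.T i) - algebraMap K _ t) * (FreeAlgebra.ι K (.T i) + algebraMap K _ t⁻¹))
        0
  | braid (hn : n ≠ 2) (i : ZMod n) :
      DAHARel n S t Y
        (FreeAlgebra.ι K (.T i) * FreeAlgebra.ι K (.T (i + 1)) * FreeAlgebra.ι K (.T i))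
        (FreeAlgebra.ι K (.T (i + 1)) * FreeAlgebra.ι K (.T i) * FreeAlgebra.ι K (.T (i + 1)))
  | T_comm (hn : n ≠ 2) (i j : ZMod n) (h₁ : j ≠ i + 1) (h₂ : i ≠ j + 1) :
      DAHARel n S t Y (FreeAlgebra.ι K (.T i) * FreeAlgebra.ι K (.T j))
        (FreeAlgebra.ι K (.T j) * FreeAlgebra.ι K (.T i))
  | pi_T (i : ZMod n) :
      DAHARel n S t Y (FreeAlgebra.ι K .pi * FreeAlgebra.ι K (.T i) * FreeAlgebra.ι K .piInv)
        (FreeAlgebra.ι K (.T (i + 1)))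
  | T_Z_T (i : ZMod n) (hi : i ≠ 0) :
      DAHARel n S t Y (FreeAlgebra.ι K (.T i) * FreeAlgebra.ι K (.Z i) * FreeAlgebra.ι K (.T i))
        (FreeAlgebra.ι K (.Z (i + 1)))
  | T_Z_T_zero :
      DAHARel n S t Y (FreeAlgebra.ι K (.T 0) * FreeAlgebra.ι K (.Z 0) * FreeAlgebra.ι K (.T 0))
        (S ^ (2 * n) • FreeAlgebra.ι K (.Z 1))
  | T_Z_comm (i j : ZMod n) (h₁ : j ≠ i) (h₂ : j ≠ i + 1) :
      DAHARel n S t Y (FreeAlgebra.ι K (.T i) * FreeAlgebra.ι K (.Z j))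
        (FreeAlgebra.ι K (.Z j) * FreeAlgebra.ι K (.T i))
  | Z_prod :
      DAHARel n S t Y ((List.range n).map fun i => FreeAlgebra.ι K (.Z ((i : ZMod n) + 1))).prod
        (algebraMap K _ (S ^ (n * (n - 1)) * Y ^ n))
  | pi_pow : DAHARel n S t Y (FreeAlgebra.ι K .pi ^ n) 1
  | pi_Z (i : ZMod n) (hi : i ≠ 0) :
      DAHARel n S t Y (FreeAlgebra.ι K .pi * FreeAlgebra.ι K (.Z i) * FreeAlgebra.ι K .piInv)
        (S ^ (-2 : ℤ) • FreeAlgebra.ι K (.Z (i + 1)))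
  | pi_Z_zero :
      DAHARel n S t Y (FreeAlgebra.ι K .pi * FreeAlgebra.ι K (.Z 0) * FreeAlgebra.ι K .piInv)
        (S ^ (2 * (n : ℤ) - 2) • FreeAlgebra.ι K (.Z 1))

/-- The double affine Hecke algebra of `SL_n`. -/
def DAHA {K : Type*} [Field K] (n : ℕ) (S t Y : K) : Type _ := RingQuot (DAHARel n S t Y)

namespace DAHA

variable {K : Type*} [Field K] {n : ℕ} {S t Y : K}

instance instRing : Ring (DAHA n S t Y) := inferInstanceAs (Ring (RingQuot _))

instance instAlgebra : Algebra K (DAHA n S t Y) := inferInstanceAs (Algebra K (RingQuot _))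

/-- The quotient map from the free algebra. -/
def mk : FreeAlgebra K (DAHAGen n) →ₐ[K] DAHA n S t Y := RingQuot.mkAlgHom K (DAHARel n S t Y)

theorem mk_rel {x y : FreeAlgebra K (DAHAGen n)} (h : DAHARel n S t Y x y) :
    (mk x : DAHA n S t Y) = mk y := RingQuot.mkAlgHom_rel K h

/-- The generator `T_i`. -/
def T (i : ZMod n) : DAHA n S t Y := mk (FreeAlgebra.ι K (.T i))

/-- The generator `π`. -/
def pi : DAHA n S t Y := mk (FreeAlgebra.ι K .pi)

/-- The generator `Z_i` (with `Z 0 = Z_n`). -/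
def Z (i : ZMod n) : DAHA n S t Y := mk (FreeAlgebra.ι K (.Z i))

/-- The generator `Z_i⁻¹`. -/
def Zinv (i : ZMod n) : DAHA n S t Y := mk (FreeAlgebra.ι K (.Zinv i))

/-- Images of the generators under the twist by `b`. -/
def twistGen (b : Kˣ) : DAHAGen n → DAHA n S t Y
  | .T i => mk (FreeAlgebra.ι K (.T i))
  | .pi => (b : K) • mk (FreeAlgebra.ι K .pi)
  | .piInv => ((b⁻¹ : Kˣ) : K) • mk (FreeAlgebra.ι K .piInv)
  | .Z i => mk (FreeAlgebra.ι K (.Z i))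
  | .Zinv i => mk (FreeAlgebra.ι K (.Zinv i))

theorem twist_rel (b : rootsOfUnity n K) {x y : FreeAlgebra K (DAHAGen n)}
    (h : DAHARel n S t Y x y) :
    FreeAlgebra.lift K (twistGen (S := S) (t := t) (Y := Y) (b : Kˣ)) x =
      FreeAlgebra.lift K (twistGen (S := S) (t := t) (Y := Y) (b : Kˣ)) y := by
  have hb : ((b : Kˣ) : K) ^ n = 1 := by
    have := b.2
    rw [mem_rootsOfUnity] at this
    rw [← Units.val_pow_eq_pow_val, this, Units.val_one]
  have key := mk_rel h
  cases h
  case Z_prod =>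
    rw [map_list_prod, List.map_map] at key ⊢
    simpa [Function.comp_def, twistGen] using key
  case pi_pow =>
    simp only [map_pow, map_one, FreeAlgebra.lift_ι_apply, twistGen, smul_pow, hb, one_smul]
      at key ⊢
    exact key
  all_goals
    simp only [map_mul, map_one, map_sub, map_add, map_smul, map_zero, AlgHom.commutes,
      FreeAlgebra.lift_ι_apply, twistGen, smul_mul_assoc, mul_smul_comm, smul_smul,
      Units.mul_inv, Units.inv_mul, one_smul] at key ⊢
    exact key

/-- The automorphism of the algebra that fixes all `T_i` and `Z_i` and maps `π` to `b π`, where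
`b` is an `n`-th root of unity. -/
def twist (b : rootsOfUnity n K) : DAHA n S t Y →ₐ[K] DAHA n S t Y :=
  RingQuot.liftAlgHom K ⟨FreeAlgebra.lift K (twistGen (b : Kˣ)), fun _ _ h => twist_rel b h⟩

/-- The twist `V^b` of a representation `ρ` on `V` by the above automorphism: `x` acts as
`ρ (twist b x)`, so that the action of `π` is multiplied by `b`. -/
abbrev TwistMod {V : Type*} [AddCommGroup V] [Module K V]
    (ρ : DAHA n S t Y →ₐ[K] Module.End K V) (b : rootsOfUnity n K) : Type _ :=
  RepMod (ρ.comp (twist b))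

/-- The subalgebra `H(𝒵)` generated by `T_1, …, T_{n-1}` and `Z_1^{±1}, …, Z_n^{±1}`. -/
def HZ (n : ℕ) (S t Y : K) : Subalgebra K (DAHA n S t Y) :=
  Algebra.adjoin K ({x | ∃ i : ZMod n, i ≠ 0 ∧ x = T i} ∪ Set.range Z ∪ Set.range Zinv)

variable (n S t Y) (M : Type*) [AddCommGroup M] [Module K M] [Module (DAHA n S t Y) M]
  [IsScalarTower K (DAHA n S t Y) M]

/-- The weight space `M[z]`; the entry `z 0` of a weight is the eigenvalue of `Z_n`. -/
def weightSpace (z : ZMod n → K) : Submodule K M where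
  carrier := {m | ∀ i, (Z i : DAHA n S t Y) • m = z i • m}
  zero_mem' := by simp
  add_mem' := by
    intro x y hx hy i
    rw [smul_add, smul_add, hx i, hy i]
  smul_mem' := by
    intro c x hx i
    rw [smul_comm, hx i, smul_comm]

/-- The support of a module: the set of its weights. -/
def supp : Set (ZMod n → K) := {z | weightSpace n S t Y M z ≠ ⊥}

end DAHA

/-! ## Standard tableaux of rectangular shape and the module `rect` -/

/-- Standard tableaux of shape `(k^N)` (rows and columns are counted from `0`; the entries are
`1, …, N k`). -/
@[ext]
structure SYT (N k : ℕ) where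
  entry : Fin N → Fin k → ℕ
  entry_mem : ∀ r c, entry r c ∈ Finset.Icc 1 (N * k)
  entry_inj : ∀ r c r' c', entry r c = entry r' c' → r = r' ∧ c = c'
  row_lt : ∀ r c c', c < c' → entry r c < entry r c'
  col_lt : ∀ r r' c, r < r' → entry r c < entry r' c

/-- `R'` is obtained from `R` by exchanging the entries `i` and `i + 1`. -/
def SYT.IsSwap {N k : ℕ} (i : ℕ) (R R' : SYT N k) : Prop :=
  ∀ r c, R'.entry r c = Equiv.swap i (i + 1) (R.entry r c)

section Rect

variable {K : Type*} [Field K]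

/-- The diagonal coefficient of `T_i` in the seminormal form, where `d` is the difference of the
contents of the boxes filled with `i` and with `i + 1`. -/
def seminormalCoeff (t : K) (d : ℤ) : K := (t - t⁻¹) / (1 - t ^ (2 * d))

/-- `σ` is the representation `rect` of `H(𝒵)`: the irreducible representation of the finite Hecke
algebra of shape `(k^N)`, in its (Young, Hoefsmit) seminormal form on the basis `v_R` with `R` a
standard tableau of shape `(k^N)`, extended to `H(𝒵)` by letting `Z_1` act as the identity.
The seminormal form is `T_i v_R = α v_R + (t⁻¹ + α) v_{s_i R}`, where
`α = (t - t⁻¹) / (1 - t ^ (2 (c(i) - c(i+1))))`, `c(j)` is the content (column minus row) of the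
box of `R` filled with `j`, and `v_{s_i R} = 0` if `s_i R` is not standard. -/
structure IsRectHZ (N k : ℕ) (S t Y : K)
    (σ : DAHA.HZ (N * k) S t Y →ₐ[K] Module.End K (SYT N k →₀ K)) : Prop where
  Z_one : ∀ x : DAHA.HZ (N * k) S t Y, (x : DAHA (N * k) S t Y) = DAHA.Z 1 → σ x = 1
  T_swap : ∀ (i : ℕ) (x : DAHA.HZ (N * k) S t Y), 1 ≤ i → i < N * k →
    (x : DAHA (N * k) S t Y) = DAHA.T (i : ZMod (N * k)) →
    ∀ (R R' : SYT N k) (r r' : Fin N) (c c' : Fin k), R.IsSwap i R' →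
      R.entry r c = i → R.entry r' c' = i + 1 →
      σ x (Finsupp.single R 1) =
        seminormalCoeff t (((c : ℤ) - r) - ((c' : ℤ) - r')) • Finsupp.single R 1 +
          (t⁻¹ + seminormalCoeff t (((c : ℤ) - r) - ((c' : ℤ) - r'))) • Finsupp.single R' 1
  T_not_swap : ∀ (i : ℕ) (x : DAHA.HZ (N * k) S t Y), 1 ≤ i → i < N * k →
    (x : DAHA (N * k) S t Y) = DAHA.T (i : ZMod (N * k)) →
    ∀ (R : SYT N k) (r r' : Fin N) (c c' : Fin k), (¬ ∃ R', R.IsSwap i R') →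
      R.entry r c = i → R.entry r' c' = i + 1 →
      σ x (Finsupp.single R 1) =
        seminormalCoeff t (((c : ℤ) - r) - ((c' : ℤ) - r')) • Finsupp.single R 1

end Rect

/-! ## Periodic tableaux and the module `L̄(k^N)` -/

/-- Standard `n`-periodic tableaux of shape `(k^N)`, `n = N k`: bijections from `ℤ` to the boxes of
the `N × ∞` strip.  The box `(r, c)` lies in the row number `r + 1` (counted from the top) and in
the column number `c`; the rectangle `μ[0]` consists of the columns `1, …, k`. -/
structure PSYT (N k : ℕ) where
  box : ℤ ≃ Fin N × ℤ
  row_lt : ∀ r c c', c < c' → box.symm (r, c) < box.symm (r, c')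
  col_lt : ∀ r r' c, r < r' → box.symm (r, c) < box.symm (r', c)
  periodic : ∀ i, box (i + (N * k : ℕ)) = ((box i).1, (box i).2 + k)

namespace PSYT

variable {N k : ℕ}

/-- The integer `p` such that the filling sum of `μ[0]` is `(1 + 2 + ⋯ + n) + n p`.  (The
division is exact.) -/
def p (R : PSYT N k) : ℤ :=
  ((∑ r : Fin N, ∑ c ∈ Finset.Icc (1 : ℤ) k, R.box.symm (r, c)) -
    ∑ i ∈ Finset.Icc (1 : ℤ) (N * k : ℕ), i) / (N * k : ℕ)

/-- `N` times the `SL`-diagonal label `column - row + p / N` of the box filled with `i`. -/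
def diagN (R : PSYT N k) (i : ℤ) : ℤ :=
  N * ((R.box i).2 - (((R.box i).1 : ℕ) + 1)) + R.p

/-- Two periodic tableaux are identified if they differ by a horizontal shift of the strip. -/
def shiftSetoid (N k : ℕ) : Setoid (PSYT N k) where
  r R R' := ∃ s : ℤ, ∀ i, R'.box i = ((R.box i).1, (R.box i).2 + s)
  iseqv :=
    { refl := fun R => ⟨0, fun i => by simp⟩
      symm := by
        rintro R R' ⟨s, h⟩
        exact ⟨-s, fun i => by rw [h i]; simp⟩
      trans := by
        rintro R R' R'' ⟨s, h⟩ ⟨s', h'⟩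
        exact ⟨s + s', fun i => by rw [h' i, h i]; simp [add_assoc]⟩ }

/-- The periodic tableau `R₀` whose columns are filled with consecutive integers: the box in row
`r + 1` and column `c` contains `r + 1 + N (c - 1)`. -/
def R₀ (N k : ℕ) [NeZero N] : PSYT N k where
  box :=
    { toFun := fun i => (⟨((i - 1) % N).toNat, by
          have h0 : (N : ℤ) ≠ 0 := by exact_mod_cast NeZero.ne N
          have h1 := Int.emod_nonneg (i - 1) h0
          have h2 := Int.emod_lt_of_pos (i - 1) (by positivity : (0 : ℤ) < N)
          omega⟩, (i - 1) / N + 1)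
      invFun := fun b => (b.1 : ℤ) + 1 + N * (b.2 - 1)
      left_inv := fun i => by
        have h0 : (N : ℤ) ≠ 0 := by exact_mod_cast NeZero.ne N
        have h1 := Int.emod_nonneg (i - 1) h0
        have h2 := Int.emod_add_mul_ediv (i - 1) N
        simp only [Int.toNat_of_nonneg h1]
        linarith
      right_inv := fun b => by
        obtain ⟨r, c⟩ := b
        have h0 : (N : ℤ) ≠ 0 := by exact_mod_cast NeZero.ne N
        have e : ((r : ℕ) : ℤ) + 1 + N * (c - 1) - 1 = (r : ℕ) + N * (c - 1) := by ring
        have hr : ((r : ℕ) : ℤ) < N := by exact_mod_cast r.2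
        have hr0 : (0 : ℤ) ≤ ((r : ℕ) : ℤ) := by positivity
        simp only [e, Int.add_mul_emod_self_left, Int.add_mul_ediv_left _ _ h0,
          Int.emod_eq_of_lt hr0 hr, Int.ediv_eq_zero_of_lt hr0 hr]
        ext <;> simp }
  row_lt := by
    intro r c c' h
    have hN : (0 : ℤ) < N := by exact_mod_cast Nat.pos_of_neZero N
    simp only [Equiv.coe_fn_symm_mk]
    nlinarith
  col_lt := by
    intro r r' c h
    have h' : ((r : ℕ) : ℤ) < ((r' : ℕ) : ℤ) := by exact_mod_cast h
    simp only [Equiv.coe_fn_symm_mk]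
    linarith
  periodic := by
    intro i
    have h0 : (N : ℤ) ≠ 0 := by exact_mod_cast NeZero.ne N
    have e : i + ((N * k : ℕ) : ℤ) - 1 = (i - 1) + N * k := by push_cast; ring
    simp only [Equiv.coe_fn_mk, e, Int.add_mul_emod_self_left, Int.add_mul_ediv_left _ _ h0]
    ext <;> simp
    ring

/-- The representative of a class modulo `n` in `{1, …, n}`. -/
def rep {n : ℕ} (i : ZMod n) : ℤ := if i = 0 then n else i.val

/-- The weight `(t ^ (2 diag(1)), …, t ^ (2 diag(n)))` of a periodic tableau, where the `N`-th root
of `t` is `S` and `diag` is the `SL`-diagonal label. -/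
def wt {K : Type*} [Field K] (S : K) (R : PSYT N k) : ZMod (N * k) → K :=
  fun i => S ^ (2 * R.diagN (rep i))

end PSYT

/-- Periodic tableaux up to horizontal shifts. -/
abbrev PSYTBar (N k : ℕ) : Type := Quotient (PSYT.shiftSetoid N k)

/-- `ρ` is the rectangular representation `L̄(k^N)`: an irreducible representation on the vector
space with basis `v_R`, `R` running through the periodic tableaux up to horizontal shift, such that
each `v_R` is a weight vector of weight `wt(R)`, and such that `π^N v_{R₀} = v_{R₀}`. -/
structure IsRectRep {K : Type*} [Field K] (N k : ℕ) [NeZero N] (S t Y : K)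
    (ρ : DAHA (N * k) S t Y →ₐ[K] Module.End K (PSYTBar N k →₀ K)) : Prop where
  irreducible : IsSimpleModule (DAHA (N * k) S t Y) (RepMod ρ)
  weight : ∀ (R : PSYT N k) (i : ZMod (N * k)),
    ρ (DAHA.Z i) (Finsupp.single ⟦R⟧ 1) = R.wt S i • Finsupp.single ⟦R⟧ 1
  pi_pow : ρ (DAHA.pi ^ N) (Finsupp.single ⟦PSYT.R₀ N k⟧ 1) = Finsupp.single ⟦PSYT.R₀ N k⟧ 1

end

/-! A class of standard periodic tableaux is determined by its labels N·diag(i), i ∈ ℤ, and the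
weight determines the labels because q is not a root of unity. Everything is done with joint
eigenvectors of the Z_i.

Existence of L̄(k^N). The seminormal formulas make sense on the space with basis all integer
sequences, where T_i exchanges the values at i and i+1 (periodically) and π rotates. The relations
become rational identities in powers of q (`swapCoeff_mul`, `diagCoeff_add`), valid where values at
distance one and two differ, as is the case for labels. If i and i+1 are neighbours in a row or
column, the coefficient of the exchanged sequence vanishes, so the sequences of tableaux span a
stable subspace (`swapCoeff_eq_zero_or`). It is irreducible: the weights are distinct, so a non-zero
submodule contains a basis vector, and rotations together with exchanges with non-zero coefficient
connect all classes to R₀ (`induction_diag`, `eq_top_of_invariant`).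

Uniqueness. Call x a column vector if it has weight wt(R₀), T_i x = -t⁻¹x for N ∤ i, and π^N x = βx.
Any module generated by x is spanned by reduced words in the T_i applied to the π^j x. A Hecke
version of the exchange condition (`exchange`) filters it by length, and the Z_i act triangularly,
with eigenvalues read off from a filling whose columns increase (`IsWord.Zi_smul_sub_mem`). Such a
filling has the weight of R₀ only if it is a horizontal shift of R₀, and then the word is a power of
π^N applied to x. Hence the weight space of x is the line Kx (`smul_mem_span_of_weight`). For simple
modules with column vectors x, x' and the same β, the submodule generated by (x, x') is therefore
the graph of an isomorphism (`nonempty_equiv_of_isColumnVector`). So β classifies these modules, and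
the twist by b has β = b^N.

Simple modules with the support of L̄. For x of weight wt(R₀), the vector T_i x + t⁻¹x has the
exchanged weight, which no tableau has when N ∤ i (`PSYT.diagN_ne_comp_aswap`); so it is zero. Since
π^N preserves the weight space and its k-th power is 1, some vector there is an eigenvector of π^N,
with eigenvalue a power of a^N. It is a column vector, so the module is one of the k twists.

The induced module. `rect` is the restriction of the model to the periodic extensions of the
tableaux of shape (k^N), and v_{R₀} generates it. The vector 1 ⊗ v_{R₀} satisfies all conditions on
a column vector except the one on π^N. Hence every simple quotient is one of the k twists, and the
kernel of the joint map to all of them lies in the radical. The joint map is onto because the k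
eigenvalues of π^N are distinct. -/

set_option linter.unusedSectionVars false

/-! ## Periodic transpositions of `ℤ` -/

/-- The permutation of `ℤ` that exchanges `j` and `j + 1` for all `j ≡ i` modulo `n` (it is the
identity if `n = 1`). -/
def aswap (n : ℕ) (i : ℤ) : Equiv.Perm ℤ :=
  Function.Involutive.toPerm
    (fun j => if (n : ℤ) ∣ 1 then j else if (n : ℤ) ∣ j - i then j + 1
      else if (n : ℤ) ∣ j - i - 1 then j - 1 else j) <| by
    intro j
    by_cases h1 : (n : ℤ) ∣ 1
    · simp [h1]
    by_cases h2 : (n : ℤ) ∣ j - i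
    · have h3 : ¬ (n : ℤ) ∣ j + 1 - i := fun h => h1 (by
        have := dvd_sub h h2; rwa [show j + 1 - i - (j - i) = 1 by ring] at this)
      have h4 : (n : ℤ) ∣ j + 1 - i - 1 := by rwa [show j + 1 - i - 1 = j - i by ring]
      simp [h1, h2, h3, h4]
    by_cases h3 : (n : ℤ) ∣ j - i - 1
    · have h4 : (n : ℤ) ∣ j - 1 - i := by rwa [show j - 1 - i = j - i - 1 by ring]
      simp [h1, h2, h3, h4]
    · simp [h1, h2, h3]

section ASwap

variable {n : ℕ} {i j : ℤ}

theorem aswap_apply (n : ℕ) (i j : ℤ) :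
    aswap n i j = if (n : ℤ) ∣ 1 then j else if (n : ℤ) ∣ j - i then j + 1
      else if (n : ℤ) ∣ j - i - 1 then j - 1 else j := rfl

theorem aswap_aswap (n : ℕ) (i j : ℤ) : aswap n i (aswap n i j) = j :=
  (aswap n i).left_inv j

theorem aswap_left (h1 : ¬ (n : ℤ) ∣ 1) (h : (n : ℤ) ∣ j - i) : aswap n i j = j + 1 := by
  simp [aswap_apply, h1, h]

theorem aswap_right (h1 : ¬ (n : ℤ) ∣ 1) (h : (n : ℤ) ∣ j - i - 1) : aswap n i j = j - 1 := by
  have h3 : ¬ (n : ℤ) ∣ j - i := fun h2 => h1 (by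
    have := dvd_sub h2 h; rwa [show j - i - (j - i - 1) = 1 by ring] at this)
  simp [aswap_apply, h1, h, h3]

theorem aswap_other (h : ¬ (n : ℤ) ∣ j - i) (h' : ¬ (n : ℤ) ∣ j - i - 1) : aswap n i j = j := by
  simp [aswap_apply, h, h']

theorem aswap_self (h1 : ¬ (n : ℤ) ∣ 1) (i : ℤ) : aswap n i i = i + 1 :=
  aswap_left h1 (by simp)

theorem aswap_succ (h1 : ¬ (n : ℤ) ∣ 1) (i : ℤ) : aswap n i (i + 1) = i := by
  rw [aswap_right h1 (by simp)]; ring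

theorem aswap_cases (h1 : ¬ (n : ℤ) ∣ 1) (i j : ℤ) :
    ((n : ℤ) ∣ j - i ∧ aswap n i j = j + 1) ∨ ((n : ℤ) ∣ j - i - 1 ∧ aswap n i j = j - 1) ∨
      (¬ (n : ℤ) ∣ j - i ∧ ¬ (n : ℤ) ∣ j - i - 1 ∧ aswap n i j = j) := by
  by_cases h : (n : ℤ) ∣ j - i
  · exact Or.inl ⟨h, aswap_left h1 h⟩
  by_cases h' : (n : ℤ) ∣ j - i - 1
  · exact Or.inr (Or.inl ⟨h', aswap_right h1 h'⟩)
  · exact Or.inr (Or.inr ⟨h, h', aswap_other h h'⟩)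

theorem aswap_add (n : ℕ) (i j : ℤ) : aswap n i (j + n) = aswap n i j + n := by
  have e1 : (n : ℤ) ∣ j + n - i ↔ (n : ℤ) ∣ j - i := by
    rw [show j + n - i = j - i + n by ring, dvd_add_self_right]
  have e2 : (n : ℤ) ∣ j + n - i - 1 ↔ (n : ℤ) ∣ j - i - 1 := by
    rw [show j + n - i - 1 = j - i - 1 + n by ring, dvd_add_self_right]
  simp only [aswap_apply, e1, e2]
  split_ifs <;> ring

theorem aswap_congr {i' : ℤ} (h : (n : ℤ) ∣ i - i') : aswap n i = aswap n i' := by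
  ext j
  have e1 : (n : ℤ) ∣ j - i ↔ (n : ℤ) ∣ j - i' := by
    rw [show j - i' = j - i + (i - i') by ring]; exact (dvd_add_left h).symm
  have e2 : (n : ℤ) ∣ j - i - 1 ↔ (n : ℤ) ∣ j - i' - 1 := by
    rw [show j - i' - 1 = j - i - 1 + (i - i') by ring]; exact (dvd_add_left h).symm
  simp only [aswap_apply, e1, e2]

/-- Exchanging neighbours reverses only the pairs that are themselves exchanged. This is what
preserves the monotonicity of rows and columns. -/
theorem aswap_lt {e e' : ℤ} (h : e < e') (h' : ¬ (e' = e + 1 ∧ (n : ℤ) ∣ e - i)) :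
    aswap n i e < aswap n i e' := by
  by_cases h1 : (n : ℤ) ∣ 1
  · simpa [aswap_apply, h1] using h
  have hne : aswap n i e ≠ aswap n i e' := fun H => h.ne ((aswap n i).injective H)
  rcases aswap_cases h1 i e with ⟨a, b⟩ | ⟨a, b⟩ | ⟨a, a', b⟩ <;>
  rcases aswap_cases h1 i e' with ⟨c, d⟩ | ⟨c, d⟩ | ⟨c, c', d⟩
  · omega
  · by_cases h2 : e' = e + 1
    · exact absurd ⟨h2, a⟩ h'
    · by_cases h3 : e' = e + 2
      · subst h3
        exact absurd (show (n : ℤ) ∣ 1 by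
          have := dvd_sub c a; rwa [show e + 2 - i - 1 - (e - i) = 1 by ring] at this) h1
      · omega
  all_goals omega

end ASwap

/-- Telescoping. It is applied to functions with equal values at 0 and n, or with a known increment,
to compare sums over one period. -/
theorem sum_Icc_sub_pred (f : ℤ → ℤ) (n : ℕ) :
    ∑ i ∈ Finset.Icc (1 : ℤ) n, (f i - f (i - 1)) = f n - f 0 := by
  induction n with
  | zero => simp
  | succ n ih =>
    have : Finset.Icc (1 : ℤ) ((n + 1 : ℕ) : ℤ) = insert ((n : ℤ) + 1) (Finset.Icc (1 : ℤ) n) := by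
      ext x; simp only [Finset.mem_Icc, Finset.mem_insert]; push_cast; omega
    rw [this, Finset.sum_insert (by simp), ih]
    push_cast
    simp

theorem exists_mem_Icc_dvd (n : ℕ) [NeZero n] (i : ℤ) :
    ∃ j ∈ Finset.Icc (1 : ℤ) n, (n : ℤ) ∣ j - i := by
  have h0 : (n : ℤ) ≠ 0 := by exact_mod_cast NeZero.ne n
  have hp : (0 : ℤ) < n := by have := Nat.pos_of_neZero n; exact_mod_cast this
  have h1 := Int.emod_nonneg (i - 1) h0
  have h2 := Int.emod_lt_of_pos (i - 1) hp
  refine ⟨(i - 1) % n + 1, by simp; omega, ?_⟩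
  have h3 := Int.emod_add_mul_ediv (i - 1) n
  exact ⟨-((i - 1) / n), by linarith⟩

/-! ## Periodic bijections onto the boxes of the strip -/

section PeriodicBijection

variable {N k : ℕ}

/-- Periodicity of a bijection from `ℤ` to the boxes of the strip. -/
def BoxPeriodic (k : ℕ) (B : ℤ ≃ Fin N × ℤ) : Prop :=
  ∀ i, B (i + (N * k : ℕ)) = ((B i).1, (B i).2 + k)

/-- The entries increase down the columns. -/
def ColIncreasing (B : ℤ ≃ Fin N × ℤ) : Prop :=
  ∀ r r' c, r < r' → B.symm (r, c) < B.symm (r', c)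

variable {B : ℤ ≃ Fin N × ℤ}

theorem BoxPeriodic.add_mul (hB : BoxPeriodic k B) (i m : ℤ) :
    B (i + (N * k : ℕ) * m) = ((B i).1, (B i).2 + k * m) := by
  induction m using Int.induction_on with
  | zero => simp
  | succ m ih =>
    rw [show i + ((N * k : ℕ) : ℤ) * ((m : ℤ) + 1) = i + ((N * k : ℕ) : ℤ) * m + (N * k : ℕ) by ring,
      hB, ih]
    ext <;> simp; ring
  | pred m ih =>
    have := hB (i + ((N * k : ℕ) : ℤ) * (-(m : ℤ) - 1))
    rw [show i + ((N * k : ℕ) : ℤ) * (-(m : ℤ) - 1) + (N * k : ℕ) = i + ((N * k : ℕ) : ℤ) * (-m) by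
      ring, ih] at this
    have h1 := congrArg Prod.fst this
    have h2 := congrArg Prod.snd this
    simp only at h1 h2
    ext
    · simp [h1]
    · simp only; linarith

theorem BoxPeriodic.symm_add_mul (hB : BoxPeriodic k B) (r : Fin N) (c m : ℤ) :
    B.symm (r, c + k * m) = B.symm (r, c) + (N * k : ℕ) * m := by
  rw [Equiv.symm_apply_eq, hB.add_mul]; simp

theorem BoxPeriodic.symm_add (hB : BoxPeriodic k B) (r : Fin N) (c : ℤ) :
    B.symm (r, c + k) = B.symm (r, c) + (N * k : ℕ) := by
  simpa using hB.symm_add_mul r c 1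

theorem BoxPeriodic.trans_perm (hB : BoxPeriodic k B) (i : ℤ) :
    BoxPeriodic k ((aswap (N * k) i).trans B) := by
  intro j
  simp only [Equiv.trans_apply, aswap_add, hB _]

theorem apply_add_mul {M : Type*} {N k : ℕ} {F : Fin N × ℤ → M}
    (hF : ∀ r c, F (r, c + k) = F (r, c)) (r : Fin N) (c m : ℤ) : F (r, c + k * m) = F (r, c) := by
  induction m using Int.induction_on with
  | zero => simp
  | succ m ih => rw [mul_add, mul_one, ← add_assoc, hF, ih]
  | pred m ih => rw [← ih, ← hF r (c + k * (-(m : ℤ) - 1))]; congr 2; ring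

/-- The boxes of 1, …, n and the rectangle of columns 1, …, k are two fundamental domains for the
horizontal translation by k, so a k-periodic function has the same sum over both. -/
theorem BoxPeriodic.sum_box [NeZero N] [NeZero k] (hB : BoxPeriodic k B)
    {M : Type*} [AddCommMonoid M] (F : Fin N × ℤ → M) (hF : ∀ r c, F (r, c + k) = F (r, c)) :
    ∑ i ∈ Finset.Icc (1 : ℤ) (N * k : ℕ), F (B i) =
      ∑ r : Fin N, ∑ c ∈ Finset.Icc (1 : ℤ) k, F (r, c) := by
  have hn : (((N * k : ℕ) : ℕ) : ℤ) ≠ 0 := by exact_mod_cast NeZero.ne (N * k)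
  have hn' : (0 : ℤ) < ((N * k : ℕ) : ℤ) := by
    have := Nat.pos_of_neZero (N * k); exact_mod_cast this
  have hk : (k : ℤ) ≠ 0 := by exact_mod_cast NeZero.ne k
  have hk' : (0 : ℤ) < k := by have := Nat.pos_of_neZero k; exact_mod_cast this
  rw [← Finset.sum_product']
  -- Boxes are translated into columns 1, …, k and entries into 1, …, n; the shifts by 1 choose
  -- representatives starting at 1 instead of 0.
  refine Finset.sum_bij' (fun i _ => ((B i).1, ((B i).2 - 1) % k + 1))
    (fun b _ => (B.symm b - 1) % (N * k : ℕ) + 1) ?_ ?_ ?_ ?_ ?_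
  · intro i _
    have h1 := Int.emod_nonneg ((B i).2 - 1) hk
    have h2 := Int.emod_lt_of_pos ((B i).2 - 1) hk'
    simp only [Finset.mem_product, Finset.mem_univ, Finset.mem_Icc, true_and]
    omega
  · intro b _
    have h1 := Int.emod_nonneg (B.symm b - 1) hn
    have h2 := Int.emod_lt_of_pos (B.symm b - 1) hn'
    simp only [Finset.mem_Icc]
    omega
  · intro i hi
    simp only [Finset.mem_Icc] at hi
    have e : ((B i).2 - 1) % k + 1 = (B i).2 + k * (-(((B i).2 - 1) / k)) := by
      have := Int.emod_add_mul_ediv ((B i).2 - 1) k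
      linarith
    simp only [e, hB.symm_add_mul, Prod.mk.eta, Equiv.symm_apply_apply]
    rw [show i + ((N * k : ℕ) : ℤ) * (-(((B i).2 - 1) / k)) - 1 =
      (i - 1) + ((N * k : ℕ) : ℤ) * (-(((B i).2 - 1) / k)) by ring, Int.add_mul_emod_self_left,
      Int.emod_eq_of_lt (by omega) (by omega)]
    ring
  · rintro ⟨r, c⟩ hb
    simp only [Finset.mem_product, Finset.mem_univ, Finset.mem_Icc, true_and] at hb
    have e : (B.symm (r, c) - 1) % (N * k : ℕ) + 1 =
        B.symm (r, c) + (N * k : ℕ) * (-((B.symm (r, c) - 1) / (N * k : ℕ))) := by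
      have := Int.emod_add_mul_ediv (B.symm (r, c) - 1) (N * k : ℕ)
      linarith
    simp only [e, hB.add_mul, Equiv.apply_symm_apply]
    ext
    · rfl
    · simp only
      rw [show c + (k : ℤ) * (-((B.symm (r, c) - 1) / (N * k : ℕ))) - 1 =
        (c - 1) + (k : ℤ) * (-((B.symm (r, c) - 1) / (N * k : ℕ))) by ring,
        Int.add_mul_emod_self_left, Int.emod_eq_of_lt (by omega) (by omega)]
      ring
  · intro i _
    have e : ((B i).2 - 1) % k + 1 = (B i).2 + k * (-(((B i).2 - 1) / k)) := by
      have := Int.emod_add_mul_ediv ((B i).2 - 1) k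
      linarith
    rw [e, apply_add_mul hF]

end PeriodicBijection

/-! ### Contents, the number p, rotations and exchanges of periodic tableaux -/

namespace PSYT

variable {N k : ℕ}

theorem boxPeriodic (R : PSYT N k) : BoxPeriodic k R.box := R.periodic

theorem colIncreasing (R : PSYT N k) : ColIncreasing R.box := R.col_lt

theorem mono (R : PSYT N k) {r r' : Fin N} {c c' : ℤ} (hr : r ≤ r') (hc : c ≤ c') :
    R.box.symm (r, c) ≤ R.box.symm (r', c') := by
  have h1 : R.box.symm (r, c) ≤ R.box.symm (r', c) := by
    rcases hr.eq_or_lt with rfl | h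
    · exact le_rfl
    · exact (R.col_lt _ _ _ h).le
  have h2 : R.box.symm (r', c) ≤ R.box.symm (r', c') := by
    rcases hc.eq_or_lt with rfl | h
    · exact le_rfl
    · exact (R.row_lt _ _ _ h).le
  exact h1.trans h2

theorem le_of_box_le (R : PSYT N k) {i j : ℤ} (hr : (R.box i).1 ≤ (R.box j).1)
    (hc : (R.box i).2 ≤ (R.box j).2) : i ≤ j := by
  simpa using R.mono hr hc

/-- The boxes of `i` and `i + 1` lie in different rows and columns. -/
def Free (R : PSYT N k) (i : ℤ) : Prop :=
  (R.box i).1 ≠ (R.box (i + 1)).1 ∧ (R.box i).2 ≠ (R.box (i + 1)).2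

/-- A box between the two would carry an integer strictly between i and i + 1. -/
theorem snd_succ_of_fst_eq (R : PSYT N k) {i : ℤ} (h : (R.box i).1 = (R.box (i + 1)).1) :
    (R.box (i + 1)).2 = (R.box i).2 + 1 := by
  have h1 : (R.box i).2 < (R.box (i + 1)).2 := by
    by_contra! h2
    have := R.le_of_box_le h.ge h2
    omega
  by_contra h2
  have a := R.row_lt (R.box i).1 (R.box i).2 ((R.box i).2 + 1) (by omega)
  have b := R.row_lt (R.box i).1 ((R.box i).2 + 1) (R.box (i + 1)).2 (by omega)
  simp only [Prod.mk.eta, Equiv.symm_apply_apply] at a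
  rw [h] at b
  simp only [Prod.mk.eta, Equiv.symm_apply_apply] at b
  rw [h] at a
  omega

theorem fst_succ_of_snd_eq (R : PSYT N k) {i : ℤ} (h : (R.box i).2 = (R.box (i + 1)).2) :
    ((R.box (i + 1)).1 : ℕ) = ((R.box i).1 : ℕ) + 1 := by
  have h1 : (R.box i).1 < (R.box (i + 1)).1 := by
    by_contra! h2
    have := R.le_of_box_le h2 h.ge
    omega
  have h1' : ((R.box i).1 : ℕ) < (R.box (i + 1)).1 := h1
  by_contra h2
  have h3 := (R.box (i + 1)).1.2
  have a := R.col_lt (R.box i).1 ⟨(R.box i).1 + 1, by omega⟩ (R.box i).2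
    (Fin.lt_def.mpr (by simp))
  have b := R.col_lt ⟨(R.box i).1 + 1, by omega⟩ (R.box (i + 1)).1 (R.box i).2
    (Fin.lt_def.mpr (by simp only; omega))
  simp only [Prod.mk.eta, Equiv.symm_apply_apply] at a
  nth_rewrite 2 [h] at b
  simp only [Prod.mk.eta, Equiv.symm_apply_apply] at b
  omega

/-- The content (column minus row) of the box filled with `i`, up to a constant. -/
def content (R : PSYT N k) (i : ℤ) : ℤ := (R.box i).2 - ((R.box i).1 : ℕ)

theorem diagN_eq (R : PSYT N k) (i : ℤ) : R.diagN i = N * R.content i + (R.p - N) := by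
  rw [diagN, content]; ring

theorem content_succ_of_fst_eq (R : PSYT N k) {i : ℤ} (h : (R.box i).1 = (R.box (i + 1)).1) :
    R.content i - R.content (i + 1) = -1 := by
  rw [content, content, R.snd_succ_of_fst_eq h, h]; ring

theorem content_succ_of_snd_eq (R : PSYT N k) {i : ℤ} (h : (R.box i).2 = (R.box (i + 1)).2) :
    R.content i - R.content (i + 1) = 1 := by
  rw [content, content, R.fst_succ_of_snd_eq h, h]; push_cast; ring

/-- One box lies strictly north-east of the other: with i strictly north-west of i + 1, a corner of
the rectangle they span would carry an integer strictly in between, and the opposite position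
contradicts monotonicity. -/
theorem Free.content_sub {R : PSYT N k} {i : ℤ} (h : R.Free i) :
    2 ≤ R.content i - R.content (i + 1) ∨ R.content i - R.content (i + 1) ≤ -2 := by
  obtain ⟨h1, h2⟩ := h
  rw [content, content]
  have h1' : ((R.box i).1 : ℕ) ≠ (R.box (i + 1)).1 := fun H => h1 (Fin.ext H)
  by_cases hr : (R.box (i + 1)).1 ≤ (R.box i).1
  · have hr' : ((R.box (i + 1)).1 : ℕ) ≤ (R.box i).1 := hr
    by_cases hc : (R.box (i + 1)).2 ≤ (R.box i).2
    · have := R.le_of_box_le hr hc; omega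
    · omega
  · have hr' : ¬ ((R.box (i + 1)).1 : ℕ) ≤ (R.box i).1 := hr
    by_cases hc : (R.box i).2 ≤ (R.box (i + 1)).2
    · exfalso
      have a := R.col_lt (R.box i).1 (R.box (i + 1)).1 (R.box i).2 (not_le.mp hr)
      have b := R.row_lt (R.box (i + 1)).1 (R.box i).2 (R.box (i + 1)).2 (lt_of_le_of_ne hc h2)
      simp only [Prod.mk.eta, Equiv.symm_apply_apply] at a b
      omega
    · omega

theorem content_ne_succ (R : PSYT N k) (i : ℤ) : R.content i ≠ R.content (i + 1) := by
  by_cases h1 : (R.box i).1 = (R.box (i + 1)).1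
  · have := R.content_succ_of_fst_eq h1; omega
  by_cases h2 : (R.box i).2 = (R.box (i + 1)).2
  · have := R.content_succ_of_snd_eq h2; omega
  have := Free.content_sub (R := R) ⟨h1, h2⟩
  omega

/-- If i and i + 2 were on one diagonal, both off-diagonal corners of the square they span would
have to contain i + 1. Together with `content_ne_succ` this keeps all denominators in the braid
relation non-zero. -/
theorem content_ne_add_two (R : PSYT N k) (i : ℤ) : R.content i ≠ R.content (i + 2) := by
  intro h
  rw [content, content] at h
  rcases lt_trichotomy (R.box i).1 (R.box (i + 2)).1 with hr | hr | hr
  · have hr' : ((R.box i).1 : ℕ) < (R.box (i + 2)).1 := hr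
    have a1 := R.col_lt (R.box i).1 (R.box (i + 2)).1 (R.box i).2 hr
    have a2 := R.row_lt (R.box (i + 2)).1 (R.box i).2 (R.box (i + 2)).2 (by omega)
    have b1 := R.row_lt (R.box i).1 (R.box i).2 (R.box (i + 2)).2 (by omega)
    have b2 := R.col_lt (R.box i).1 (R.box (i + 2)).1 (R.box (i + 2)).2 hr
    simp only [Prod.mk.eta, Equiv.symm_apply_apply] at a1 a2 b1 b2
    have : R.box.symm ((R.box (i + 2)).1, (R.box i).2) =
      R.box.symm ((R.box i).1, (R.box (i + 2)).2) := by omega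
    have := congrArg Prod.fst (R.box.symm.injective this)
    simp only at this
    exact hr.ne' this
  · have h2 : (R.box i).2 = (R.box (i + 2)).2 := by rw [hr] at h; omega
    have : R.box i = R.box (i + 2) := Prod.ext hr h2
    have := R.box.injective this
    omega
  · have hr' : ((R.box (i + 2)).1 : ℕ) < (R.box i).1 := hr
    have := R.le_of_box_le hr.le (by omega : (R.box (i + 2)).2 ≤ (R.box i).2)
    omega

/-- Rotation: the entries are increased by `j`. -/
def rot (j : ℤ) (R : PSYT N k) : PSYT N k where
  box := (Equiv.subRight j).trans R.box
  row_lt r c c' h := by simpa using R.row_lt r c c' h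
  col_lt r r' c h := by simpa using R.col_lt r r' c h
  periodic i := by
    have := R.periodic (i - j)
    simp only [Equiv.trans_apply, Equiv.subRight_apply]
    rw [← this]
    congr 1; ring

@[simp]
theorem rot_box (j : ℤ) (R : PSYT N k) (i : ℤ) : (R.rot j).box i = R.box (i - j) := rfl

theorem Free.congr {R : PSYT N k} {i j : ℤ} (h : ((N * k : ℕ) : ℤ) ∣ j - i) (hi : R.Free i) :
    R.Free j := by
  obtain ⟨m, hm⟩ := h
  obtain rfl : j = i + (N * k : ℕ) * m := by linarith
  have e : i + ((N * k : ℕ) : ℤ) * m + 1 = (i + 1) + (N * k : ℕ) * m := by ring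
  have h1 := R.boxPeriodic.add_mul i m
  have h2 := R.boxPeriodic.add_mul (i + 1) m
  rw [← e] at h2
  refine ⟨?_, ?_⟩
  · rw [h1, h2]; exact hi.1
  · rw [h1, h2]; simpa using hi.2

/-- If n = 1 there is only one row, so no two boxes lie in different rows. -/
theorem Free.not_dvd [NeZero k] {R : PSYT N k} {i : ℤ} (h : R.Free i) :
    ¬ ((N * k : ℕ) : ℤ) ∣ 1 := by
  intro H
  have : N * k = 1 := by
    have := Int.natCast_dvd_natCast.mp (by exact_mod_cast H : ((N * k : ℕ) : ℤ) ∣ ((1 : ℕ) : ℤ))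
    exact Nat.dvd_one.mp this
  have hN := Nat.eq_one_of_mul_eq_one_right this
  subst hN
  exact h.1 (Subsingleton.elim _ _)

/-- Exchange of the entries `i` and `i + 1`, periodically. -/
def swap (R : PSYT N k) (i : ℤ) (h : R.Free i) : PSYT N k where
  box := (aswap (N * k) i).trans R.box
  row_lt r c c' hc := by
    refine aswap_lt (R.row_lt r c c' hc) ?_
    rintro ⟨h1, h2⟩
    have := (h.congr h2).1
    rw [← h1] at this
    simp at this
  col_lt r r' c hr := by
    refine aswap_lt (R.col_lt r r' c hr) ?_
    rintro ⟨h1, h2⟩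
    have := (h.congr h2).2
    rw [← h1] at this
    simp at this
  periodic := R.boxPeriodic.trans_perm i

/-- Modulo n the entries are k-periodic in the column, so the rectangle has the same entry sum
modulo n as 1, …, n. This makes the division in `p` exact. -/
theorem dvd_entry_sum [NeZero N] [NeZero k] (R : PSYT N k) : ((N * k : ℕ) : ℤ) ∣
    (∑ r : Fin N, ∑ c ∈ Finset.Icc (1 : ℤ) k, R.box.symm (r, c)) -
      ∑ i ∈ Finset.Icc (1 : ℤ) (N * k : ℕ), i := by
  rw [← ZMod.intCast_zmod_eq_zero_iff_dvd]
  have := R.boxPeriodic.sum_box (fun b => ((R.box.symm b : ℤ) : ZMod (N * k))) (by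
    intro r c
    rw [R.boxPeriodic.symm_add]
    push_cast
    have : ((N : ZMod (N * k)) * (k : ZMod (N * k))) = 0 := by
      exact_mod_cast ZMod.natCast_self (N * k)
    rw [this, add_zero])
  simp only [Equiv.symm_apply_apply] at this
  push_cast
  push_cast at this
  rw [← this, sub_self]

/-- The function k·entry − n·column is k-periodic. Comparing its sums over the two fundamental
domains replaces the entries of the rectangle by the columns of 1, …, n, which are easier to follow
under rotations and exchanges. -/
theorem k_mul_p [NeZero N] [NeZero k] (R : PSYT N k) :
    k * R.p = N * ∑ c ∈ Finset.Icc (1 : ℤ) k, c -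
      ∑ i ∈ Finset.Icc (1 : ℤ) (N * k : ℕ), (R.box i).2 := by
  have hn : (((N * k : ℕ) : ℕ) : ℤ) ≠ 0 := by exact_mod_cast NeZero.ne (N * k)
  have h1 : ((N * k : ℕ) : ℤ) * R.p = _ := Int.mul_ediv_cancel' R.dvd_entry_sum
  have h2 := R.boxPeriodic.sum_box (fun b => k * R.box.symm b - (N * k : ℕ) * b.2) (by
    intro r c
    rw [R.boxPeriodic.symm_add]
    ring)
  simp only [Equiv.symm_apply_apply, Finset.sum_sub_distrib, ← Finset.mul_sum, Finset.sum_const,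
    Finset.card_univ, Fintype.card_fin, nsmul_eq_mul] at h2
  apply mul_left_cancel₀ hn
  have h3 : ∑ x ∈ Finset.Icc (1 : ℤ) (N * k : ℕ), (k : ℤ) * x = k * ∑ x ∈ _, x :=
    (Finset.mul_sum _ _ _).symm
  have h4 : ∑ x ∈ Finset.Icc (1 : ℤ) k, ((N * k : ℕ) : ℤ) * x = (N * k : ℕ) * ∑ x ∈ _, x :=
    (Finset.mul_sum _ _ _).symm
  linear_combination k * h1 - h2 + h3 + N * h4

theorem sum_fst [NeZero N] [NeZero k] (R : PSYT N k) :
    ∑ i ∈ Finset.Icc (1 : ℤ) (N * k : ℕ), (((R.box i).1 : ℕ) : ℤ) =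
      k * ∑ r : Fin N, ((r : ℕ) : ℤ) := by
  rw [R.boxPeriodic.sum_box (fun b => ((b.1 : ℕ) : ℤ)) (fun _ _ => rfl)]
  simp [Finset.mul_sum]

theorem two_mul_sum_Icc (n : ℕ) : 2 * ∑ i ∈ Finset.Icc (1 : ℤ) n, i = n * (n + 1) := by
  have := sum_Icc_sub_pred (fun i => i * (i + 1)) n
  simp only [zero_mul, sub_zero] at this
  rw [← this, Finset.mul_sum]
  exact Finset.sum_congr rfl fun i _ => by ring

/-- This is the exponent required by the relation for Z_1⋯Z_n: it equals n(n−1) + n(1−N²), which is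
where Y = q^{1−N²} comes from. -/
theorem two_mul_sum_diagN [NeZero N] [NeZero k] (R : PSYT N k) :
    2 * ∑ i ∈ Finset.Icc (1 : ℤ) (N * k : ℕ), R.diagN i =
      (N * k : ℕ) * ((N * k : ℕ) - (N : ℤ) ^ 2) := by
  have h1 := R.k_mul_p
  have h2 := R.sum_fst
  have h3 := two_mul_sum_Icc k
  have h4 : 2 * ∑ r : Fin N, ((r : ℕ) : ℤ) = N * (N - 1) := by
    rw [Fin.sum_univ_eq_sum_range (fun i => (i : ℤ))]
    have := Finset.sum_range_id_mul_two N
    have hN := Nat.pos_of_neZero N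
    zify at this
    rw [Nat.cast_sub hN] at this
    push_cast at this
    linarith
  simp only [diagN, Finset.sum_add_distrib, ← Finset.mul_sum, Finset.sum_sub_distrib,
    Finset.sum_const, Int.card_Icc, nsmul_eq_mul, h2]
  have e : (((N * k : ℕ) : ℤ) + 1 - 1).toNat = N * k := by
    rw [add_sub_cancel_right, Int.toNat_natCast]
  rw [e]
  push_cast at h1 ⊢
  linear_combination (2 * N : ℤ) * h1 + N ^ 2 * h3 - N * k * h4

theorem diagN_add (R : PSYT N k) (i : ℤ) :
    R.diagN (i + (N * k : ℕ)) = R.diagN i + (N * k : ℕ) := by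
  rw [diagN, diagN, R.periodic]; push_cast; ring

/-- A shift by s raises every column by s and lowers p by N·s; the two effects cancel in the label.
-/
theorem diagN_shift [NeZero N] [NeZero k] (R R' : PSYT N k) (s : ℤ)
    (h : ∀ i, R'.box i = ((R.box i).1, (R.box i).2 + s)) : R'.diagN = R.diagN := by
  have hk : (k : ℤ) ≠ 0 := by exact_mod_cast NeZero.ne k
  have e : (((N * k : ℕ) : ℤ) + 1 - 1).toNat = N * k := by
    rw [add_sub_cancel_right, Int.toNat_natCast]
  have hp : R'.p = R.p - N * s := by
    apply mul_left_cancel₀ hk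
    have h1 := R'.k_mul_p
    simp only [h, Finset.sum_add_distrib, Finset.sum_const, Int.card_Icc, nsmul_eq_mul, e] at h1
    have h2 := R.k_mul_p
    push_cast at h1 h2 ⊢
    linear_combination h1 - h2
  ext i
  rw [diagN, diagN, hp, h]
  ring

theorem sum_snd_sub [NeZero N] [NeZero k] (R : PSYT N k) (j : ℤ) :
    ∑ i ∈ Finset.Icc (1 : ℤ) (N * k : ℕ), (R.box (i - j)).2 =
      ∑ i ∈ Finset.Icc (1 : ℤ) (N * k : ℕ), (R.box i).2 - k * j := by
  have step : ∀ j : ℤ, ∑ i ∈ Finset.Icc (1 : ℤ) (N * k : ℕ), (R.box (i - (j + 1))).2 =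
      ∑ i ∈ Finset.Icc (1 : ℤ) (N * k : ℕ), (R.box (i - j)).2 - k := by
    intro j
    have h := sum_Icc_sub_pred (fun i => (R.box (i - j)).2) (N * k)
    have h2 := R.periodic (0 - j)
    rw [show (0 : ℤ) - j + (N * k : ℕ) = (N * k : ℕ) - j by ring] at h2
    rw [h2, Finset.sum_sub_distrib] at h
    simp only [show ∀ i : ℤ, i - (j + 1) = i - 1 - j by intro i; ring]
    linarith
  induction j using Int.induction_on with
  | zero => simp
  | succ j ih => rw [step, ih]; ring
  | pred j ih =>
    have := step (-(j : ℤ) - 1)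
    simp only [sub_add_cancel] at this
    rw [ih] at this
    linarith

/-- Rotating by j lowers the sum of the columns of 1, …, n by k·j, hence raises p by j. This is the
factor in the commutation of π with the Z_i. -/
theorem diagN_rot [NeZero N] [NeZero k] (R : PSYT N k) (j i : ℤ) :
    (R.rot j).diagN i = R.diagN (i - j) + j := by
  have hk : (k : ℤ) ≠ 0 := by exact_mod_cast NeZero.ne k
  have hp : (R.rot j).p = R.p + j := by
    apply mul_left_cancel₀ hk
    have h1 := (R.rot j).k_mul_p
    simp only [rot_box, sum_snd_sub] at h1
    have h2 := R.k_mul_p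
    linear_combination h1 - h2
  rw [diagN, diagN, hp, rot_box]
  ring

/-- f is the difference u(j) − u(j−1) of the n-periodic function u that equals g on the class of i₀
and vanishes elsewhere. -/
theorem sum_aswap {n : ℕ} (h1 : ¬ (n : ℤ) ∣ 1) (i₀ : ℤ) (f : ℤ → ℤ)
    (g : ℤ → ℤ) (hg : ∀ j, g (j + n) = g j)
    (h0 : ∀ j, (n : ℤ) ∣ j - i₀ → f j = g j) (h2 : ∀ j, (n : ℤ) ∣ j - i₀ - 1 → f j = -g (j - 1))
    (h3 : ∀ j, ¬ (n : ℤ) ∣ j - i₀ → ¬ (n : ℤ) ∣ j - i₀ - 1 → f j = 0) :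
    ∑ i ∈ Finset.Icc (1 : ℤ) n, f i = 0 := by
  classical
  let u : ℤ → ℤ := fun j => if (n : ℤ) ∣ j - i₀ then g j else 0
  have hu : ∀ j, f j = u j - u (j - 1) := by
    intro j
    have e : j - 1 - i₀ = j - i₀ - 1 := by ring
    simp only [u, e]
    rcases aswap_cases h1 i₀ j with ⟨a, -⟩ | ⟨a, -⟩ | ⟨a, b, -⟩
    · have b : ¬ (n : ℤ) ∣ j - i₀ - 1 := fun b => h1 (by simpa using dvd_sub a b)
      simp [a, b, h0 j a]
    · have b : ¬ (n : ℤ) ∣ j - i₀ := fun b => h1 (by simpa using dvd_sub b a)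
      simp [a, b, h2 j a]
    · simp [a, b, h3 j a b]
  simp only [hu]
  rw [sum_Icc_sub_pred]
  simp only [u]
  have e1 : (n : ℤ) ∣ (n : ℤ) - i₀ ↔ (n : ℤ) ∣ 0 - i₀ := by
    rw [show (n : ℤ) - i₀ = 0 - i₀ + n by ring, dvd_add_self_right]
  have := hg 0
  rw [zero_add] at this
  simp only [e1, this, sub_self]

theorem sum_snd_aswap (R : PSYT N k) (i : ℤ) (h1 : ¬ ((N * k : ℕ) : ℤ) ∣ 1) :
    ∑ j ∈ Finset.Icc (1 : ℤ) (N * k : ℕ), (R.box (aswap (N * k) i j)).2 =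
      ∑ j ∈ Finset.Icc (1 : ℤ) (N * k : ℕ), (R.box j).2 := by
  rw [← sub_eq_zero, ← Finset.sum_sub_distrib]
  refine sum_aswap h1 i _ (fun j => (R.box (j + 1)).2 - (R.box j).2) ?_ ?_ ?_ ?_
  · intro j
    rw [show j + ((N * k : ℕ) : ℤ) + 1 = j + 1 + (N * k : ℕ) by ring, R.periodic, R.periodic]
    simp
  · intro j hj
    rw [aswap_left h1 hj]
  · intro j hj
    rw [aswap_right h1 hj]; simp
  · intro j hj hj'
    rw [aswap_other hj hj']; simp

theorem diagN_aswap [NeZero N] [NeZero k] (R R' : PSYT N k) (i : ℤ) (h1 : ¬ ((N * k : ℕ) : ℤ) ∣ 1)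
    (h : ∀ j, R'.box j = R.box (aswap (N * k) i j)) (j : ℤ) :
    R'.diagN j = R.diagN (aswap (N * k) i j) := by
  have hk : (k : ℤ) ≠ 0 := by exact_mod_cast NeZero.ne k
  have hp : R'.p = R.p := by
    apply mul_left_cancel₀ hk
    have h2 := R'.k_mul_p
    simp only [h] at h2
    rw [sum_snd_aswap R i h1] at h2
    rw [h2, R.k_mul_p]
  rw [diagN, diagN, hp, h]

theorem p_eq_zero [NeZero N] [NeZero k] (R : PSYT N k)
    (h : ∀ r, ∀ c ∈ Finset.Icc (1 : ℤ) k, R.box.symm (r, c) ∈ Finset.Icc (1 : ℤ) (N * k : ℕ)) :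
    R.p = 0 := by
  have := R.boxPeriodic.sum_box (fun b => (R.box.symm b - 1) % (N * k : ℕ) + 1) (by
    intro r c
    rw [R.boxPeriodic.symm_add, show R.box.symm (r, c) + ((N * k : ℕ) : ℤ) - 1 =
      R.box.symm (r, c) - 1 + (N * k : ℕ) by ring, Int.add_emod_right])
  have key : ∀ i ∈ Finset.Icc (1 : ℤ) (N * k : ℕ), (i - 1) % (N * k : ℕ) + 1 = i := by
    intro i hi
    rw [Finset.mem_Icc] at hi
    rw [Int.emod_eq_of_lt (by omega) (by omega)]
    ring
  simp only [Equiv.symm_apply_apply] at this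
  rw [Finset.sum_congr rfl key] at this
  rw [p, this]
  have e : ∑ r : Fin N, ∑ c ∈ Finset.Icc (1 : ℤ) k,
      ((R.box.symm (r, c) - 1) % (N * k : ℕ) + 1) =
      ∑ r : Fin N, ∑ c ∈ Finset.Icc (1 : ℤ) k, R.box.symm (r, c) :=
    Finset.sum_congr rfl fun r _ => Finset.sum_congr rfl fun c hc => key _ (h r c hc)
  rw [e]
  simp

end PSYT

/-! ### Recognizing a tableau by its labels; reaching all tableaux from R₀ -/

namespace PSYT

variable {N k : ℕ}

/-- A filling that increases down the columns is determined by its contents, if these are the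
contents of a standard periodic tableau. -/
theorem eq_shift_of_content_eq [NeZero N] (R : PSYT N k) {B : ℤ ≃ Fin N × ℤ} (hB : ColIncreasing B)
    (m : ℤ) (h : ∀ i, N * ((B i).2 - ((B i).1 : ℕ)) + m = N * R.content i) :
    ∃ s : ℤ, ∀ i, R.box i = ((B i).1, (B i).2 + s) := by
  have hN : (N : ℤ) ≠ 0 := by exact_mod_cast NeZero.ne N
  obtain ⟨s, rfl⟩ : ∃ s, m = N * s :=
    ⟨R.content 0 - ((B 0).2 - ((B 0).1 : ℕ)), by linear_combination h 0⟩
  have h' : ∀ i, (B i).2 - ((B i).1 : ℕ) + s = R.content i := fun i =>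
    mul_left_cancel₀ hN (by linear_combination h i)
  -- For a fixed column of B, the row in R is a strictly increasing self-map of Fin N, hence the
  -- identity. Rows and contents then determine the boxes.
  have row : ∀ c r, (R.box (B.symm (r, c))).1 = r := by
    intro c
    have hmono : StrictMono fun r => (R.box (B.symm (r, c))).1 := by
      intro r r' hr
      -- The larger entry has the smaller content. If its row in R were not larger, it would lie
      -- weakly north-west of the smaller entry.
      by_contra hle
      have hle : (R.box (B.symm (r', c))).1 ≤ (R.box (B.symm (r, c))).1 := not_lt.mp hle
      have e1 := h' (B.symm (r, c))
      have e2 := h' (B.symm (r', c))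
      simp only [Equiv.apply_symm_apply, content] at e1 e2
      have a1 : (r : ℕ) < r' := hr
      have a2 : ((R.box (B.symm (r', c))).1 : ℕ) ≤ (R.box (B.symm (r, c))).1 := hle
      have := R.le_of_box_le hle (by omega)
      have := hB r r' c hr
      omega
    exact fun r => le_antisymm hmono.apply_le hmono.le_apply
  refine ⟨s, fun i => ?_⟩
  have h1 : (R.box i).1 = (B i).1 := by simpa using row (B i).2 (B i).1
  refine Prod.ext h1 ?_
  have := h' i
  rw [content, h1] at this
  simp only
  linarith

theorem diagN_injective [NeZero N] {R R' : PSYT N k} (h : R.diagN = R'.diagN) :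
    ∃ s : ℤ, ∀ i, R'.box i = ((R.box i).1, (R.box i).2 + s) := by
  refine R'.eq_shift_of_content_eq R.colIncreasing (R.p - R'.p) fun i => ?_
  have := congrFun h i
  rw [diagN_eq, diagN_eq] at this
  simp only [content] at this ⊢
  linarith

/-- In such an R the contents of i and i + 1 differ by −1, so the two are not in one column, and
exchanging them keeps the columns increasing. The result has the labels of R₁, so it is R₁ up to a
shift. But then i and i + 1 share a column of R after all. Rows play no role, which is why
`eq_shift_of_content_eq` asks only for increasing columns. -/
theorem diagN_ne_comp_aswap [NeZero N] [NeZero k] {R R₁ : PSYT N k} {i : ℤ}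
    (hn : ¬ ((N * k : ℕ) : ℤ) ∣ 1)
    (h : (R₁.box i).2 = (R₁.box (i + 1)).2) :
    ¬ ∀ j, R.diagN j = R₁.diagN (aswap (N * k) i j) := by
  intro H
  have hc : R.content i - R.content (i + 1) = -1 := by
    have hN : (N : ℤ) ≠ 0 := by exact_mod_cast NeZero.ne N
    have h1 := R₁.content_succ_of_snd_eq h
    have a := H i
    have b := H (i + 1)
    rw [aswap_self hn, diagN_eq, diagN_eq] at a
    rw [aswap_succ hn, diagN_eq, diagN_eq] at b
    apply mul_left_cancel₀ hN
    linear_combination a - b - (N : ℤ) * h1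
  have hne : ∀ j, ((N * k : ℕ) : ℤ) ∣ j - i → (R.box j).2 ≠ (R.box (j + 1)).2 := by
    rintro j ⟨m, hm⟩ hj
    obtain rfl : j = i + (N * k : ℕ) * m := by linarith
    have h1 := R.boxPeriodic.add_mul i m
    have h2 := R.boxPeriodic.add_mul (i + 1) m
    rw [show i + 1 + ((N * k : ℕ) : ℤ) * m = i + ((N * k : ℕ) : ℤ) * m + 1 by ring] at h2
    rw [h1, h2] at hj
    simp only [add_left_inj] at hj
    have := R.content_succ_of_snd_eq hj
    omega
  have hB : ColIncreasing ((aswap (N * k) i).trans R.box) := by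
    intro r r' c hr
    refine aswap_lt (R.col_lt r r' c hr) ?_
    rintro ⟨h1, h2⟩
    refine hne _ h2 ?_
    rw [← h1]; simp
  obtain ⟨s, hs⟩ := R₁.eq_shift_of_content_eq hB (R.p - R₁.p) (by
    intro j
    have := H (aswap (N * k) i j)
    rw [aswap_aswap, diagN_eq, diagN_eq, content] at this
    simp only [Equiv.trans_apply]
    linarith)
  have a := hs i
  have b := hs (i + 1)
  simp only [Equiv.trans_apply, aswap_self hn, aswap_succ hn] at a b
  rw [a, b] at h
  simp only [add_left_inj] at h
  exact hne i (by simp) h.symm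

/-- The position of a box in the column reading order. -/
def readingPos (R : PSYT N k) (i : ℤ) : ℤ := N * (R.box i).2 + ((R.box i).1 : ℕ)

theorem readingPos_injective {R R' : PSYT N k} {i j : ℤ}
    (h : R.readingPos i = R'.readingPos j) : R.box i = R'.box j := by
  have h1 : (((R.box i).1 : ℕ) : ℤ) < N := by exact_mod_cast (R.box i).1.2
  have h2 : (((R'.box j).1 : ℕ) : ℤ) < N := by exact_mod_cast (R'.box j).1.2
  have h3 : (0 : ℤ) ≤ ((R.box i).1 : ℕ) := by positivity
  have h4 : (0 : ℤ) ≤ ((R'.box j).1 : ℕ) := by positivity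
  rw [readingPos, readingPos] at h
  have hN : (0 : ℤ) < N := by omega
  have hc : (R.box i).2 = (R'.box j).2 := by
    rcases lt_trichotomy (R.box i).2 (R'.box j).2 with hc | hc | hc
    · nlinarith
    · exact hc
    · nlinarith
  rw [hc] at h
  refine Prod.ext (Fin.ext ?_) hc
  omega

/-- If columns never decrease, a column is completed, from top to bottom, before the next one
starts; so the successor sits in the next box of the reading order. -/
theorem readingPos_add_one [NeZero N] (R : PSYT N k)
    (h : ∀ i, (R.box i).2 ≤ (R.box (i + 1)).2) (i : ℤ) :
    R.readingPos (i + 1) = R.readingPos i + 1 := by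
  have hmono : Monotone fun i => (R.box i).2 := monotone_int_of_le_succ h
  have hN := Nat.pos_of_neZero N
  obtain ⟨⟨r, hr⟩, c, hb⟩ : ∃ r : Fin N, ∃ c, R.box i = (r, c) := ⟨_, _, rfl⟩
  obtain ⟨⟨r', hr'⟩, c', hb'⟩ : ∃ r : Fin N, ∃ c, R.box (i + 1) = (r, c) := ⟨_, _, rfl⟩
  have hi : i = R.box.symm (⟨r, hr⟩, c) := by rw [← hb]; simp
  have hi' : i + 1 = R.box.symm (⟨r', hr'⟩, c') := by rw [← hb']; simp
  have hcc : c ≤ c' := by have := h i; rwa [hb, hb'] at this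
  have h1 : c = c' → r < r' := by
    rintro rfl
    by_contra hle
    have := R.mono (show (⟨r', hr'⟩ : Fin N) ≤ ⟨r, hr⟩ from not_lt.mp hle) le_rfl (c := c)
    omega
  simp only [readingPos, hb, hb']
  by_cases hlast : r + 1 < N
  · have hlt := R.col_lt ⟨r, hr⟩ ⟨r + 1, hlast⟩ c (Fin.lt_def.mpr (by simp))
    have hle : (i + 1) ≤ R.box.symm (⟨r + 1, hlast⟩, c) := by omega
    have hc := hmono hle
    simp only [hb', Equiv.apply_symm_apply] at hc
    obtain rfl : c = c' := le_antisymm hcc hc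
    have hr1 : r' ≤ r + 1 := by
      by_contra hgt
      have := R.col_lt ⟨r + 1, hlast⟩ ⟨r', hr'⟩ c (Fin.lt_def.mpr (by simp only; omega))
      omega
    have := h1 rfl
    have : r' = r + 1 := by omega
    rw [this]; push_cast; ring
  · have hlt : i < R.box.symm (⟨0, hN⟩, c + 1) := by
      by_contra hge
      have hc := hmono (not_lt.mp hge)
      simp only [hb, Equiv.apply_symm_apply] at hc
      omega
    have hle : (i + 1) ≤ R.box.symm (⟨0, hN⟩, c + 1) := by omega
    have hc := hmono hle
    simp only [hb', Equiv.apply_symm_apply] at hc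
    have hne : c ≠ c' := fun hcc => by have := h1 hcc; omega
    obtain rfl : c' = c + 1 := by omega
    have hr1 : r' = 0 := by
      by_contra hgt
      have := R.col_lt ⟨0, hN⟩ ⟨r', hr'⟩ (c + 1) (Fin.lt_def.mpr (by simp only; omega))
      omega
    have : r = N - 1 := by omega
    subst hr1 this
    rw [Nat.cast_sub hN]; push_cast; ring

theorem readingPos_eq [NeZero N] (R : PSYT N k)
    (h : ∀ i, (R.box i).2 ≤ (R.box (i + 1)).2) (i : ℤ) :
    R.readingPos i = R.readingPos 0 + i := by
  induction i using Int.induction_on with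
  | zero => simp
  | succ i ih => rw [R.readingPos_add_one h, ih]; ring
  | pred i ih =>
    have := R.readingPos_add_one h (-(i : ℤ) - 1)
    rw [sub_add_cancel] at this
    linarith

section R₀

variable [NeZero N]

theorem R₀_box_snd (i : ℤ) : ((R₀ N k).box i).2 = (i - 1) / N + 1 := rfl

theorem R₀_symm (r : Fin N) (c : ℤ) : (R₀ N k).box.symm (r, c) = (r : ℤ) + 1 + N * (c - 1) := rfl

theorem R₀_col_le (i : ℤ) : ((R₀ N k).box i).2 ≤ ((R₀ N k).box (i + 1)).2 := by
  rw [R₀_box_snd, R₀_box_snd]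
  have : (i - 1) / N ≤ (i + 1 - 1) / N := Int.ediv_le_ediv (by
    have := Nat.pos_of_neZero N; exact_mod_cast this) (by omega)
  omega

theorem R₀_col_eq {i : ℤ} (h : ¬ (N : ℤ) ∣ i) : ((R₀ N k).box i).2 = ((R₀ N k).box (i + 1)).2 := by
  have hN : (0 : ℤ) < N := by have := Nat.pos_of_neZero N; exact_mod_cast this
  rw [R₀_box_snd, R₀_box_snd]
  have h1 := Int.emod_add_mul_ediv i N
  have h2 := Int.emod_lt_of_pos i hN
  have h3 : 0 < i % N := lt_of_le_of_ne (Int.emod_nonneg i hN.ne')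
    (fun H => h (Int.dvd_of_emod_eq_zero H.symm))
  have : (i - 1) / N = i / N := by
    rw [Int.ediv_eq_iff_of_pos hN]
    constructor <;> nlinarith
  rw [this]; simp

theorem R₀_box_add (i : ℤ) :
    (R₀ N k).box (i + N) = (((R₀ N k).box i).1, ((R₀ N k).box i).2 + 1) := by
  have h0 : (N : ℤ) ≠ 0 := by exact_mod_cast NeZero.ne N
  rw [← Equiv.eq_symm_apply]
  have : i = (R₀ N k).box.symm ((R₀ N k).box i) := by simp
  rw [R₀_symm]
  nth_rewrite 1 [this]
  rw [← Prod.mk.eta (p := (R₀ N k).box i), R₀_symm]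
  ring

theorem R₀_diagN_add (i : ℤ) : (R₀ N k).diagN (i + N) = (R₀ N k).diagN i + N := by
  rw [diagN, diagN, R₀_box_add]; ring

theorem R₀_diagN_succ {i : ℤ} (h : ¬ (N : ℤ) ∣ i) :
    (R₀ N k).diagN i - (R₀ N k).diagN (i + 1) = N := by
  have := content_succ_of_snd_eq _ (R₀_col_eq (k := k) h)
  rw [diagN_eq, diagN_eq]
  linear_combination (N : ℤ) * this

/-- A tableau whose columns do not decrease is a rotation of `R₀`. -/
theorem exists_rot_eq (R : PSYT N k) (h : ∀ i, (R.box i).2 ≤ (R.box (i + 1)).2) :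
    ∃ j : ℤ, ∀ i, R.box i = ((R₀ N k).rot j).box i := by
  refine ⟨(R₀ N k).readingPos 0 - R.readingPos 0, fun i => ?_⟩
  rw [rot_box]
  apply readingPos_injective
  rw [R.readingPos_eq h, readingPos_eq _ R₀_col_le]
  ring

end R₀

/-- A potential that drops if a descent of columns is removed. -/
noncomputable def energy (R : PSYT N k) : ℤ :=
  ∑ i ∈ Finset.Icc (1 : ℤ) (N * k : ℕ), ((N * k : ℕ) * (R.box i).2 - k * i) ^ 2

theorem energy_nonneg (R : PSYT N k) : 0 ≤ R.energy := Finset.sum_nonneg fun _ _ => sq_nonneg _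

/-- The rearrangement inequality: exchanging a descent changes only the mixed terms, by 2kn times
the negative column difference. To sum over one period even if the pair straddles its end, the
change at j is written as f(j) + u(j−1) with u periodic, and u is moved back by telescoping. -/
theorem energy_lt [NeZero N] [NeZero k] (R R' : PSYT N k) (i : ℤ) (h1 : ¬ ((N * k : ℕ) : ℤ) ∣ 1)
    (h : ∀ j, R'.box j = R.box (aswap (N * k) i j)) (hi : (R.box (i + 1)).2 < (R.box i).2) :
    R'.energy < R.energy := by
  classical
  set n := N * k with hn
  have hn0 : 0 < n := Nat.pos_of_neZero (N * k)
  have hk0 : 0 < k := Nat.pos_of_neZero k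
  have hper : ∀ j, (R.box (j + (n : ℕ))).2 = (R.box j).2 + k := fun j => by rw [R.periodic]
  let g : ℤ → ℤ := fun j => (n : ℕ) * (R.box j).2 - k * j
  have hg : ∀ j, g (j + n) = g j := by intro j; simp only [g, hper]; ring
  let f : ℤ → ℤ := fun j => if (n : ℤ) ∣ j - i then (g (j + 1) + k) ^ 2 - g j ^ 2 else 0
  let u : ℤ → ℤ := fun j => if (n : ℤ) ∣ j - i then (g j - k) ^ 2 - g (j + 1) ^ 2 else 0
  have hdiff : ∀ j, ((n : ℕ) * (R'.box j).2 - k * j) ^ 2 - g j ^ 2 = f j + u (j - 1) := by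
    intro j
    have e : j - 1 - i = j - i - 1 := by ring
    simp only [f, u, e, h]
    rcases aswap_cases h1 i j with ⟨a, c⟩ | ⟨a, c⟩ | ⟨a, b, c⟩
    · have b : ¬ (n : ℤ) ∣ j - i - 1 := fun b => h1 (by simpa using dvd_sub a b)
      simp only [a, b, c, if_true, if_false, g]; ring
    · have b : ¬ (n : ℤ) ∣ j - i := fun b => h1 (by simpa using dvd_sub b a)
      simp only [a, b, c, if_true, if_false, g, sub_add_cancel]; ring
    · simp only [a, b, c, if_false, g]; ring
  have hu := sum_Icc_sub_pred u n
  have hu0 : u n = u 0 := by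
    have e1 : (n : ℤ) ∣ (n : ℤ) - i ↔ (n : ℤ) ∣ 0 - i := by
      rw [show (n : ℤ) - i = 0 - i + n by ring, dvd_add_self_right]
    have e2 := hg 0
    have e3 := hg (0 + 1)
    rw [show (0 : ℤ) + 1 + n = n + 1 by ring] at e3
    rw [zero_add] at e2
    simp only [u, e1, e2, e3]
  rw [hu0, sub_self, Finset.sum_sub_distrib] at hu
  have key : R'.energy - R.energy = ∑ j ∈ Finset.Icc (1 : ℤ) n, (f j + u j) := by
    rw [energy, energy, ← Finset.sum_sub_distrib, Finset.sum_congr rfl fun j _ => hdiff j,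
      Finset.sum_add_distrib, Finset.sum_add_distrib]
    linarith
  have hfu : ∀ j, f j + u j = if (n : ℤ) ∣ j - i then
      2 * k * n * ((R.box (j + 1)).2 - (R.box j).2) else 0 := by
    intro j
    simp only [f, u]
    split_ifs
    · simp only [g]; ring
    · rfl
  have hneg : ∀ j, (n : ℤ) ∣ j - i → (R.box (j + 1)).2 - (R.box j).2 < 0 := by
    rintro j ⟨m, hm⟩
    obtain rfl : j = i + n * m := by linarith
    have a := R.boxPeriodic.add_mul i m
    have b := R.boxPeriodic.add_mul (i + 1) m
    rw [show i + 1 + ((N * k : ℕ) : ℤ) * m = i + ((N * k : ℕ) : ℤ) * m + 1 by ring] at b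
    rw [a, b]
    simp only
    omega
  have hpos : (0 : ℤ) < 2 * k * n := by positivity
  have : ∑ j ∈ Finset.Icc (1 : ℤ) n, (f j + u j) < 0 := by
    obtain ⟨j, hj, hj'⟩ := exists_mem_Icc_dvd (N * k) i
    refine Finset.sum_neg' ?_ ⟨j, hj, ?_⟩
    · intro j _
      rw [hfu]
      split_ifs with hd
      · exact (mul_neg_of_pos_of_neg hpos (hneg j hd)).le
      · exact le_rfl
    · rw [hfu, if_pos hj']
      exact mul_neg_of_pos_of_neg hpos (hneg j hj')
  linarith

theorem free_of_col_lt (R : PSYT N k) {i : ℤ} (hi : (R.box (i + 1)).2 < (R.box i).2) : R.Free i :=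
  ⟨fun h => by have := R.snd_succ_of_fst_eq h; omega, hi.ne'⟩

/-- Every periodic tableau is reached from the rotations of `R₀` by exchanging entries. -/
theorem induction_swap [NeZero N] [NeZero k] {P : PSYT N k → Prop}
    (hrot : ∀ j R, (∀ i, R.box i = ((R₀ N k).rot j).box i) → P R)
    (hswap : ∀ (R : PSYT N k) (i : ℤ) (h : R.Free i), (R.box (i + 1)).2 < (R.box i).2 →
      P (R.swap i h) → P R) (R : PSYT N k) : P R := by
  obtain ⟨m, hm⟩ : ∃ m : ℕ, R.energy.toNat = m := ⟨_, rfl⟩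
  induction m using Nat.strong_induction_on generalizing R with
  | _ m ih =>
    by_cases h : ∀ i, (R.box i).2 ≤ (R.box (i + 1)).2
    · obtain ⟨j, hj⟩ := R.exists_rot_eq h
      exact hrot j R hj
    · push Not at h
      obtain ⟨i, hi⟩ := h
      have hf := R.free_of_col_lt hi
      refine hswap R i hf hi (ih _ ?_ _ rfl)
      have a := energy_lt R (R.swap i hf) i hf.not_dvd (fun _ => rfl) hi
      have b := energy_nonneg (R.swap i hf)
      have c := energy_nonneg R
      omega

end PSYT

/-! ## Diagonal labels of classes of periodic tableaux -/

namespace PSYTBar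

variable {N k : ℕ} [NeZero N] [NeZero k]

/-- The diagonal labels (multiplied by `N`) of a class of periodic tableaux. -/
noncomputable def diag (Q : PSYTBar N k) : ℤ → ℤ :=
  Quotient.lift (s := PSYT.shiftSetoid N k) (fun R : PSYT N k => R.diagN)
    (by rintro R R' ⟨s, h⟩; exact (PSYT.diagN_shift R R' s h).symm) Q

theorem diag_mk (R : PSYT N k) : diag (⟦R⟧ : PSYTBar N k) = R.diagN := rfl

theorem diag_injective : Function.Injective (diag : PSYTBar N k → ℤ → ℤ) := by
  intro Q Q'
  induction Q using Quotient.inductionOn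
  induction Q' using Quotient.inductionOn
  intro h
  exact Quotient.sound (PSYT.diagN_injective h)

theorem diag_add (Q : PSYTBar N k) (i : ℤ) :
    Q.diag (i + (N * k : ℕ)) = Q.diag i + (N * k : ℕ) := by
  induction Q using Quotient.inductionOn
  exact PSYT.diagN_add _ i

theorem diag_ne_succ (Q : PSYTBar N k) (i : ℤ) : Q.diag i ≠ Q.diag (i + 1) := by
  have hN : (N : ℤ) ≠ 0 := by exact_mod_cast NeZero.ne N
  induction Q using Quotient.inductionOn with
  | _ R =>
    rw [diag_mk, PSYT.diagN_eq, PSYT.diagN_eq]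
    intro h
    exact R.content_ne_succ i (mul_left_cancel₀ hN (by linarith))

theorem diag_ne_add_two (Q : PSYTBar N k) (i : ℤ) : Q.diag i ≠ Q.diag (i + 2) := by
  have hN : (N : ℤ) ≠ 0 := by exact_mod_cast NeZero.ne N
  induction Q using Quotient.inductionOn with
  | _ R =>
    rw [diag_mk, PSYT.diagN_eq, PSYT.diagN_eq]
    intro h
    exact R.content_ne_add_two i (mul_left_cancel₀ hN (by linarith))

/-- Label differences N and −N are those of vertical and horizontal neighbours, the only pairs whose
exchange is not standard. -/
theorem exists_swap (Q : PSYTBar N k) {i : ℤ} (h : Q.diag i - Q.diag (i + 1) ≠ N)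
    (h' : Q.diag i - Q.diag (i + 1) ≠ -N) :
    ¬ ((N * k : ℕ) : ℤ) ∣ 1 ∧
      ∃ Q' : PSYTBar N k, ∀ j, Q'.diag j = Q.diag (aswap (N * k) i j) := by
  induction Q using Quotient.inductionOn with
  | _ R =>
    rw [diag_mk, PSYT.diagN_eq, PSYT.diagN_eq] at h h'
    have hf : R.Free i := by
      refine ⟨fun H => h' ?_, fun H => h ?_⟩
      · linear_combination (N : ℤ) * R.content_succ_of_fst_eq H
      · linear_combination (N : ℤ) * R.content_succ_of_snd_eq H
    exact ⟨hf.not_dvd, ⟦R.swap i hf⟧,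
      fun j => PSYT.diagN_aswap R (R.swap i hf) i hf.not_dvd (fun _ => rfl) j⟩

theorem exists_rot (Q : PSYTBar N k) (j : ℤ) :
    ∃ Q' : PSYTBar N k, ∀ i, Q'.diag i = Q.diag (i - j) + j := by
  induction Q using Quotient.inductionOn with
  | _ R => exact ⟨⟦R.rot j⟧, R.diagN_rot j⟩

theorem two_mul_sum_diag (Q : PSYTBar N k) :
    2 * ∑ i ∈ Finset.Icc (1 : ℤ) (N * k : ℕ), Q.diag i =
      (N * k : ℕ) * ((N * k : ℕ) - (N : ℤ) ^ 2) := by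
  induction Q using Quotient.inductionOn with
  | _ R => exact R.two_mul_sum_diagN

/-- Connectedness in the form needed for irreducibility: the exchanges used have label difference
different from ±N, so the corresponding coefficient of T_i is non-zero. -/
theorem induction_diag {P : PSYTBar N k → Prop} (h0 : P ⟦PSYT.R₀ N k⟧)
    (hrot : ∀ (Q Q' : PSYTBar N k) (j : ℤ), (∀ i, Q'.diag i = Q.diag (i - j) + j) → P Q → P Q')
    (hswap : ∀ (Q Q' : PSYTBar N k) (i : ℤ), ¬ ((N * k : ℕ) : ℤ) ∣ 1 →
      Q.diag i - Q.diag (i + 1) ≠ N → Q.diag i - Q.diag (i + 1) ≠ -N →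
      (∀ j, Q'.diag j = Q.diag (aswap (N * k) i j)) → P Q → P Q') (Q : PSYTBar N k) : P Q := by
  have hN : (0 : ℤ) < N := by have := Nat.pos_of_neZero N; exact_mod_cast this
  induction Q using Quotient.inductionOn with
  | _ R =>
    induction R using PSYT.induction_swap with
    | hrot j R hR =>
      refine hrot _ _ j (fun i => ?_) h0
      rw [diag_mk, diag_mk, ← PSYT.diagN_rot]
      have : R.diagN = ((PSYT.R₀ N k).rot j).diagN :=
        PSYT.diagN_shift _ _ 0 fun i => by rw [hR i]; simp
      rw [this]
    | hswap R i h _ ih =>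
      have e := PSYT.diagN_aswap R (R.swap i h) i h.not_dvd (fun _ => rfl)
      have hc := h.content_sub
      have e1 : (R.swap i h).diagN i - (R.swap i h).diagN (i + 1) =
          N * (R.content (i + 1) - R.content i) := by
        rw [e, e, aswap_self h.not_dvd, aswap_succ h.not_dvd, PSYT.diagN_eq, PSYT.diagN_eq]; ring
      refine hswap _ _ i h.not_dvd ?_ ?_ (fun j => ?_) ih
      · rw [diag_mk, e1]
        intro H
        have : R.content (i + 1) - R.content i = 1 :=
          mul_left_cancel₀ hN.ne' (by linarith)
        omega
      · rw [diag_mk, e1]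
        intro H
        have : R.content (i + 1) - R.content i = -1 :=
          mul_left_cancel₀ hN.ne' (by linarith)
        omega
      · rw [diag_mk, diag_mk, e, aswap_aswap]

end PSYTBar

theorem PSYT.rep_intCast {n : ℕ} [NeZero n] (i : ℤ) :
    PSYT.rep (i : ZMod n) = (i - 1) % n + 1 := by
  have hn : (0 : ℤ) < n := by have := Nat.pos_of_neZero n; exact_mod_cast this
  rw [PSYT.rep]
  split_ifs with h
  · rw [ZMod.intCast_zmod_eq_zero_iff_dvd] at h
    obtain ⟨m, rfl⟩ := h
    rw [show (n : ℤ) * m - 1 = (n - 1) + n * (m - 1) by ring, Int.add_mul_emod_self_left,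
      Int.emod_eq_of_lt (by omega) (by omega)]
    ring
  · rw [ZMod.intCast_zmod_eq_zero_iff_dvd] at h
    rw [ZMod.val_intCast]
    have h1 := Int.emod_add_mul_ediv i n
    have h2 := Int.emod_lt_of_pos i hn
    have h3 : 0 < i % n := lt_of_le_of_ne (Int.emod_nonneg i hn.ne')
      (fun H => h (Int.dvd_of_emod_eq_zero H.symm))
    rw [show i - 1 = (i % n - 1) + n * (i / n) by linarith, Int.add_mul_emod_self_left,
      Int.emod_eq_of_lt (a := i % n - 1) (by omega) (by omega)]
    ring

theorem PSYT.intCast_rep {n : ℕ} [NeZero n] (i : ZMod n) : ((PSYT.rep i : ℤ) : ZMod n) = i := by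
  rw [PSYT.rep]
  split_ifs with h
  · simp [h]
  · simp

theorem PSYT.rep_mem {n : ℕ} [NeZero n] (i : ZMod n) : 1 ≤ PSYT.rep i ∧ PSYT.rep i ≤ n := by
  have hn := Nat.pos_of_neZero n
  rw [PSYT.rep]
  split_ifs with h
  · exact ⟨by exact_mod_cast hn, le_rfl⟩
  · have := ZMod.val_lt i
    have h0 : i.val ≠ 0 := by rwa [Ne, ZMod.val_eq_zero]
    omega

/-! ### Relations of the algebra with indices in ℤ -/

namespace DAHA

section Relations

variable {K : Type*} [Field K] {n : ℕ} {S t Y : K}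

/-- The generator `T_i`, with `i` an integer. -/
noncomputable def Ti (i : ℤ) : DAHA n S t Y := T (i : ZMod n)

/-- The element `Z_i`, with `i` an integer, such that `Z_{i + n} = q ^ {2 n} Z_i`. -/
noncomputable def Zi (i : ℤ) : DAHA n S t Y := S ^ (2 * n * ((i - 1) / n) : ℤ) • Z (i : ZMod n)

theorem Ti_congr {i j : ℤ} (h : (n : ℤ) ∣ i - j) : (Ti i : DAHA n S t Y) = Ti j := by
  rw [Ti, Ti]
  congr 1
  rw [← sub_eq_zero, ← Int.cast_sub]
  exact (ZMod.intCast_zmod_eq_zero_iff_dvd _ _).mpr h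

theorem Zi_of_mem {i : ℤ} (h1 : 1 ≤ i) (h2 : i ≤ n) : (Zi i : DAHA n S t Y) = Z (i : ZMod n) := by
  rw [Zi, Int.ediv_eq_zero_of_lt (by omega) (by omega)]; simp

theorem Z_eq_Zi [NeZero n] (i : ZMod n) : (Z i : DAHA n S t Y) = Zi (PSYT.rep i) := by
  rw [Zi_of_mem (PSYT.rep_mem i).1 (PSYT.rep_mem i).2, PSYT.intCast_rep]

theorem Zi_comm (i j : ℤ) : (Zi i : DAHA n S t Y) * Zi j = Zi j * Zi i := by
  have h : (Z (i : ZMod n) : DAHA n S t Y) * Z j = Z j * Z i := by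
    have := mk_rel (S := S) (t := t) (Y := Y) (DAHARel.Z_comm (i : ZMod n) (j : ZMod n))
    simp only [map_mul] at this
    exact this
  simp only [Zi, smul_mul_assoc, mul_smul_comm, h]
  rw [smul_comm]

theorem Z_Zinv (i : ZMod n) : (Z i : DAHA n S t Y) * Zinv i = 1 := by
  have := mk_rel (S := S) (t := t) (Y := Y) (DAHARel.Z_Zinv i)
  simp only [map_mul, map_one] at this
  exact this

theorem Zinv_Z (i : ZMod n) : (Zinv i : DAHA n S t Y) * Z i = 1 := by
  have := mk_rel (S := S) (t := t) (Y := Y) (DAHARel.Zinv_Z i)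
  simp only [map_mul, map_one] at this
  exact this

theorem Ti_mul_self (ht : t ≠ 0) (i : ℤ) :
    (Ti i : DAHA n S t Y) * Ti i = (t - t⁻¹) • Ti i + 1 := by
  have := mk_rel (S := S) (t := t) (Y := Y) (DAHARel.hecke (i : ZMod n))
  simp only [map_mul, map_sub, map_add, map_zero, AlgHom.commutes] at this
  change (Ti i - algebraMap K _ t) * (Ti i + algebraMap K _ t⁻¹) = 0 at this
  have h1 : algebraMap K (DAHA n S t Y) t * algebraMap K _ t⁻¹ = 1 := by
    rw [← map_mul, mul_inv_cancel₀ ht, map_one]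
  rw [sub_mul, mul_add, mul_add, h1, ← Algebra.commutes t⁻¹, ← Algebra.smul_def,
    ← Algebra.smul_def] at this
  rw [sub_smul, ← sub_eq_zero, ← this]
  abel

theorem Ti_inv_mul (ht : t ≠ 0) (i : ℤ) :
    ((Ti i : DAHA n S t Y) - (t - t⁻¹) • 1) * Ti i = 1 := by
  rw [sub_mul, Ti_mul_self ht, smul_mul_assoc, one_mul]; abel

/-- The rule Z_{i+n} = q^{2n} Z_i absorbs the exceptional factor in the relation for T_0, so that
one formula holds for all i; the same happens in `pi_Zi`. -/
theorem Ti_Zi_Ti [NeZero n] (hS : S ≠ 0) (i : ℤ) :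
    (Ti i : DAHA n S t Y) * Zi i * Ti i = Zi (i + 1) := by
  have hn : (0 : ℤ) < n := by have := Nat.pos_of_neZero n; exact_mod_cast this
  simp only [Zi, Ti, mul_smul_comm, smul_mul_assoc]
  by_cases h : (n : ℤ) ∣ i
  · have h0 : (i : ZMod n) = 0 := (ZMod.intCast_zmod_eq_zero_iff_dvd _ _).mpr h
    obtain ⟨m, rfl⟩ := h
    have := mk_rel (S := S) (t := t) (Y := Y) (DAHARel.T_Z_T_zero (n := n))
    simp only [map_mul, map_smul] at this
    change (T 0 : DAHA n S t Y) * Z 0 * T 0 = S ^ (2 * n) • Z 1 at this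
    rw [Int.cast_add, h0, this, smul_smul, Int.cast_one, zero_add]
    congr 1
    have e1 : ((n : ℤ) * m - 1) / n = m - 1 := by
      rw [Int.ediv_eq_iff_of_pos hn]; constructor <;> nlinarith
    have e2 : ((n : ℤ) * m + 1 - 1) / n = m := by
      rw [add_sub_cancel_right, Int.mul_ediv_cancel_left _ hn.ne']
    rw [e1, e2, ← zpow_natCast, ← zpow_add₀ hS]
    congr 1; push_cast; ring
  · have h0 : (i : ZMod n) ≠ 0 := fun H => h ((ZMod.intCast_zmod_eq_zero_iff_dvd _ _).mp H)
    have := mk_rel (S := S) (t := t) (Y := Y) (DAHARel.T_Z_T (i : ZMod n) h0)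
    simp only [map_mul] at this
    change (T (i : ZMod n) : DAHA n S t Y) * Z i * T i = Z ((i : ZMod n) + 1) at this
    rw [this, Int.cast_add, Int.cast_one, add_sub_cancel_right]
    congr 3
    have h1 := Int.emod_add_mul_ediv i n
    have h2 := Int.emod_lt_of_pos i hn
    have h3 : 0 < i % n := lt_of_le_of_ne (Int.emod_nonneg i hn.ne')
      (fun H => h (Int.dvd_of_emod_eq_zero H.symm))
    rw [Int.ediv_eq_iff_of_pos hn]
    constructor <;> nlinarith

theorem intCast_ne_of_not_dvd {i j : ℤ} (h : ¬ (n : ℤ) ∣ j - i) : (j : ZMod n) ≠ (i : ZMod n) := by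
  intro H
  apply h
  rw [← ZMod.intCast_zmod_eq_zero_iff_dvd, Int.cast_sub, H, sub_self]

theorem Ti_Zi_comm {i j : ℤ} (h1 : ¬ (n : ℤ) ∣ j - i) (h2 : ¬ (n : ℤ) ∣ j - i - 1) :
    (Ti i : DAHA n S t Y) * Zi j = Zi j * Ti i := by
  have := mk_rel (S := S) (t := t) (Y := Y) (DAHARel.T_Z_comm (i : ZMod n) (j : ZMod n)
    (intCast_ne_of_not_dvd h1) (by
      have := intCast_ne_of_not_dvd (n := n) (i := i + 1) (j := j)
        (by rwa [show j - (i + 1) = j - i - 1 by ring])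
      simpa using this))
  simp only [map_mul] at this
  change (T (i : ZMod n) : DAHA n S t Y) * Z j = Z j * T i at this
  simp only [Zi, Ti, mul_smul_comm, smul_mul_assoc, this]

theorem braid_Ti (hn : n ≠ 2) (i : ℤ) :
    (Ti i : DAHA n S t Y) * Ti (i + 1) * Ti i = Ti (i + 1) * Ti i * Ti (i + 1) := by
  have := mk_rel (S := S) (t := t) (Y := Y) (DAHARel.braid hn (i : ZMod n))
  simp only [map_mul] at this
  simp only [Ti, Int.cast_add, Int.cast_one]
  exact this

theorem Ti_comm (hn : n ≠ 2) {i j : ℤ} (h1 : ¬ (n : ℤ) ∣ j - i - 1) (h2 : ¬ (n : ℤ) ∣ i - j - 1) :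
    (Ti i : DAHA n S t Y) * Ti j = Ti j * Ti i := by
  have := mk_rel (S := S) (t := t) (Y := Y) (DAHARel.T_comm hn (i : ZMod n) (j : ZMod n) (by
      have := intCast_ne_of_not_dvd (n := n) (i := i + 1) (j := j)
        (by rwa [show j - (i + 1) = j - i - 1 by ring])
      simpa using this) (by
      have := intCast_ne_of_not_dvd (n := n) (i := j + 1) (j := i)
        (by rwa [show i - (j + 1) = i - j - 1 by ring])
      simpa using this))
  simp only [map_mul] at this
  exact this

/-- The inverse of the generator `π`. -/
noncomputable def piInv : DAHA n S t Y := mk (FreeAlgebra.ι K .piInv)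

theorem piInv_pi : (piInv : DAHA n S t Y) * pi = 1 := by
  have := mk_rel (S := S) (t := t) (Y := Y) (DAHARel.piInv_pi (n := n))
  simp only [map_mul, map_one] at this
  exact this

theorem pi_pow_n : (pi : DAHA n S t Y) ^ n = 1 := by
  have := mk_rel (S := S) (t := t) (Y := Y) (DAHARel.pi_pow (n := n))
  simp only [map_pow, map_one] at this
  exact this

theorem piInv_eq [NeZero n] : (piInv : DAHA n S t Y) = pi ^ (n - 1) := by
  have h : (pi : DAHA n S t Y) * pi ^ (n - 1) = 1 := by
    rw [← pow_succ', Nat.sub_add_cancel (Nat.pos_of_neZero n), pi_pow_n]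
  calc (piInv : DAHA n S t Y) = piInv * (pi * pi ^ (n - 1)) := by rw [h, mul_one]
    _ = pi ^ (n - 1) := by rw [← mul_assoc, piInv_pi, one_mul]

theorem pi_Ti (i : ℤ) : (pi : DAHA n S t Y) * Ti i = Ti (i + 1) * pi := by
  have := mk_rel (S := S) (t := t) (Y := Y) (DAHARel.pi_T (i : ZMod n))
  simp only [map_mul] at this
  change (pi : DAHA n S t Y) * T i * piInv = T ((i : ZMod n) + 1) at this
  simp only [Ti, Int.cast_add, Int.cast_one]
  rw [← this, mul_assoc, mul_assoc, piInv_pi, mul_one]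

theorem pi_Zi [NeZero n] (hS : S ≠ 0) (i : ℤ) :
    (pi : DAHA n S t Y) * Zi i = S ^ (-2 : ℤ) • (Zi (i + 1) * pi) := by
  have hn : (0 : ℤ) < n := by have := Nat.pos_of_neZero n; exact_mod_cast this
  simp only [Zi, mul_smul_comm, smul_mul_assoc, smul_smul]
  by_cases h : (n : ℤ) ∣ i
  · have h0 : (i : ZMod n) = 0 := (ZMod.intCast_zmod_eq_zero_iff_dvd _ _).mpr h
    obtain ⟨m, rfl⟩ := h
    have := mk_rel (S := S) (t := t) (Y := Y) (DAHARel.pi_Z_zero (n := n))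
    simp only [map_mul, map_smul] at this
    change (pi : DAHA n S t Y) * Z 0 * piInv = S ^ (2 * (n : ℤ) - 2) • Z 1 at this
    have h2 : (pi : DAHA n S t Y) * Z 0 = S ^ (2 * (n : ℤ) - 2) • (Z 1 * pi) := by
      rw [← smul_mul_assoc, ← this, mul_assoc, mul_assoc, piInv_pi, mul_one]
    rw [Int.cast_add, h0, h2, smul_smul, Int.cast_one, zero_add]
    congr 1
    have e1 : ((n : ℤ) * m - 1) / n = m - 1 := by
      rw [Int.ediv_eq_iff_of_pos hn]; constructor <;> nlinarith
    have e2 : ((n : ℤ) * m + 1 - 1) / n = m := by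
      rw [add_sub_cancel_right, Int.mul_ediv_cancel_left _ hn.ne']
    rw [e1, e2, ← zpow_add₀ hS, ← zpow_add₀ hS]
    congr 1; ring
  · have h0 : (i : ZMod n) ≠ 0 := fun H => h ((ZMod.intCast_zmod_eq_zero_iff_dvd _ _).mp H)
    have := mk_rel (S := S) (t := t) (Y := Y) (DAHARel.pi_Z (i : ZMod n) h0)
    simp only [map_mul, map_smul] at this
    change (pi : DAHA n S t Y) * Z i * piInv = S ^ (-2 : ℤ) • Z ((i : ZMod n) + 1) at this
    have h2 : (pi : DAHA n S t Y) * Z i = S ^ (-2 : ℤ) • (Z ((i : ZMod n) + 1) * pi) := by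
      rw [← smul_mul_assoc, ← this, mul_assoc, mul_assoc, piInv_pi, mul_one]
    rw [h2, smul_smul, Int.cast_add, Int.cast_one, add_sub_cancel_right, mul_comm]
    congr 3
    have h1 := Int.emod_add_mul_ediv i n
    have h2 := Int.emod_lt_of_pos i hn
    have h3 : 0 < i % n := lt_of_le_of_ne (Int.emod_nonneg i hn.ne')
      (fun H => h (Int.dvd_of_emod_eq_zero H.symm))
    congr 1
    rw [Int.ediv_eq_iff_of_pos hn]
    constructor <;> nlinarith

theorem pi_pow_Ti (j : ℕ) (i : ℤ) : (pi : DAHA n S t Y) ^ j * Ti i = Ti (i + j) * pi ^ j := by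
  induction j with
  | zero => simp
  | succ j ih =>
    rw [pow_succ', mul_assoc, ih, ← mul_assoc, pi_Ti, mul_assoc]
    push_cast; rw [add_assoc]

theorem pi_pow_Zi [NeZero n] (hS : S ≠ 0) (j : ℕ) (i : ℤ) :
    (pi : DAHA n S t Y) ^ j * Zi i = S ^ (-2 * j : ℤ) • (Zi (i + j) * pi ^ j) := by
  induction j with
  | zero => simp
  | succ j ih =>
    rw [pow_succ', mul_assoc, ih, mul_smul_comm, ← mul_assoc, pi_Zi hS, smul_mul_assoc, smul_smul,
      ← zpow_add₀ hS, mul_assoc]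
    push_cast; rw [add_assoc]
    congr 2; ring

/-- Multiply T_i Z_i T_i = Z_{i+1} by T_i⁻¹ = T_i − (t − t⁻¹). Moving Z past T_i costs a term
without T_i, that is, a shorter word. -/
theorem Zi_Ti [NeZero n] (hS : S ≠ 0) (ht : t ≠ 0) (i : ℤ) :
    (Zi i : DAHA n S t Y) * Ti i = Ti i * Zi (i + 1) - (t - t⁻¹) • Zi (i + 1) := by
  have := Ti_Zi_Ti (n := n) (t := t) (Y := Y) hS i
  calc (Zi i : DAHA n S t Y) * Ti i = ((Ti i - (t - t⁻¹) • 1) * Ti i) * (Zi i * Ti i) := by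
        rw [Ti_inv_mul ht, one_mul]
    _ = (Ti i - (t - t⁻¹) • 1) * (Ti i * Zi i * Ti i) := by simp only [mul_assoc]
    _ = _ := by rw [this, sub_mul, smul_mul_assoc, one_mul]

theorem Zi_succ_Ti [NeZero n] (hS : S ≠ 0) (ht : t ≠ 0) (i : ℤ) :
    (Zi (i + 1) : DAHA n S t Y) * Ti i = Ti i * Zi i + (t - t⁻¹) • Zi (i + 1) := by
  have := Ti_Zi_Ti (n := n) (t := t) (Y := Y) hS i
  calc (Zi (i + 1) : DAHA n S t Y) * Ti i = Ti i * Zi i * (Ti i * Ti i) := by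
        rw [← this, mul_assoc (Ti i * Zi i)]
    _ = (t - t⁻¹) • (Ti i * Zi i * Ti i) + Ti i * Zi i := by
        rw [Ti_mul_self ht, mul_add, mul_one, mul_smul_comm]
    _ = _ := by rw [this, add_comm]

theorem prod_Zi [NeZero n] :
    ((List.range n).map fun i : ℕ => (Zi ((i : ℤ) + 1) : DAHA n S t Y)).prod =
      algebraMap K _ (S ^ (n * (n - 1)) * Y ^ n) := by
  have := mk_rel (S := S) (t := t) (Y := Y) (DAHARel.Z_prod (n := n))
  rw [map_list_prod, List.map_map, AlgHom.commutes] at this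
  rw [← this]
  congr 1
  refine List.map_congr_left fun i hi => ?_
  rw [List.mem_range] at hi
  rw [Zi_of_mem (by omega) (by omega)]
  simp [Z]

theorem mk_surjective : Function.Surjective (mk : FreeAlgebra K (DAHAGen n) →ₐ[K] DAHA n S t Y) :=
  RingQuot.mkAlgHom_surjective K _

theorem twist_mk (b : rootsOfUnity n K) (x : FreeAlgebra K (DAHAGen n)) :
    twist b (mk x : DAHA n S t Y) = FreeAlgebra.lift K (twistGen (b : Kˣ)) x :=
  RingQuot.liftAlgHom_mkAlgHom_apply _ _ _ _

theorem twist_T (b : rootsOfUnity n K) (i : ZMod n) : twist b (T i : DAHA n S t Y) = T i := by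
  rw [T, twist_mk, FreeAlgebra.lift_ι_apply]; rfl

theorem twist_Z (b : rootsOfUnity n K) (i : ZMod n) : twist b (Z i : DAHA n S t Y) = Z i := by
  rw [Z, twist_mk, FreeAlgebra.lift_ι_apply]; rfl

theorem twist_Zinv (b : rootsOfUnity n K) (i : ZMod n) :
    twist b (Zinv i : DAHA n S t Y) = Zinv i := by
  rw [Zinv, twist_mk, FreeAlgebra.lift_ι_apply]; rfl

theorem twist_pi (b : rootsOfUnity n K) :
    twist b (pi : DAHA n S t Y) = ((b : Kˣ) : K) • pi := by
  rw [pi, twist_mk, FreeAlgebra.lift_ι_apply]; rfl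

theorem induction_generators [NeZero n] (A : Subalgebra K (DAHA n S t Y)) (hT : ∀ i : ZMod n, T i ∈ A)
    (hpi : pi ∈ A) (hZ : ∀ i, Z i ∈ A) (hZinv : ∀ i, Zinv i ∈ A) (a : DAHA n S t Y) : a ∈ A := by
  obtain ⟨x, rfl⟩ := mk_surjective a
  induction x using FreeAlgebra.induction with
  | grade0 r => rw [AlgHom.commutes]; exact A.algebraMap_mem r
  | grade1 g =>
    cases g with
    | T i => exact hT i
    | pi => exact hpi
    | piInv =>
      change piInv ∈ A
      rw [piInv_eq]
      exact A.pow_mem hpi _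
    | Z i => exact hZ i
    | Zinv i => exact hZinv i
  | mul x y hx hy => rw [map_mul]; exact A.mul_mem hx hy
  | add x y hx hy => rw [map_add]; exact A.add_mem hx hy

end Relations

section Modules

variable {K : Type*} [Field K] {n : ℕ} {S t Y : K}
variable {M : Type*} [AddCommGroup M] [Module K M] [Module (DAHA n S t Y) M]
  [IsScalarTower K (DAHA n S t Y) M]

/-- The subalgebra of all elements that map a subspace into itself. -/
def stabilizer (W : Submodule K M) : Subalgebra K (DAHA n S t Y) where
  carrier := {a | ∀ m ∈ W, a • m ∈ W}
  mul_mem' ha hb m hm := by rw [mul_smul]; exact ha _ (hb _ hm)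
  add_mem' ha hb m hm := by rw [add_smul]; exact W.add_mem (ha _ hm) (hb _ hm)
  algebraMap_mem' r m hm := by rw [algebraMap_smul]; exact W.smul_mem r hm

theorem smul_mem_of_generators [NeZero n] (W : Submodule K M)
    (hT : ∀ i : ℤ, ∀ m ∈ W, (Ti i : DAHA n S t Y) • m ∈ W)
    (hpi : ∀ m ∈ W, (pi : DAHA n S t Y) • m ∈ W)
    (hZ : ∀ i : ZMod n, ∀ m ∈ W, (Z i : DAHA n S t Y) • m ∈ W)
    (hZinv : ∀ i : ZMod n, ∀ m ∈ W, (Zinv i : DAHA n S t Y) • m ∈ W)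
    (a : DAHA n S t Y) {m : M} (hm : m ∈ W) : a • m ∈ W := by
  have := induction_generators (stabilizer (S := S) (t := t) (Y := Y) W) (fun i => by
    have := hT (PSYT.rep i)
    rwa [Ti, PSYT.intCast_rep] at this) hpi hZ hZinv a
  exact this m hm

/-- Both Z_i and q^{2 d(i)} are multiplied by q^{2n} when i grows by n, so n eigenvalues determine
all of them. -/
theorem Zi_smul_of_weight [NeZero n] (hS : S ≠ 0) {m : M} {d : ℤ → ℤ} (hd : ∀ i, d (i + n) = d i + n)
    (h : ∀ i : ZMod n, (Z i : DAHA n S t Y) • m = S ^ (2 * d (PSYT.rep i)) • m) (i : ℤ) :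
    (Zi i : DAHA n S t Y) • m = S ^ (2 * d i) • m := by
  have hd' : ∀ i m : ℤ, d (i + n * m) = d i + n * m := by
    intro i m
    induction m using Int.induction_on with
    | zero => simp
    | succ m ih => rw [mul_add, ← add_assoc, mul_one, hd, ih]; ring
    | pred m ih =>
      have := hd (i + n * (-(m : ℤ) - 1))
      rw [show i + (n : ℤ) * (-(m : ℤ) - 1) + n = i + n * (-m) by ring, ih] at this
      linarith
  rw [Zi, smul_assoc, h, PSYT.rep_intCast, smul_smul, ← zpow_add₀ hS]
  congr 2
  have h1 := Int.emod_add_mul_ediv (i - 1) n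
  have : d i = d ((i - 1) % n + 1) + n * ((i - 1) / n) := by
    rw [← hd']; congr 1; linarith
  rw [this]; ring

theorem Z_smul_of_Zi [NeZero n] {m : M} {d : ℤ → ℤ}
    (h : ∀ i : ℤ, (Zi i : DAHA n S t Y) • m = S ^ (2 * d i) • m) (i : ZMod n) :
    (Z i : DAHA n S t Y) • m = S ^ (2 * d (PSYT.rep i)) • m := by
  rw [Z_eq_Zi, h]

end Modules

end DAHA

/-! ## Relations between periodic transpositions -/

section ASwapRelations

variable {n : ℕ}

theorem aswap_sub_one (n : ℕ) (i j : ℤ) : aswap n i (j - 1) = aswap n (i + 1) j - 1 := by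
  simp only [aswap_apply, show j - 1 - i = j - (i + 1) by ring]
  split_ifs <;> ring

theorem aswap_comm {i j : ℤ} (h1 : ¬ (n : ℤ) ∣ j - i - 1) (h2 : ¬ (n : ℤ) ∣ i - j - 1) (l : ℤ) :
    aswap n i (aswap n j l) = aswap n j (aswap n i l) := by
  by_cases h0 : (n : ℤ) ∣ 1
  · simp [aswap_apply, h0]
  by_cases h : (n : ℤ) ∣ i - j
  · rw [aswap_congr h]
  have key : ∀ i j : ℤ, ¬ (n : ℤ) ∣ j - i - 1 → ¬ (n : ℤ) ∣ i - j - 1 → ¬ (n : ℤ) ∣ i - j →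
      ∀ m, (n : ℤ) ∣ m - i → aswap n i m = m + 1 ∧ aswap n i (m + 1) = m ∧
        aswap n j m = m ∧ aswap n j (m + 1) = m + 1 := by
    intro i j h1 h2 h m hm
    have d : ∀ a b : ℤ, m - i - a = b → (n : ℤ) ∣ a → (n : ℤ) ∣ b := fun a b e ha =>
      e ▸ dvd_sub hm ha
    refine ⟨aswap_left h0 hm, ?_, ?_, ?_⟩
    · rw [aswap_right h0 (by rwa [show m + 1 - i - 1 = m - i by ring])]; ring
    · refine aswap_other (fun H => h ?_) (fun H => h2 ?_)
      · exact (dvd_neg (α := ℤ)).mp (d _ _ (by ring) H)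
      · exact (dvd_neg (α := ℤ)).mp (d _ _ (by ring) H)
    · refine aswap_other (fun H => h1 ?_) (fun H => h ?_)
      · exact d _ _ (by ring) H
      · exact (dvd_neg (α := ℤ)).mp (d _ _ (by ring) H)
  have h' : ¬ (n : ℤ) ∣ j - i := fun H => h (by
    have := (dvd_neg (α := ℤ)).mpr H; rwa [neg_sub] at this)
  by_cases a : (n : ℤ) ∣ l - i
  · obtain ⟨a1, a2, a3, a4⟩ := key i j h1 h2 h l a
    simp only [a1, a3, a4]
  by_cases b : (n : ℤ) ∣ l - i - 1
  · obtain ⟨a1, a2, a3, a4⟩ := key i j h1 h2 h (l - 1) (by rwa [show l - 1 - i = l - i - 1 by ring])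
    simp only [sub_add_cancel] at a1 a2 a3 a4
    simp only [a2, a3, a4]
  by_cases c : (n : ℤ) ∣ l - j
  · obtain ⟨a1, a2, a3, a4⟩ := key j i h2 h1 h' l c
    simp only [a1, a3, a4]
  by_cases e : (n : ℤ) ∣ l - j - 1
  · obtain ⟨a1, a2, a3, a4⟩ := key j i h2 h1 h' (l - 1) (by
      rwa [show l - 1 - j = l - j - 1 by ring])
    simp only [sub_add_cancel] at a1 a2 a3 a4
    simp only [a2, a3, a4]
  simp only [aswap_other a b, aswap_other c e]

theorem aswap_braid (h1 : ¬ (n : ℤ) ∣ 1) (h2 : ¬ (n : ℤ) ∣ 2) (i l : ℤ) :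
    aswap n i (aswap n (i + 1) (aswap n i l)) =
      aswap n (i + 1) (aswap n i (aswap n (i + 1) l)) := by
  have e1 : ∀ m, (n : ℤ) ∣ m - i → aswap n i m = m + 1 ∧ aswap n i (m + 1) = m ∧
      aswap n i (m + 1 + 1) = m + 1 + 1 ∧ aswap n (i + 1) m = m ∧
      aswap n (i + 1) (m + 1) = m + 1 + 1 ∧ aswap n (i + 1) (m + 1 + 1) = m + 1 := by
    intro m hm
    refine ⟨aswap_left h1 hm, ?_, ?_, ?_, ?_, ?_⟩
    · rw [aswap_right h1 (by rwa [show m + 1 - i - 1 = m - i by ring])]; ring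
    · refine aswap_other (fun H => h2 ?_) (fun H => h1 ?_)
      · have := dvd_sub H hm; rwa [show m + 1 + 1 - i - (m - i) = 2 by ring] at this
      · have := dvd_sub H hm; rwa [show m + 1 + 1 - i - 1 - (m - i) = 1 by ring] at this
    · refine aswap_other (fun H => h1 ?_) (fun H => h2 ?_)
      · have := dvd_sub hm H; rwa [show m - i - (m - (i + 1)) = 1 by ring] at this
      · have := dvd_sub hm H; rwa [show m - i - (m - (i + 1) - 1) = 2 by ring] at this
    · exact aswap_left h1 (by rwa [show m + 1 - (i + 1) = m - i by ring])
    · rw [aswap_right h1 (by rwa [show m + 1 + 1 - (i + 1) - 1 = m - i by ring])]; ring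
  by_cases a : (n : ℤ) ∣ l - i
  · obtain ⟨a1, a2, a3, a4, a5, a6⟩ := e1 l a
    simp only [a1, a3, a4, a5]
  by_cases b : (n : ℤ) ∣ l - i - 1
  · obtain ⟨a1, a2, a3, a4, a5, a6⟩ := e1 (l - 1) (by rwa [show l - 1 - i = l - i - 1 by ring])
    simp only [sub_add_cancel] at a1 a2 a3 a4 a5 a6
    simp only [a1, a2, a3, a4, a5, a6]
  by_cases c : (n : ℤ) ∣ l - i - 2
  · obtain ⟨a1, a2, a3, a4, a5, a6⟩ := e1 (l - 2) (by rwa [show l - 2 - i = l - i - 2 by ring])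
    simp only [show l - 2 + 1 + 1 = l by ring] at a1 a2 a3 a4 a5 a6
    simp only [a2, a3, a4, a6]
  have f1 : aswap n i l = l := aswap_other a b
  have f2 : aswap n (i + 1) l = l := aswap_other (by rwa [show l - (i + 1) = l - i - 1 by ring])
    (by rwa [show l - (i + 1) - 1 = l - i - 2 by ring])
  simp only [f1, f2]
end ASwapRelations

/-! ### Words applied to a column vector and the exchange property -/

namespace DAHA

variable {K : Type*} [Field K] {N k : ℕ} [NeZero N] [NeZero k] {S t Y : K}
variable {M : Type*} [AddCommGroup M] [Module K M] [Module (DAHA (N * k) S t Y) M]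
  [IsScalarTower K (DAHA (N * k) S t Y) M]

/-- The properties of `v_{R₀}` that characterize a simple module: its weight is `wt(R₀)`, it is
antisymmetric for the column group, and `π ^ N` acts on it by the scalar `β`. -/
structure IsColumnVector (S t Y β : K) (x : M) [Module (DAHA (N * k) S t Y) M] : Prop where
  weight : ∀ i : ZMod (N * k), (Z i : DAHA (N * k) S t Y) • x = (PSYT.R₀ N k).wt S i • x
  T_smul : ∀ i : ℤ, ¬ (N : ℤ) ∣ i → (Ti i : DAHA (N * k) S t Y) • x = (-t⁻¹) • x
  pi_pow : (pi ^ N : DAHA (N * k) S t Y) • x = β • x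

theorem IsColumnVector.Zi_smul (hS : S ≠ 0) {β : K} {x : M}
    (h : IsColumnVector (N := N) (k := k) S t Y β x) (i : ℤ) :
    (Zi i : DAHA (N * k) S t Y) • x = S ^ (2 * (PSYT.R₀ N k).diagN i) • x :=
  Zi_smul_of_weight hS (PSYT.R₀ N k).diagN_add h.weight i

/-- Reduced words in the generators `T_i`, applied to the vectors `π ^ j x`, together with the
filling (increasing along columns, up to rotation by `m`) that is reached. -/
inductive IsWord (S t Y : K) [Module (DAHA (N * k) S t Y) M] (x : M) :
    ℕ → (ℤ ≃ Fin N × ℤ) → ℤ → M → Prop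
  | base (j : ℕ) : IsWord S t Y x 0 ((Equiv.subRight (j : ℤ)).trans (PSYT.R₀ N k).box) j
      ((pi ^ j : DAHA (N * k) S t Y) • x)
  | step {l : ℕ} {B : ℤ ≃ Fin N × ℤ} {m : ℤ} {y : M} (i : ℤ) :
      IsWord S t Y x l B m y → (B i).2 < (B (i + 1)).2 →
      IsWord S t Y x (l + 1) ((aswap (N * k) i).trans B) m ((Ti i : DAHA (N * k) S t Y) • y)

variable {x : M}

theorem IsWord.periodic {l : ℕ} {B : ℤ ≃ Fin N × ℤ} {m : ℤ} {y : M}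
    (h : IsWord (k := k) S t Y x l B m y) : BoxPeriodic k B := by
  induction h with
  | base j => exact ((PSYT.R₀ N k).rot j).boxPeriodic
  | step i _ _ ih => exact ih.trans_perm i

theorem snd_sub_congr {B : ℤ ≃ Fin N × ℤ} (hB : BoxPeriodic k B) {i j : ℤ}
    (h : ((N * k : ℕ) : ℤ) ∣ i - j) : (B (i + 1)).2 - (B i).2 = (B (j + 1)).2 - (B j).2 := by
  obtain ⟨m, hm⟩ := h
  obtain rfl : i = j + (N * k : ℕ) * m := by linarith
  rw [show j + ((N * k : ℕ) : ℤ) * m + 1 = j + 1 + (N * k : ℕ) * m by ring, hB.add_mul, hB.add_mul]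
  simp only
  ring

theorem IsWord.colIncreasing {l : ℕ} {B : ℤ ≃ Fin N × ℤ} {m : ℤ} {y : M}
    (h : IsWord (k := k) S t Y x l B m y) : ColIncreasing B := by
  induction h with
  | base j => exact ((PSYT.R₀ N k).rot j).colIncreasing
  | @step l B m y i hw hi ih =>
    intro r r' c hr
    refine aswap_lt (ih r r' c hr) ?_
    rintro ⟨h1, h2⟩
    have := snd_sub_congr hw.periodic h2
    rw [← h1] at this
    simp only [Equiv.apply_symm_apply] at this
    omega

variable (S t Y) in
/-- The span of all words of length less than `l`. -/
def wordSpan (x : M) (l : ℕ) : Submodule K M :=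
  Submodule.span K {y | ∃ l' < l, ∃ B m, IsWord (N := N) (k := k) S t Y x l' B m y}

theorem wordSpan_mono {l l' : ℕ} (h : l ≤ l') :
    wordSpan (N := N) (k := k) S t Y x l ≤ wordSpan (N := N) (k := k) S t Y x l' :=
  Submodule.span_mono fun _ ⟨a, ha, b⟩ => ⟨a, ha.trans_le h, b⟩

theorem IsWord.mem {l l' : ℕ} {B : ℤ ≃ Fin N × ℤ} {m : ℤ} {y : M}
    (h : IsWord (k := k) S t Y x l B m y) (hl : l < l') :
    y ∈ wordSpan (N := N) (k := k) S t Y x l' :=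
  Submodule.subset_span ⟨l, hl, B, m, h⟩

theorem smul_wordSpan {a : DAHA (N * k) S t Y} {l : ℕ} {W : Submodule K M}
    (h : ∀ l' < l, ∀ B m y, IsWord (N := N) (k := k) S t Y x l' B m y → a • y ∈ W) {y : M}
    (hy : y ∈ wordSpan (N := N) (k := k) S t Y x l) : a • y ∈ W := by
  rw [wordSpan] at hy
  induction hy using Submodule.span_induction with
  | mem y hy => obtain ⟨l', hl, B, m, hw⟩ := hy; exact h l' hl B m y hw
  | zero => rw [smul_zero]; exact W.zero_mem
  | add y z _ _ hy hz => rw [smul_add]; exact W.add_mem hy hz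
  | smul c y _ hy => rw [smul_comm]; exact W.smul_mem c hy

/-- The statement that descents of the filling can be split off from the words of length `l`. -/
def Exchange (S t Y : K) [Module (DAHA (N * k) S t Y) M] (x : M) (l : ℕ) : Prop :=
  ∀ (B : ℤ ≃ Fin N × ℤ) (m : ℤ) (y : M), IsWord (k := k) S t Y x l B m y → ∀ i : ℤ,
    ((B (i + 1)).2 < (B i).2 → ∃ l' y', l = l' + 1 ∧
      IsWord (k := k) S t Y x l' ((aswap (N * k) i).trans B) m y' ∧
      y - (Ti i : DAHA (N * k) S t Y) • y' ∈ wordSpan (N := N) (k := k) S t Y x l) ∧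
    ((B (i + 1)).2 ≤ (B i).2 →
      (Ti i : DAHA (N * k) S t Y) • y ∈ wordSpan (N := N) (k := k) S t Y x (l + 1))

/-- At an ascent of columns the word becomes longer by one letter; otherwise the second half of the
exchange property applies. -/
theorem Ti_smul_mem_wordSpan {l : ℕ} (H : ∀ l' < l, Exchange (N := N) (k := k) S t Y x l') (i : ℤ)
    {y : M} (hy : y ∈ wordSpan (N := N) (k := k) S t Y x l) :
    (Ti i : DAHA (N * k) S t Y) • y ∈ wordSpan (N := N) (k := k) S t Y x (l + 1) := by
  refine smul_wordSpan (fun l' hl B m y hw => ?_) hy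
  by_cases h : (B i).2 < (B (i + 1)).2
  · exact (hw.step i h).mem (by omega)
  · exact wordSpan_mono (by omega) ((H l' hl B m y hw i).2 (not_lt.mp h))

theorem aswap_trans_aswap_trans (n : ℕ) (i : ℤ) (B : ℤ ≃ Fin N × ℤ) :
    (aswap n i).trans ((aswap n i).trans B) = B := by
  ext1 j
  simp [aswap_aswap]

theorem Ti_Ti_smul (ht : t ≠ 0) (i : ℤ) (y : M) :
    (Ti i : DAHA (N * k) S t Y) • (Ti i : DAHA (N * k) S t Y) • y =
      (t - t⁻¹) • (Ti i : DAHA (N * k) S t Y) • y + y := by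
  rw [← mul_smul, Ti_mul_self ht, add_smul, one_smul, smul_assoc]

theorem aswap_add_two {n : ℕ} (h1 : ¬ (n : ℤ) ∣ 1) (h2 : ¬ (n : ℤ) ∣ 2) (j : ℤ) :
    aswap n j (j + 1 + 1) = j + 1 + 1 :=
  aswap_other (by rwa [show j + 1 + 1 - j = 2 by ring])
    (by rwa [show j + 1 + 1 - j - 1 = 1 by ring])

theorem aswap_succ_self {n : ℕ} (h1 : ¬ (n : ℤ) ∣ 1) (h2 : ¬ (n : ℤ) ∣ 2) (j : ℤ) :
    aswap n (j + 1) j = j :=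
  aswap_other (by rwa [show j - (j + 1) = -1 by ring, dvd_neg])
    (by rwa [show j - (j + 1) - 1 = -2 by ring, dvd_neg])

theorem not_dvd_two_ne {n : ℕ} (h2 : ¬ (n : ℤ) ∣ 2) : n ≠ 2 := by
  rintro rfl; exact h2 (by norm_num)

/-- The induction step for the exchange property, for the neighbour on the right. -/
theorem exchange_right (h1 : ¬ ((N * k : ℕ) : ℤ) ∣ 1)
    {l : ℕ} (H : ∀ l' < l + 1, Exchange (N := N) (k := k) S t Y x l')
    {B : ℤ ≃ Fin N × ℤ} {m : ℤ} {w : M} {j : ℤ} (hw : IsWord (k := k) S t Y x l B m w)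
    (hj : (B j).2 < (B (j + 1)).2)
    (hle : (B (aswap (N * k) j (j + 1 + 1))).2 ≤ (B (aswap (N * k) j (j + 1))).2) :
    ((B (aswap (N * k) j (j + 1 + 1))).2 < (B (aswap (N * k) j (j + 1))).2 →
      ∃ l' y', l + 1 = l' + 1 ∧ IsWord (k := k) S t Y x l'
        ((aswap (N * k) (j + 1)).trans ((aswap (N * k) j).trans B)) m y' ∧
        (Ti j : DAHA (N * k) S t Y) • w - (Ti (j + 1) : DAHA (N * k) S t Y) • y' ∈
          wordSpan (N := N) (k := k) S t Y x (l + 1)) ∧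
      (Ti (j + 1) : DAHA (N * k) S t Y) • (Ti j : DAHA (N * k) S t Y) • w ∈
        wordSpan (N := N) (k := k) S t Y x (l + 1 + 1) := by
  -- For n = 2 there is no braid relation, but the configuration cannot occur: the exchange also
  -- moves j + 2 to j + 3, whose column is that of j + 1 plus a non-negative multiple of k, against
  -- `hle`.
  have h2 : ¬ ((N * k : ℕ) : ℤ) ∣ 2 := by
    intro h2
    have e : aswap (N * k) j (j + 1 + 1) = j + 1 + 1 + 1 :=
      aswap_left h1 (by rwa [show j + 1 + 1 - j = 2 by ring])
    rw [aswap_succ h1, e] at hle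
    have h3 := snd_sub_congr hw.periodic
      (show ((N * k : ℕ) : ℤ) ∣ (j + 1 + 1) - j by rwa [show j + 1 + 1 - j = 2 by ring])
    obtain ⟨c, hc⟩ := h2
    have h4 := hw.periodic.add_mul j c
    rw [show j + ((N * k : ℕ) : ℤ) * c = j + 1 + 1 by linarith] at h4
    rw [h4] at h3
    simp only at h3
    have hc0 : 0 ≤ (k : ℤ) * c := by
      have hk : (0 : ℤ) ≤ k := by positivity
      have hc' : 0 < c := by
        by_contra hneg
        have : ((N * k : ℕ) : ℤ) * c ≤ 0 := mul_nonpos_of_nonneg_of_nonpos (by positivity) (by omega)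
        omega
      positivity
    omega
  rw [aswap_succ h1, aswap_add_two h1 h2] at *
  have T_mem := fun (l' : ℕ) (hl' : l' ≤ l + 1) (i : ℤ) (y : M) => Ti_smul_mem_wordSpan
    (l := l') (fun l'' hl'' => H l'' (by omega)) i (y := y)
  obtain ⟨l', w', rfl, hw', hmem⟩ := (H l (by omega) B m w hw (j + 1)).1 (by omega)
  have e1 : aswap (N * k) (j + 1) j = j := aswap_succ_self h1 h2 j
  have e2 : aswap (N * k) (j + 1) (j + 1) = j + 1 + 1 := aswap_self h1 _
  have e3 : aswap (N * k) (j + 1) (j + 1 + 1) = j + 1 := aswap_succ h1 _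
  have braid : ∀ y : M, (Ti j : DAHA (N * k) S t Y) • (Ti (j + 1) : DAHA (N * k) S t Y) •
      (Ti j : DAHA (N * k) S t Y) • y = (Ti (j + 1) : DAHA (N * k) S t Y) •
      (Ti j : DAHA (N * k) S t Y) • (Ti (j + 1) : DAHA (N * k) S t Y) • y := by
    intro y
    simp only [← mul_smul, ← mul_assoc]
    rw [braid_Ti (not_dvd_two_ne h2)]
  constructor
  · intro hlt
    -- The columns of j + 2, j, j + 1 increase strictly in this order, so w is T_{j+1} T_j w'' up to
    -- shorter words. The braid relation turns T_j w into T_{j+1} applied to the word T_j T_{j+1}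
    -- w''.
    obtain ⟨l'', w'', rfl, hw'', hmem'⟩ := (H l' (by omega) _ m w' hw' j).1 (by
      simp only [Equiv.trans_apply, e1, e2]; omega)
    have hw3 := hw''.step (j + 1) (by
      simp only [Equiv.trans_apply, aswap_succ h1, aswap_add_two h1 h2, e1]; omega)
    have hw4 := hw3.step j (by
      simp only [Equiv.trans_apply, aswap_succ h1, aswap_self h1, aswap_add_two h1 h2, e1]
      omega)
    refine ⟨_, (Ti j : DAHA (N * k) S t Y) • (Ti (j + 1) : DAHA (N * k) S t Y) • w'', rfl, ?_, ?_⟩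
    · convert hw4 using 1
      ext1 i
      simp only [Equiv.trans_apply]
      congr 1
      rw [← aswap_braid h1 h2 j, aswap_aswap]
    · have a1 := T_mem _ (by omega) j _ hmem
      have a2 := T_mem _ (by omega) j _ (T_mem _ (by omega) (j + 1) _ hmem')
      have := Submodule.add_mem _ a1 a2
      rw [smul_sub, smul_sub, smul_sub, braid] at this
      convert this using 1
      abel
  -- Only the last comparison may be an equality: T_{j+1} T_j T_{j+1} w' = T_j T_{j+1} T_j w', and
  -- T_j w' does not get longer.
  · have a1 := T_mem _ (by omega) (j + 1) _ (T_mem _ (by omega) j _ hmem)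
    have a2 := (H l' (by omega) _ m w' hw' j).2 (by
      simp only [Equiv.trans_apply, e1, e2]; omega)
    have a3 := T_mem _ (by omega) j _ (T_mem _ (by omega) (j + 1) _ a2)
    rw [smul_sub, smul_sub, ← braid] at a1
    have := Submodule.add_mem _ a1 a3
    rwa [sub_add_cancel] at this

/-- The induction step for the exchange property, for the neighbour on the left. -/
theorem exchange_left (h1 : ¬ ((N * k : ℕ) : ℤ) ∣ 1)
    {l : ℕ} (H : ∀ l' < l + 1, Exchange (N := N) (k := k) S t Y x l')
    {B : ℤ ≃ Fin N × ℤ} {m : ℤ} {w : M} {j : ℤ} (hw : IsWord (k := k) S t Y x l B m w)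
    (hj : (B (j + 1)).2 < (B (j + 1 + 1)).2)
    (hle : (B (aswap (N * k) (j + 1) (j + 1))).2 ≤ (B (aswap (N * k) (j + 1) j)).2) :
    ((B (aswap (N * k) (j + 1) (j + 1))).2 < (B (aswap (N * k) (j + 1) j)).2 →
      ∃ l' y', l + 1 = l' + 1 ∧ IsWord (k := k) S t Y x l'
        ((aswap (N * k) j).trans ((aswap (N * k) (j + 1)).trans B)) m y' ∧
        (Ti (j + 1) : DAHA (N * k) S t Y) • w - (Ti j : DAHA (N * k) S t Y) • y' ∈
          wordSpan (N := N) (k := k) S t Y x (l + 1)) ∧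
      (Ti j : DAHA (N * k) S t Y) • (Ti (j + 1) : DAHA (N * k) S t Y) • w ∈
        wordSpan (N := N) (k := k) S t Y x (l + 1 + 1) := by
  -- For n = 2 the exchange sends j to j − 1, a translate of j + 1, and `hj` and `hle` contradict
  -- each other.
  have h2 : ¬ ((N * k : ℕ) : ℤ) ∣ 2 := by
    intro h2
    have e : aswap (N * k) (j + 1) j = j - 1 :=
      aswap_right h1 (by rwa [show j - (j + 1) - 1 = -2 by ring, dvd_neg])
    rw [aswap_self h1, e] at hle
    obtain ⟨c, hc⟩ := h2
    have h4 := hw.periodic.add_mul (j - 1) c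
    rw [show j - 1 + ((N * k : ℕ) : ℤ) * c = j + 1 by linarith] at h4
    rw [h4] at hj
    simp only at hj
    have hc0 : 0 ≤ (k : ℤ) * c := by
      have hc' : 0 < c := by
        by_contra hneg
        have : ((N * k : ℕ) : ℤ) * c ≤ 0 := mul_nonpos_of_nonneg_of_nonpos (by positivity) (by omega)
        omega
      positivity
    omega
  rw [aswap_self h1, aswap_succ_self h1 h2] at *
  have T_mem := fun (l' : ℕ) (hl' : l' ≤ l + 1) (i : ℤ) (y : M) => Ti_smul_mem_wordSpan
    (l := l') (fun l'' hl'' => H l'' (by omega)) i (y := y)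
  obtain ⟨l', w', rfl, hw', hmem⟩ := (H l (by omega) B m w hw j).1 (by omega)
  have e1 : aswap (N * k) (j + 1) j = j := aswap_succ_self h1 h2 j
  have e2 : aswap (N * k) (j + 1) (j + 1) = j + 1 + 1 := aswap_self h1 _
  have e3 : aswap (N * k) (j + 1) (j + 1 + 1) = j + 1 := aswap_succ h1 _
  have braid : ∀ y : M, (Ti j : DAHA (N * k) S t Y) • (Ti (j + 1) : DAHA (N * k) S t Y) •
      (Ti j : DAHA (N * k) S t Y) • y = (Ti (j + 1) : DAHA (N * k) S t Y) •
      (Ti j : DAHA (N * k) S t Y) • (Ti (j + 1) : DAHA (N * k) S t Y) • y := by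
    intro y
    simp only [← mul_smul, ← mul_assoc]
    rw [braid_Ti (not_dvd_two_ne h2)]
  constructor
  · intro hlt
    obtain ⟨l'', w'', rfl, hw'', hmem'⟩ := (H l' (by omega) _ m w' hw' (j + 1)).1 (by
      simp only [Equiv.trans_apply, aswap_succ h1, aswap_add_two h1 h2]; omega)
    have hw3 := hw''.step j (by
      simp only [Equiv.trans_apply, aswap_self h1, aswap_add_two h1 h2, e1]; omega)
    have hw4 := hw3.step (j + 1) (by
      simp only [Equiv.trans_apply, aswap_succ h1, aswap_self h1, aswap_add_two h1 h2, e1]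
      omega)
    refine ⟨_, (Ti (j + 1) : DAHA (N * k) S t Y) • (Ti j : DAHA (N * k) S t Y) • w'', rfl, ?_, ?_⟩
    · convert hw4 using 1
      ext1 i
      simp only [Equiv.trans_apply]
      congr 1
      rw [aswap_braid h1 h2 j, aswap_aswap]
    · have a1 := T_mem _ (by omega) (j + 1) _ hmem
      have a2 := T_mem _ (by omega) (j + 1) _ (T_mem _ (by omega) j _ hmem')
      have := Submodule.add_mem _ a1 a2
      rw [smul_sub, smul_sub, smul_sub, ← braid] at this
      convert this using 1
      abel
  · have a1 := T_mem _ (by omega) j _ (T_mem _ (by omega) (j + 1) _ hmem)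
    have a2 := (H l' (by omega) _ m w' hw' (j + 1)).2 (by
      simp only [Equiv.trans_apply, aswap_succ h1, aswap_add_two h1 h2]; omega)
    have a3 := T_mem _ (by omega) (j + 1) _ (T_mem _ (by omega) j _ a2)
    rw [smul_sub, smul_sub, braid] at a1
    have := Submodule.add_mem _ a1 a3
    rwa [sub_add_cancel] at this

theorem R₀_col_lt {i : ℤ} (h : (N : ℤ) ∣ i) :
    ((PSYT.R₀ N k).box i).2 < ((PSYT.R₀ N k).box (i + 1)).2 := by
  have hN : (0 : ℤ) < N := by have := Nat.pos_of_neZero N; exact_mod_cast this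
  obtain ⟨m, rfl⟩ := h
  rw [PSYT.R₀_box_snd, PSYT.R₀_box_snd, add_sub_cancel_right, Int.mul_ediv_cancel_left _ hN.ne']
  have : ((N : ℤ) * m - 1) / N < m := by
    rw [Int.ediv_lt_iff_lt_mul hN]; linarith
  omega

/-- The exchange condition for minimal coset representatives, with Hecke relations producing shorter
words. Induct on the length and compare i with the leading letter j: equal letters use the quadratic
relation, neighbours the braid relation, and all other letters commute. For length zero there is no
descent, and T_i acts by a scalar where the columns agree. -/
theorem exchange (ht : t ≠ 0) (h1 : ¬ ((N * k : ℕ) : ℤ) ∣ 1) {β : K}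
    (hx : IsColumnVector (N := N) (k := k) S t Y β x) (l : ℕ) :
    Exchange (N := N) (k := k) S t Y x l := by
  induction l using Nat.strong_induction_on with
  | _ l H =>
  intro B m y hw i
  cases hw with
  | base j =>
    simp only [Equiv.trans_apply, Equiv.subRight_apply]
    have e : i + 1 - (j : ℤ) = i - j + 1 := by ring
    rw [e]
    refine ⟨fun h => absurd h (not_lt.mpr (PSYT.R₀_col_le _)), fun h => ?_⟩
    -- In R₀ the column increases exactly after multiples of N, so equal columns are covered by the
    -- antisymmetry of x.
    have hd : ¬ (N : ℤ) ∣ i - j := fun hd => absurd h (not_le.mpr (R₀_col_lt hd))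
    have : (Ti i : DAHA (N * k) S t Y) • (pi ^ j : DAHA (N * k) S t Y) • x =
        (-t⁻¹) • (pi ^ j : DAHA (N * k) S t Y) • x := by
      rw [← mul_smul, show i = (i - j) + j by ring, ← pi_pow_Ti, mul_smul, hx.T_smul _ hd,
        smul_comm]
    rw [this]
    exact Submodule.smul_mem _ _ ((IsWord.base j).mem (by omega))
  | @step l B _ w j hw hj =>
    by_cases c1 : ((N * k : ℕ) : ℤ) ∣ i - j
    · rw [Ti_congr c1, aswap_congr c1, aswap_trans_aswap_trans]
      refine ⟨fun _ => ⟨l, w, rfl, hw, by rw [sub_self]; exact Submodule.zero_mem _⟩, fun _ => ?_⟩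
      rw [Ti_Ti_smul ht]
      exact Submodule.add_mem _ (Submodule.smul_mem _ _ ((hw.step j hj).mem (by omega)))
        (hw.mem (by omega))
    by_cases c2 : ((N * k : ℕ) : ℤ) ∣ i - j - 1
    · have c2' : ((N * k : ℕ) : ℤ) ∣ i - (j + 1) := by rwa [show i - (j + 1) = i - j - 1 by ring]
      have hd := snd_sub_congr (hw.step j hj).periodic c2'
      simp only [Equiv.trans_apply] at hd ⊢
      rw [Ti_congr c2', aswap_congr c2']
      have := exchange_right h1 H hw hj
      exact ⟨fun h => (this (by omega)).1 (by omega), fun h => (this (by omega)).2⟩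
    by_cases c3 : ((N * k : ℕ) : ℤ) ∣ j - i - 1
    · have c3' : ((N * k : ℕ) : ℤ) ∣ j - (i + 1) := by rwa [show j - (i + 1) = j - i - 1 by ring]
      have hd := snd_sub_congr hw.periodic c3'
      simp only [Equiv.trans_apply] at hd ⊢
      rw [Ti_congr c3', aswap_congr c3']
      have := exchange_left h1 H hw (j := i) (by omega)
      exact ⟨fun h => (this (by omega)).1 (by omega), fun h => (this (by omega)).2⟩
    -- For n = 2 every i is congruent to j or j + 1, and both cases have been treated.
    · have hn2 : N * k ≠ 2 := by
        intro hn2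
        rw [hn2] at c1 c2
        omega
      have e1 : aswap (N * k) j i = i := aswap_other c1 c2
      have e2 : aswap (N * k) j (i + 1) = i + 1 := aswap_other
        (by rwa [show i + 1 - j = -(j - i - 1) by ring, dvd_neg])
        (by rwa [show i + 1 - j - 1 = i - j by ring])
      have f1 : aswap (N * k) i j = j := aswap_other
        (by rwa [show j - i = -(i - j) by ring, dvd_neg]) c3
      have f2 : aswap (N * k) i (j + 1) = j + 1 := aswap_other
        (by rwa [show j + 1 - i = -(i - j - 1) by ring, dvd_neg])
        (by rwa [show j + 1 - i - 1 = -(i - j) by ring, dvd_neg])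
      have comm : ∀ z : M, (Ti i : DAHA (N * k) S t Y) • (Ti j : DAHA (N * k) S t Y) • z =
          (Ti j : DAHA (N * k) S t Y) • (Ti i : DAHA (N * k) S t Y) • z := by
        intro z
        rw [← mul_smul, Ti_comm hn2 c3 c2, mul_smul]
      simp only [Equiv.trans_apply, e1, e2]
      constructor
      · intro hlt
        obtain ⟨l', w', rfl, hw', hmem⟩ := (H l (by omega) B m w hw i).1 hlt
        refine ⟨_, (Ti j : DAHA (N * k) S t Y) • w', rfl, ?_, ?_⟩
        · convert hw'.step j (by simpa only [Equiv.trans_apply, f1, f2] using hj) using 1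
          ext1 a
          simp only [Equiv.trans_apply]
          rw [aswap_comm c2 c3]
        · rw [comm, ← smul_sub]
          exact Ti_smul_mem_wordSpan (fun l'' h'' => H l'' (by omega)) j hmem
      · intro hle
        rw [comm]
        exact Ti_smul_mem_wordSpan (fun l'' h'' => H l'' (by omega)) j
          ((H l (by omega) B m w hw i).2 hle)

end DAHA

theorem zpow_injective_of_not_root {K : Type*} [Field K] {S : K} (hS : S ≠ 0)
    (hS' : ∀ m : ℕ, 0 < m → S ^ m ≠ 1) {a b : ℤ} (h : S ^ a = S ^ b) : a = b := by
  have key : ∀ a b : ℤ, a < b → S ^ a ≠ S ^ b := by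
    intro a b hab h
    have : S ^ (b - a) = 1 := by rw [zpow_sub₀ hS, h, div_self (zpow_ne_zero _ hS)]
    obtain ⟨m, hm⟩ := Int.eq_ofNat_of_zero_le (by omega : 0 ≤ b - a)
    rw [hm, zpow_natCast] at this
    exact hS' m (by omega) this
  rcases lt_trichotomy a b with hab | hab | hab
  · exact absurd h (key a b hab)
  · exact hab
  · exact absurd h.symm (key b a hab)

/-! ### Triangularity of the Z_i and the weight space of a column vector -/

namespace DAHA

variable {K : Type*} [Field K] {N k : ℕ} [NeZero N] [NeZero k] {S t Y : K}
variable {M : Type*} [AddCommGroup M] [Module K M] [Module (DAHA (N * k) S t Y) M]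
  [IsScalarTower K (DAHA (N * k) S t Y) M]
variable {x : M}

/-- The diagonal labels of a filling that is rotated by `m`. -/
noncomputable def fillingDiag (k : ℕ) (B : ℤ ≃ Fin N × ℤ) (m : ℤ) (i : ℤ) : ℤ :=
  N * ((B i).2 - ((B i).1 : ℕ)) + m + ((PSYT.R₀ N k).p - N)

/-- On π^j x the eigenvalue is exact. Moving Z_i past the leading T_j exchanges the index just as
the filling is exchanged, and the correction in `Zi_Ti` or `Zi_succ_Ti` lies in the span of shorter
words. -/
theorem IsWord.Zi_smul_sub_mem (hS : S ≠ 0) (ht : t ≠ 0) (h1 : ¬ ((N * k : ℕ) : ℤ) ∣ 1) {β : K}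
    (hx : IsColumnVector (N := N) (k := k) S t Y β x) {l : ℕ} {B : ℤ ≃ Fin N × ℤ} {m : ℤ} {y : M}
    (hw : IsWord (k := k) S t Y x l B m y) (i : ℤ) :
    (Zi i : DAHA (N * k) S t Y) • y - S ^ (2 * fillingDiag k B m i) • y ∈
      wordSpan (N := N) (k := k) S t Y x l := by
  induction l using Nat.strong_induction_on generalizing B m y i with
  | _ l ih =>
  have Z_mem : ∀ l' ≤ l, ∀ (i : ℤ) (z : M), z ∈ wordSpan (N := N) (k := k) S t Y x l' →
      (Zi i : DAHA (N * k) S t Y) • z ∈ wordSpan (N := N) (k := k) S t Y x l' := by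
    intro l' hl' i z hz
    refine smul_wordSpan (fun l'' hl'' B m z hw => ?_) hz
    have a := wordSpan_mono hl''.le (ih l'' (by omega) hw i)
    have b := Submodule.smul_mem _ (S ^ (2 * fillingDiag k B m i)) (hw.mem hl'')
    have := Submodule.add_mem _ a b
    rwa [sub_add_cancel] at this
  cases hw with
  | base j =>
    have : (Zi i : DAHA (N * k) S t Y) • (pi ^ j : DAHA (N * k) S t Y) • x =
        S ^ (2 * fillingDiag k ((Equiv.subRight (j : ℤ)).trans (PSYT.R₀ N k).box) j i) •
          (pi ^ j : DAHA (N * k) S t Y) • x := by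
      have h := pi_pow_Zi (n := N * k) (t := t) (Y := Y) hS j (i - j)
      rw [sub_add_cancel] at h
      have h2 : (Zi i * pi ^ j : DAHA (N * k) S t Y) = S ^ (2 * j : ℤ) • (pi ^ j * Zi (i - j)) := by
        rw [h, smul_smul, ← zpow_add₀ hS]; simp
      rw [← mul_smul, h2, smul_assoc, mul_smul, hx.Zi_smul hS, smul_comm _ (S ^ _), smul_smul,
        ← zpow_add₀ hS]
      congr 2
      rw [PSYT.diagN_eq, PSYT.content, fillingDiag]
      simp only [Equiv.trans_apply, Equiv.subRight_apply]
      ring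
    rw [this, sub_self]
    exact Submodule.zero_mem _
  | @step l B _ w j hw hj =>
    have T_mem : ∀ (j : ℤ) (z : M), z ∈ wordSpan (N := N) (k := k) S t Y x l →
        (Ti j : DAHA (N * k) S t Y) • z ∈ wordSpan (N := N) (k := k) S t Y x (l + 1) :=
      fun j z hz => Ti_smul_mem_wordSpan (fun l' _ => exchange ht h1 hx l') j hz
    have hw1 : w ∈ wordSpan (N := N) (k := k) S t Y x (l + 1) := hw.mem (by omega)
    rcases aswap_cases h1 j i with ⟨a, b⟩ | ⟨a, b⟩ | ⟨a, a', b⟩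
    · have e : fillingDiag k ((aswap (N * k) j).trans B) m i = fillingDiag k B m (i + 1) := by
        simp only [fillingDiag, Equiv.trans_apply, b]
      rw [e, Ti_congr (by rwa [← dvd_neg, neg_sub] : ((N * k : ℕ) : ℤ) ∣ j - i), ← mul_smul,
        Zi_Ti hS ht, sub_smul, mul_smul, smul_assoc]
      have h2 := T_mem i _ (ih l (by omega) hw (i + 1))
      have h3 := Submodule.smul_mem _ (t - t⁻¹) (Z_mem (l + 1) le_rfl (i + 1) w hw1)
      rw [smul_sub, smul_comm _ (S ^ _)] at h2
      have := Submodule.sub_mem _ h2 h3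
      convert this using 1
      abel
    · have e : fillingDiag k ((aswap (N * k) j).trans B) m i = fillingDiag k B m (i - 1) := by
        simp only [fillingDiag, Equiv.trans_apply, b]
      obtain ⟨i, rfl⟩ : ∃ i', i = i' + 1 := ⟨i - 1, by ring⟩
      rw [add_sub_cancel_right] at e
      rw [e, Ti_congr (by rwa [← dvd_neg, neg_sub, show i - j = i + 1 - j - 1 by ring] :
          ((N * k : ℕ) : ℤ) ∣ j - i), ← mul_smul,
        Zi_succ_Ti hS ht, add_smul, mul_smul, smul_assoc]
      have h2 := T_mem i _ (ih l (by omega) hw i)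
      have h3 := Submodule.smul_mem _ (t - t⁻¹) (Z_mem (l + 1) le_rfl (i + 1) w hw1)
      rw [smul_sub, smul_comm _ (S ^ _)] at h2
      have := Submodule.add_mem _ h2 h3
      convert this using 1
      abel
    · have e : fillingDiag k ((aswap (N * k) j).trans B) m i = fillingDiag k B m i := by
        simp only [fillingDiag, Equiv.trans_apply, b]
      rw [e, ← mul_smul, ← Ti_Zi_comm a a', mul_smul]
      have h2 := T_mem j _ (ih l (by omega) hw i)
      rwa [smul_sub, smul_comm _ (S ^ _)] at h2

theorem Zi_smul_mem_wordSpan (hS : S ≠ 0) (ht : t ≠ 0) (h1 : ¬ ((N * k : ℕ) : ℤ) ∣ 1) {β : K}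
    (hx : IsColumnVector (N := N) (k := k) S t Y β x) {l : ℕ} (i : ℤ) {z : M}
    (hz : z ∈ wordSpan (N := N) (k := k) S t Y x l) :
    (Zi i : DAHA (N * k) S t Y) • z ∈ wordSpan (N := N) (k := k) S t Y x l := by
  refine smul_wordSpan (fun l' hl' B m z hw => ?_) hz
  have a := wordSpan_mono hl'.le (hw.Zi_smul_sub_mem hS ht h1 hx i)
  have b := Submodule.smul_mem _ (S ^ (2 * fillingDiag k B m i)) (hw.mem hl')
  have := Submodule.add_mem _ a b
  rwa [sub_add_cancel] at this

/-- Z_i is triangular with non-zero diagonal entries, so its inverse respects the filtration by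
length too. -/
theorem Zinv_smul_mem_wordSpan (hS : S ≠ 0) (ht : t ≠ 0) (h1 : ¬ ((N * k : ℕ) : ℤ) ∣ 1) {β : K}
    (hx : IsColumnVector (N := N) (k := k) S t Y β x) (l : ℕ) (i : ZMod (N * k)) {z : M}
    (hz : z ∈ wordSpan (N := N) (k := k) S t Y x l) :
    (Zinv i : DAHA (N * k) S t Y) • z ∈ wordSpan (N := N) (k := k) S t Y x l := by
  induction l using Nat.strong_induction_on generalizing z with
  | _ l ih =>
  refine smul_wordSpan (fun l' hl' B m z hw => ?_) hz
  have a := hw.Zi_smul_sub_mem hS ht h1 hx (PSYT.rep i)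
  have b := wordSpan_mono hl'.le (ih l' hl' a)
  rw [← Z_eq_Zi, smul_sub, ← mul_smul, Zinv_Z, one_smul, smul_comm] at b
  have c := Submodule.sub_mem _ (hw.mem hl') b
  rw [sub_sub_cancel] at c
  have := Submodule.smul_mem _ (S ^ (2 * fillingDiag k B m (PSYT.rep i)))⁻¹ c
  rwa [smul_smul, inv_mul_cancel₀ (zpow_ne_zero _ hS), one_smul] at this

theorem IsWord.pi_smul {l : ℕ} {B : ℤ ≃ Fin N × ℤ} {m : ℤ} {y : M}
    (hw : IsWord (k := k) S t Y x l B m y) :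
    IsWord (k := k) S t Y x l ((Equiv.subRight 1).trans B) (m + 1)
      ((pi : DAHA (N * k) S t Y) • y) := by
  induction hw with
  | base j =>
    have := IsWord.base (N := N) (k := k) (S := S) (t := t) (Y := Y) (x := x) (j + 1)
    rw [pow_succ', mul_smul] at this
    convert this using 1
    · ext1 i
      simp only [Equiv.trans_apply, Equiv.subRight_apply]
      congr 1; push_cast; ring
    · push_cast; ring
  | step i hw hi ih =>
    have := ih.step (i + 1) (by
      simpa only [Equiv.trans_apply, Equiv.subRight_apply, add_sub_cancel_right] using hi)
    rw [← mul_smul, pi_Ti, mul_smul]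
    convert this using 1
    ext1 j
    simp only [Equiv.trans_apply, Equiv.subRight_apply, aswap_sub_one]

theorem exists_mem_wordSpan (hS : S ≠ 0) (ht : t ≠ 0) (h1 : ¬ ((N * k : ℕ) : ℤ) ∣ 1) {β : K}
    (hx : IsColumnVector (N := N) (k := k) S t Y β x) (a : DAHA (N * k) S t Y) :
    ∃ l, a • x ∈ wordSpan (N := N) (k := k) S t Y x l := by
  let W : Submodule K M := ⨆ l, wordSpan (N := N) (k := k) S t Y x l
  have hdir : Monotone (wordSpan (N := N) (k := k) S t Y x) := fun _ _ h => wordSpan_mono h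
  have hW : ∀ z : M, z ∈ W ↔ ∃ l, z ∈ wordSpan (N := N) (k := k) S t Y x l := fun z =>
    Submodule.mem_iSup_of_directed _ hdir.directed_le
  rw [← hW]
  refine smul_mem_of_generators W ?_ ?_ ?_ ?_ a ?_
  · intro i z hz
    obtain ⟨l, hl⟩ := (hW z).mp hz
    exact (hW _).mpr ⟨l + 1, Ti_smul_mem_wordSpan (fun l' _ => exchange ht h1 hx l') i hl⟩
  · intro z hz
    obtain ⟨l, hl⟩ := (hW z).mp hz
    exact (hW _).mpr ⟨l, smul_wordSpan (fun l' hl' B m z hw => hw.pi_smul.mem hl') hl⟩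
  · intro i z hz
    obtain ⟨l, hl⟩ := (hW z).mp hz
    rw [Z_eq_Zi]
    exact (hW _).mpr ⟨l, Zi_smul_mem_wordSpan hS ht h1 hx _ hl⟩
  · intro i z hz
    obtain ⟨l, hl⟩ := (hW z).mp hz
    exact (hW _).mpr ⟨l, Zinv_smul_mem_wordSpan hS ht h1 hx l i hl⟩
  · have := IsWord.base (N := N) (k := k) (S := S) (t := t) (Y := Y) (x := x) 0
    rw [pow_zero, one_smul] at this
    exact (hW _).mpr ⟨1, this.mem (by omega)⟩

/-- If the weight is that of R₀, the filling, having increasing columns, is a horizontal shift of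
R₀. A word with a letter has a descent of columns, which R₀ has not. A word π^j x has rotation
number j, and the shift forces N ∣ j, so π^j acts on x by a power of β. -/
theorem IsWord.mem_span_or_exists_ne {β : K}
    (hx : IsColumnVector (N := N) (k := k) S t Y β x) {l : ℕ} {B : ℤ ≃ Fin N × ℤ} {m : ℤ} {y : M}
    (hw : IsWord (k := k) S t Y x l B m y) (h1 : ¬ ((N * k : ℕ) : ℤ) ∣ 1) :
    y ∈ Submodule.span K {x} ∨ ∃ i, fillingDiag k B m i ≠ (PSYT.R₀ N k).diagN i := by
  by_contra! H
  obtain ⟨hy, H⟩ := H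
  have hN : (N : ℤ) ≠ 0 := by exact_mod_cast NeZero.ne N
  obtain ⟨s, hs⟩ := (PSYT.R₀ N k).eq_shift_of_content_eq hw.colIncreasing m (fun i => by
    have := H i
    rw [fillingDiag, PSYT.diagN_eq] at this
    linarith)
  cases hw with
  | base j =>
    apply hy
    have h0 := H 0
    have h1 := hs 0
    rw [fillingDiag, PSYT.diagN_eq, PSYT.content] at h0
    have h2 : ((PSYT.R₀ N k).box 0).2 =
      (((Equiv.subRight (j : ℤ)).trans (PSYT.R₀ N k).box) 0).2 + s := by
      have := congrArg Prod.snd h1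
      exact this
    have h3 : ((PSYT.R₀ N k).box 0).1 =
      (((Equiv.subRight (j : ℤ)).trans (PSYT.R₀ N k).box) 0).1 := by
      have := congrArg Prod.fst h1
      exact this
    rw [h2, h3] at h0
    have hj : (j : ℤ) = N * s := by linarith
    obtain ⟨q, hq⟩ : N ∣ j := Int.natCast_dvd_natCast.mp ⟨s, hj⟩
    have : ∀ q : ℕ, ((pi ^ N) ^ q : DAHA (N * k) S t Y) • x = β ^ q • x := by
      intro q
      induction q with
      | zero => simp
      | succ q ih => rw [pow_succ, mul_smul, hx.pi_pow, smul_comm, ih, smul_smul, pow_succ']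
    rw [hq, pow_mul, this]
    exact Submodule.smul_mem _ _ (Submodule.mem_span_singleton_self x)
  | step i hw hi =>
    have a := hs i
    have b := hs (i + 1)
    simp only [Equiv.trans_apply, aswap_self h1, aswap_succ h1] at a b
    have := PSYT.R₀_col_le (N := N) (k := k) i
    rw [a, b] at this
    simp only at this
    omega

/-- Products of elements `Z_i - ζ` that act by non-zero scalars on the vectors of weight
`q ^ (2 d)`. -/
def weightKillers (S t Y : K) (d : ℤ → ℤ) : Submonoid (DAHA (N * k) S t Y) :=
  Submonoid.closure {a | ∃ i ζ, ζ ≠ S ^ (2 * d i) ∧ a = Zi i - algebraMap K _ ζ}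

variable {d : ℤ → ℤ}

theorem weightKillers_comm {a b : DAHA (N * k) S t Y} (ha : a ∈ weightKillers (N := N) (k := k) S t Y d)
    (hb : b ∈ weightKillers (N := N) (k := k) S t Y d) : a * b = b * a := by
  induction ha, hb using Submonoid.closure_induction₂ with
  | mem a b ha hb =>
    obtain ⟨i, ζ, -, rfl⟩ := ha
    obtain ⟨j, ξ, -, rfl⟩ := hb
    have h : Commute (Zi i : DAHA (N * k) S t Y) (Zi j) := Zi_comm i j
    exact (h.sub_left (Algebra.commute_algebraMap_left ζ _)).sub_right
      (Algebra.commute_algebraMap_right _ _)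
  | one_left => simp
  | one_right => simp
  | mul_left a b c _ _ _ h h' => exact (Commute.mul_left h h' : Commute _ _)
  | mul_right a b c _ _ _ h h' => exact (Commute.mul_right h h' : Commute _ _)

theorem weightKillers_smul {a : DAHA (N * k) S t Y} (ha : a ∈ weightKillers (N := N) (k := k) S t Y d) :
    ∃ χ : K, χ ≠ 0 ∧ ∀ y : M, (∀ i, (Zi i : DAHA (N * k) S t Y) • y = S ^ (2 * d i) • y) →
      a • y = χ • y := by
  induction ha using Submonoid.closure_induction with
  | mem a ha =>
    obtain ⟨i, ζ, hζ, rfl⟩ := ha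
    refine ⟨S ^ (2 * d i) - ζ, sub_ne_zero.mpr hζ.symm, fun y hy => ?_⟩
    rw [sub_smul, hy, algebraMap_smul, sub_smul]
  | one => exact ⟨1, one_ne_zero, fun y _ => by simp⟩
  | mul a b _ _ ha hb =>
    obtain ⟨χ, h, h'⟩ := ha
    obtain ⟨ψ, g, g'⟩ := hb
    refine ⟨χ * ψ, mul_ne_zero h g, fun y hy => ?_⟩
    rw [mul_smul, g' y hy, smul_comm, h' y hy, smul_smul, mul_comm]

theorem weightKillers_smul_mem {W : Submodule K M}
    (hW : ∀ i, ∀ z ∈ W, (Zi i : DAHA (N * k) S t Y) • z ∈ W) {a : DAHA (N * k) S t Y}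
    (ha : a ∈ weightKillers (N := N) (k := k) S t Y d) {z : M} (hz : z ∈ W) : a • z ∈ W := by
  induction ha using Submonoid.closure_induction generalizing z with
  | mem a ha =>
    obtain ⟨i, ζ, hζ, rfl⟩ := ha
    rw [sub_smul, algebraMap_smul]
    exact W.sub_mem (hW _ _ hz) (W.smul_mem _ hz)
  | one => simpa using hz
  | mul a b _ _ ha hb => rw [mul_smul]; exact ha (hb hz)

/-- If a subspace is spanned, modulo a smaller `W`, by vectors of other weights, then
all vectors in it of the given weight lie in `W`. -/
theorem mem_of_weight {W : Submodule K M}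
    (hW : ∀ i, ∀ z ∈ W, (Zi i : DAHA (N * k) S t Y) • z ∈ W) {X : Set M}
    (hX : ∀ y ∈ X, y ∈ W ∨ ∃ i ζ, ζ ≠ S ^ (2 * d i) ∧
      (Zi i : DAHA (N * k) S t Y) • y - ζ • y ∈ W) {y : M} (hy : y ∈ Submodule.span K X)
    (hd : ∀ i, (Zi i : DAHA (N * k) S t Y) • y = S ^ (2 * d i) • y) : y ∈ W := by
  -- Each spanning vector is sent into W by some element of the commutative monoid, so the product
  -- of these elements works for a sum. On a vector of the given weight it is a non-zero scalar,
  -- which can be divided out.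
  have key : ∃ a ∈ weightKillers (N := N) (k := k) S t Y d, a • y ∈ W := by
    clear hd
    induction hy using Submodule.span_induction with
    | mem y hy =>
      rcases hX y hy with h | ⟨i, ζ, hζ, h⟩
      · exact ⟨1, one_mem _, by simpa using h⟩
      · refine ⟨_, Submonoid.subset_closure ⟨i, ζ, hζ, rfl⟩, ?_⟩
        rwa [sub_smul, algebraMap_smul]
    | zero => exact ⟨1, one_mem _, by simp⟩
    | add y z _ _ hy hz =>
      obtain ⟨a, ha, ha'⟩ := hy
      obtain ⟨b, hb, hb'⟩ := hz
      refine ⟨a * b, mul_mem ha hb, ?_⟩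
      rw [smul_add]
      refine W.add_mem ?_ ?_
      · rw [weightKillers_comm ha hb, mul_smul]
        exact weightKillers_smul_mem hW hb ha'
      · rw [mul_smul]
        exact weightKillers_smul_mem hW ha hb'
    | smul c y _ hy =>
      obtain ⟨a, ha, ha'⟩ := hy
      exact ⟨a, ha, by rw [smul_comm]; exact W.smul_mem c ha'⟩
  obtain ⟨a, ha, haW⟩ := key
  obtain ⟨χ, hχ, h⟩ := weightKillers_smul (M := M) ha
  rw [h y hd] at haW
  have := W.smul_mem χ⁻¹ haW
  rwa [smul_smul, inv_mul_cancel₀ hχ, one_smul] at this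

/-- Words of maximal length lie in Kx or have another weight modulo shorter words. By
`mem_of_weight` they can be discarded from y, up to a multiple of x, and the length drops. -/
theorem mem_span_of_mem_wordSpan (hS : S ≠ 0) (hS' : ∀ m : ℕ, 0 < m → S ^ m ≠ 1) (ht : t ≠ 0)
    (h1 : ¬ ((N * k : ℕ) : ℤ) ∣ 1) {β : K}
    (hx : IsColumnVector (N := N) (k := k) S t Y β x) {l : ℕ} {y : M}
    (hy : y ∈ wordSpan (N := N) (k := k) S t Y x l)
    (hd : ∀ i, (Zi i : DAHA (N * k) S t Y) • y = S ^ (2 * (PSYT.R₀ N k).diagN i) • y) :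
    y ∈ Submodule.span K {x} := by
  induction l generalizing y with
  | zero =>
    have : wordSpan (N := N) (k := k) S t Y x 0 = ⊥ := by
      rw [wordSpan, Submodule.span_eq_bot]
      rintro y ⟨l', hl', -⟩
      omega
    rw [this, Submodule.mem_bot] at hy
    rw [hy]; exact Submodule.zero_mem _
  | succ l ih =>
    have hxZ : ∀ i, ∀ z ∈ Submodule.span K {x}, (Zi i : DAHA (N * k) S t Y) • z ∈
        Submodule.span K {x} := by
      intro i z hz
      obtain ⟨c, rfl⟩ := Submodule.mem_span_singleton.mp hz
      rw [smul_comm, hx.Zi_smul hS]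
      exact Submodule.smul_mem _ _ (Submodule.smul_mem _ _ (Submodule.mem_span_singleton_self x))
    have hmem : y ∈ wordSpan (N := N) (k := k) S t Y x l ⊔ Submodule.span K {x} := by
      refine mem_of_weight (d := (PSYT.R₀ N k).diagN) ?_ ?_ hy hd
      · intro i z hz
        obtain ⟨a, ha, b, hb, rfl⟩ := Submodule.mem_sup.mp hz
        rw [smul_add]
        exact Submodule.add_mem_sup (Zi_smul_mem_wordSpan hS ht h1 hx i ha) (hxZ i b hb)
      · rintro z ⟨l', hl', B, m, hw⟩
        rcases hw.mem_span_or_exists_ne hx h1 with h | ⟨i, hi⟩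
        · exact Or.inl (Submodule.mem_sup_right h)
        · refine Or.inr ⟨i, S ^ (2 * fillingDiag k B m i), fun H => hi ?_,
            Submodule.mem_sup_left (wordSpan_mono (by omega)
              (hw.Zi_smul_sub_mem hS ht h1 hx i))⟩
          have := zpow_injective_of_not_root hS hS' H
          omega
    obtain ⟨a, ha, b, hb, rfl⟩ := Submodule.mem_sup.mp hmem
    refine Submodule.add_mem _ (ih ha fun i => ?_) hb
    obtain ⟨c, rfl⟩ := Submodule.mem_span_singleton.mp hb
    have h2 := hd i
    rw [smul_add, smul_add, smul_comm _ c, hx.Zi_smul hS, smul_comm c] at h2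
    exact add_right_cancel h2

/-- In the module generated by a column vector `x`, the weight space of `x` is a line. -/
theorem smul_mem_span_of_weight (hS : S ≠ 0) (hS' : ∀ m : ℕ, 0 < m → S ^ m ≠ 1) (ht : S ^ N = t)
    {β : K} (hx : IsColumnVector (N := N) (k := k) S t Y β x) (a : DAHA (N * k) S t Y)
    (hd : ∀ i, (Zi i : DAHA (N * k) S t Y) • a • x = S ^ (2 * (PSYT.R₀ N k).diagN i) • a • x) :
    a • x ∈ Submodule.span K {x} := by
  have ht0 : t ≠ 0 := by rw [← ht]; exact pow_ne_zero _ hS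
  -- For n = 1 there are no exchanges. Here Kx is stable under all generators: the product relation
  -- makes Z_1 a scalar, and T Z T then determines T² on x, hence T on x by the quadratic relation
  -- and t² ≠ 1.
  by_cases h1 : ((N * k : ℕ) : ℤ) ∣ 1
  · have hn : N * k = 1 := Nat.dvd_one.mp (by exact_mod_cast h1)
    have hN : N = 1 := Nat.eq_one_of_mul_eq_one_right hn
    have hxx := Submodule.mem_span_singleton_self (R := K) x
    have mem : ∀ b : DAHA (N * k) S t Y, b • x ∈ Submodule.span K {x} → ∀ m ∈ Submodule.span K {x},
        b • m ∈ Submodule.span K {x} := by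
      intro b hb m hm
      obtain ⟨c, rfl⟩ := Submodule.mem_span_singleton.mp hm
      rw [smul_comm]
      exact Submodule.smul_mem _ _ hb
    refine smul_mem_of_generators _ (fun i => mem _ ?_) (mem _ ?_) (fun i => mem _ ?_)
      (fun i => mem _ ?_) a hxx
    · rw [Ti_congr (h1.trans (one_dvd _) : ((N * k : ℕ) : ℤ) ∣ i - 1)]
      by_cases hx0 : x = 0
      · rw [hx0, smul_zero]; exact Submodule.zero_mem _
      have hprod := prod_Zi (K := K) (n := N * k) (S := S) (t := t) (Y := Y)
      obtain ⟨c, hc⟩ : ∃ c : K, (Zi 1 : DAHA (N * k) S t Y) = algebraMap K _ c := by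
        refine ⟨_, Eq.trans ?_ hprod⟩
        simp [hn]
      have h2 := hx.Zi_smul hS 1
      rw [hc, algebraMap_smul] at h2
      have hc0 : c ≠ 0 := by
        rw [smul_left_injective K hx0 h2]
        exact zpow_ne_zero _ hS
      have h3 := congrArg (· • x) (Ti_Zi_Ti (n := N * k) (t := t) (Y := Y) hS 1)
      simp only [mul_smul, hc, algebraMap_smul] at h3
      rw [smul_comm _ c, Ti_Ti_smul ht0, hx.Zi_smul hS] at h3
      have ht1 : t - t⁻¹ ≠ 0 := by
        intro H
        rw [sub_eq_zero, eq_comm, inv_eq_iff_eq_inv, ← mul_eq_one_iff_eq_inv₀ ht0, ← ht,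
          ← pow_add] at H
        exact hS' _ (by have := Nat.pos_of_neZero N; omega) H
      have h4 : (Ti 1 : DAHA (N * k) S t Y) • x = ((c * (t - t⁻¹))⁻¹ *
          (S ^ (2 * (PSYT.R₀ N k).diagN (1 + 1)) - c)) • x := by
        rw [mul_smul, eq_inv_smul_iff₀ (mul_ne_zero hc0 ht1), sub_smul, ← h3, smul_add, mul_smul]
        abel
      rw [h4]; exact Submodule.smul_mem _ _ hxx
    · have := hx.pi_pow
      subst hN
      rw [pow_one] at this
      rw [this]; exact Submodule.smul_mem _ _ hxx
    · rw [hx.weight]; exact Submodule.smul_mem _ _ hxx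
    · have h2 := congrArg ((Zinv i : DAHA (N * k) S t Y) • ·) (hx.weight i)
      rw [← mul_smul, Zinv_Z, one_smul, smul_comm] at h2
      have hw : (PSYT.R₀ N k).wt S i ≠ 0 := zpow_ne_zero _ hS
      have h3 : (Zinv i : DAHA (N * k) S t Y) • x = ((PSYT.R₀ N k).wt S i)⁻¹ • x := by
        rw [eq_inv_smul_iff₀ hw]
        exact h2.symm
      rw [h3]
      exact Submodule.smul_mem _ _ hxx
  · obtain ⟨l, hl⟩ := exists_mem_wordSpan hS ht0 h1 hx a
    exact mem_span_of_mem_wordSpan hS hS' ht0 h1 hx hl hd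

end DAHA

/-! ### Simple modules with a column vector -/

namespace DAHA

variable {K : Type*} [Field K] {N k : ℕ} [NeZero N] [NeZero k] {S t Y : K}
variable {M : Type*} [AddCommGroup M] [Module K M] [Module (DAHA (N * k) S t Y) M]
  [IsScalarTower K (DAHA (N * k) S t Y) M]
variable {M' : Type*} [AddCommGroup M'] [Module K M'] [Module (DAHA (N * k) S t Y) M']
  [IsScalarTower K (DAHA (N * k) S t Y) M']

theorem IsColumnVector.prod {β : K} {x : M} {x' : M'}
    (hx : IsColumnVector (N := N) (k := k) S t Y β x)
    (hx' : IsColumnVector (N := N) (k := k) S t Y β x') :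
    IsColumnVector (N := N) (k := k) S t Y β (x, x') where
  weight i := Prod.ext (hx.weight i) (hx'.weight i)
  T_smul i hi := Prod.ext (hx.T_smul i hi) (hx'.T_smul i hi)
  pi_pow := Prod.ext hx.pi_pow hx'.pi_pow

/-- The submodule generated by (x, x') meets 0 ⊕ M' in 0 or in everything. In the second case (0,
x') lies in it and has the weight of (x, x'), so it is a multiple of this column vector, which is
absurd. Hence the projection to M is injective. -/
theorem fst_injective_of_isColumnVector (hS : S ≠ 0) (hS' : ∀ m : ℕ, 0 < m → S ^ m ≠ 1)
    (ht : S ^ N = t) {β : K} {x : M} {x' : M'}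
    (hx : IsColumnVector (N := N) (k := k) S t Y β x)
    (hx' : IsColumnVector (N := N) (k := k) S t Y β x') (h0 : x ≠ 0) (h0' : x' ≠ 0)
    [IsSimpleModule (DAHA (N * k) S t Y) M'] {z : M'}
    (hz : ((0 : M), z) ∈ Submodule.span (DAHA (N * k) S t Y) {(x, x')}) : z = 0 := by
  by_contra hne
  set D := Submodule.span (DAHA (N * k) S t Y) {(x, x')}
  have htop : D.comap (LinearMap.inr (DAHA (N * k) S t Y) M M') = ⊤ := by
    rcases eq_bot_or_eq_top (D.comap (LinearMap.inr (DAHA (N * k) S t Y) M M')) with h | h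
    · exact absurd ((Submodule.eq_bot_iff _).mp h z (by simpa using hz)) hne
    · exact h
  have hmem : ((0 : M), x') ∈ D := by
    have : x' ∈ D.comap (LinearMap.inr (DAHA (N * k) S t Y) M M') := htop ▸ Submodule.mem_top
    simpa using this
  obtain ⟨a, ha⟩ := Submodule.mem_span_singleton.mp hmem
  have := smul_mem_span_of_weight hS hS' ht (hx.prod hx') a (fun i => by
    rw [ha]
    refine Prod.ext ?_ (hx'.Zi_smul hS i)
    simp)
  rw [ha] at this
  obtain ⟨c, hc⟩ := Submodule.mem_span_singleton.mp this
  have e1 : c • x = 0 := congrArg Prod.fst hc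
  have e2 : c • x' = x' := congrArg Prod.snd hc
  rcases smul_eq_zero.mp e1 with h | h
  · rw [h, zero_smul] at e2; exact h0' e2.symm
  · exact h0 h

theorem fst_bijective_of_isColumnVector (hS : S ≠ 0) (hS' : ∀ m : ℕ, 0 < m → S ^ m ≠ 1)
    (ht : S ^ N = t) {β : K} {x : M} {x' : M'}
    (hx : IsColumnVector (N := N) (k := k) S t Y β x)
    (hx' : IsColumnVector (N := N) (k := k) S t Y β x') (h0 : x ≠ 0) (h0' : x' ≠ 0)
    [IsSimpleModule (DAHA (N * k) S t Y) M] [IsSimpleModule (DAHA (N * k) S t Y) M'] :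
    Function.Bijective ((LinearMap.fst (DAHA (N * k) S t Y) M M').comp
      (Submodule.span (DAHA (N * k) S t Y) {(x, x')}).subtype) := by
  constructor
  · rw [injective_iff_map_eq_zero]
    rintro ⟨⟨y, z⟩, hz⟩ h
    obtain rfl : y = 0 := h
    have := fst_injective_of_isColumnVector hS hS' ht hx hx' h0 h0' hz
    simp [this]
  · refine LinearMap.surjective_of_ne_zero ?_
    intro H
    apply h0
    exact LinearMap.congr_fun H ⟨(x, x'), Submodule.mem_span_singleton_self _⟩

theorem snd_bijective_of_isColumnVector (hS : S ≠ 0) (hS' : ∀ m : ℕ, 0 < m → S ^ m ≠ 1)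
    (ht : S ^ N = t) {β : K} {x : M} {x' : M'}
    (hx : IsColumnVector (N := N) (k := k) S t Y β x)
    (hx' : IsColumnVector (N := N) (k := k) S t Y β x') (h0 : x ≠ 0) (h0' : x' ≠ 0)
    [IsSimpleModule (DAHA (N * k) S t Y) M] [IsSimpleModule (DAHA (N * k) S t Y) M'] :
    Function.Bijective ((LinearMap.snd (DAHA (N * k) S t Y) M M').comp
      (Submodule.span (DAHA (N * k) S t Y) {(x, x')}).subtype) := by
  constructor
  · rw [injective_iff_map_eq_zero]
    rintro ⟨⟨y, z⟩, hz⟩ h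
    obtain rfl : z = 0 := h
    have hz' : ((0 : M'), y) ∈ Submodule.span (DAHA (N * k) S t Y) {(x', x)} := by
      obtain ⟨a, ha⟩ := Submodule.mem_span_singleton.mp hz
      refine Submodule.mem_span_singleton.mpr ⟨a, Prod.ext ?_ ?_⟩
      · exact congrArg Prod.snd ha
      · exact congrArg Prod.fst ha
    have := fst_injective_of_isColumnVector hS hS' ht hx' hx h0' h0 hz'
    simp [this]
  · refine LinearMap.surjective_of_ne_zero ?_
    intro H
    apply h0'
    exact LinearMap.congr_fun H ⟨(x, x'), Submodule.mem_span_singleton_self _⟩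

/-- Two simple modules with a column vector on which `π ^ N` acts by the same scalar are
isomorphic. -/
theorem nonempty_equiv_of_isColumnVector (hS : S ≠ 0) (hS' : ∀ m : ℕ, 0 < m → S ^ m ≠ 1)
    (ht : S ^ N = t) {β : K} {x : M} {x' : M'}
    (hx : IsColumnVector (N := N) (k := k) S t Y β x)
    (hx' : IsColumnVector (N := N) (k := k) S t Y β x') (h0 : x ≠ 0) (h0' : x' ≠ 0)
    [IsSimpleModule (DAHA (N * k) S t Y) M] [IsSimpleModule (DAHA (N * k) S t Y) M'] :
    Nonempty (M ≃ₗ[DAHA (N * k) S t Y] M') :=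
  ⟨(LinearEquiv.ofBijective _ (fst_bijective_of_isColumnVector hS hS' ht hx hx' h0 h0')).symm.trans
    (LinearEquiv.ofBijective _ (snd_bijective_of_isColumnVector hS hS' ht hx hx' h0 h0'))⟩

/-- If the weight `wt(R₀)` with the entries `i` and `i + 1` exchanged does not occur in `M`, then
`T_i` acts by a scalar on the vectors of weight `wt(R₀)`. -/
theorem Ti_smul_of_not_weight (hS : S ≠ 0) (hS' : ∀ m : ℕ, 0 < m → S ^ m ≠ 1) (ht : S ^ N = t)
    {x : M} (hx : ∀ i, (Zi i : DAHA (N * k) S t Y) • x = S ^ (2 * (PSYT.R₀ N k).diagN i) • x)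
    {i : ℤ} (hi : ¬ (N : ℤ) ∣ i) (h1 : ¬ ((N * k : ℕ) : ℤ) ∣ 1)
    (hM : ∀ y : M, (∀ j, (Zi j : DAHA (N * k) S t Y) • y =
      S ^ (2 * (PSYT.R₀ N k).diagN (aswap (N * k) i j)) • y) → y = 0) :
    (Ti i : DAHA (N * k) S t Y) • x = (-t⁻¹) • x := by
  have ht0 : t ≠ 0 := by rw [← ht]; exact pow_ne_zero _ hS
  have hsq : t * t ≠ 1 := by
    rw [← ht, ← pow_add]
    exact hS' _ (by have := Nat.pos_of_neZero N; omega)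
  -- On x the eigenvalue of Z_i is t² times that of Z_{i+1}. For this ratio T_i + t⁻¹ is the
  -- intertwiner, so the vector has the exchanged weight.
  have key : (Ti i : DAHA (N * k) S t Y) • x - (-t⁻¹) • x = 0 := by
    apply hM
    have hdiff := PSYT.R₀_diagN_succ (N := N) (k := k) hi
    set d := (PSYT.R₀ N k).diagN with hd
    have hrel : S ^ (2 * d i) = t ^ 2 * S ^ (2 * d (i + 1)) := by
      rw [show 2 * d i = 2 * N + 2 * d (i + 1) by linarith, zpow_add₀ hS, ← ht]
      congr 1
      rw [← pow_mul, mul_comm N 2]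
      exact_mod_cast zpow_natCast S (2 * N)
    have hdi : ∀ j m : ℤ, (PSYT.R₀ N k).diagN (j + (N * k : ℕ) * m) =
        (PSYT.R₀ N k).diagN j + (N * k : ℕ) * m := by
      intro j m
      rw [PSYT.diagN_eq, PSYT.diagN_eq, PSYT.content, PSYT.content,
        (PSYT.R₀ N k).boxPeriodic.add_mul]
      push_cast; ring
    intro j
    rcases aswap_cases h1 i j with ⟨a, b⟩ | ⟨a, b⟩ | ⟨a, a', b⟩
    · rw [b]
      obtain ⟨m, hm⟩ := id a
      obtain rfl : j = i + (N * k : ℕ) * m := by linarith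
      have hrel' : S ^ (2 * d (i + (N * k : ℕ) * m)) =
          t ^ 2 * S ^ (2 * d (i + (N * k : ℕ) * m + 1)) := by
        rw [show i + ((N * k : ℕ) : ℤ) * m + 1 = i + 1 + (N * k : ℕ) * m by ring, hd, hdi, hdi,
          mul_add, mul_add, zpow_add₀ hS, zpow_add₀ hS, ← hd, hrel]
        ring
      rw [Ti_congr (by rwa [← dvd_neg, neg_sub] :
          ((N * k : ℕ) : ℤ) ∣ i - (i + (N * k : ℕ) * m)), smul_sub, ← mul_smul,
        Zi_Ti hS ht0, sub_smul, mul_smul, smul_assoc, smul_comm _ (-t⁻¹), hx, hx, hrel',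
        smul_sub, smul_comm _ (S ^ _) x]
      generalize (Ti (i + (N * k : ℕ) * m) : DAHA (N * k) S t Y) • x = w
      match_scalars
      · ring1
      · field_simp; ring1
    · rw [b]
      obtain ⟨m, hm⟩ := id a
      obtain rfl : j = i + (N * k : ℕ) * m + 1 := by linarith
      have hrel' : S ^ (2 * d (i + (N * k : ℕ) * m)) =
          t ^ 2 * S ^ (2 * d (i + (N * k : ℕ) * m + 1)) := by
        rw [show i + ((N * k : ℕ) : ℤ) * m + 1 = i + 1 + (N * k : ℕ) * m by ring, hd, hdi, hdi,
          mul_add, mul_add, zpow_add₀ hS, zpow_add₀ hS, ← hd, hrel]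
        ring
      rw [Ti_congr (by
          rwa [← dvd_neg, neg_sub, ← show i + (N * k : ℕ) * m + 1 - i - 1 =
            i + ((N * k : ℕ) : ℤ) * m - i by ring] :
          ((N * k : ℕ) : ℤ) ∣ i - (i + (N * k : ℕ) * m)), smul_sub, ← mul_smul,
        Zi_succ_Ti hS ht0, add_smul, mul_smul, smul_assoc, smul_comm _ (-t⁻¹), hx, hx,
        add_sub_cancel_right, hrel', smul_sub,
        smul_comm (Ti (i + (N * k : ℕ) * m) : DAHA (N * k) S t Y) (_ : K) x]
      generalize (Ti (i + (N * k : ℕ) * m) : DAHA (N * k) S t Y) • x = w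
      match_scalars
      · field_simp
      · field_simp; ring1
    · rw [b, smul_sub, ← mul_smul, ← Ti_Zi_comm a a', mul_smul, smul_comm _ (-t⁻¹), hx,
        smul_sub, smul_comm _ (S ^ _) x, smul_comm (-t⁻¹)]
  rwa [sub_eq_zero] at key

end DAHA

/-! ## Seminormal operators on integer sequences -/

section Seminormal

variable {K : Type*} [Field K]

/-- The diagonal coefficient of the seminormal form, where `e` is the difference of two weights. -/
noncomputable def diagCoeff (S t : K) (e : ℤ) : K := (t - t⁻¹) / (1 - S ^ (2 * e))

/-- The coefficient of the exchanged sequence in the seminormal form. -/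
noncomputable def swapCoeff (N : ℕ) (S t : K) (e : ℤ) : K :=
  if e = -N then 0 else t⁻¹ + diagCoeff S t e

variable {N : ℕ} {S t : K}

theorem one_sub_zpow_ne_zero (hS : S ≠ 0) (hS' : ∀ m : ℕ, 0 < m → S ^ m ≠ 1) {e : ℤ} (he : e ≠ 0) :
    1 - S ^ (2 * e) ≠ 0 := by
  intro h
  have : S ^ (2 * e) = S ^ (0 : ℤ) := by rw [zpow_zero]; exact (sub_eq_zero.mp h).symm
  have := zpow_injective_of_not_root hS hS' this
  omega

theorem diagCoeff_mul (hS : S ≠ 0) (hS' : ∀ m : ℕ, 0 < m → S ^ m ≠ 1) {e : ℤ} (he : e ≠ 0) :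
    diagCoeff S t e * S ^ (2 * e) = diagCoeff S t e - (t - t⁻¹) := by
  have := one_sub_zpow_ne_zero hS hS' he
  rw [diagCoeff]
  field_simp
  ring1

theorem diagCoeff_neg (hS : S ≠ 0) (hS' : ∀ m : ℕ, 0 < m → S ^ m ≠ 1) {e : ℤ} (he : e ≠ 0) :
    diagCoeff S t (-e) = t - t⁻¹ - diagCoeff S t e := by
  have h := one_sub_zpow_ne_zero hS hS' he
  have h' := one_sub_zpow_ne_zero hS hS' (neg_ne_zero.mpr he)
  have hx : S ^ (2 * e) ≠ 0 := zpow_ne_zero _ hS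
  rw [diagCoeff, diagCoeff]
  rw [mul_neg, zpow_neg] at *
  generalize S ^ (2 * e) = x at *
  rw [div_eq_iff h']
  field_simp
  ring1

/-- A rational identity in q^{2e} and q^{2e'}: the rank-two content of the braid relation. -/
theorem diagCoeff_add (hS : S ≠ 0) (hS' : ∀ m : ℕ, 0 < m → S ^ m ≠ 1) {e e' : ℤ} (he : e ≠ 0)
    (he' : e' ≠ 0) (h : e + e' ≠ 0) :
    diagCoeff S t (e + e') * (diagCoeff S t e + diagCoeff S t e' - (t - t⁻¹)) =
      diagCoeff S t e * diagCoeff S t e' := by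
  have h1 := one_sub_zpow_ne_zero hS hS' he
  have h2 := one_sub_zpow_ne_zero hS hS' he'
  have h3 := one_sub_zpow_ne_zero hS hS' h
  rw [diagCoeff, diagCoeff, diagCoeff]
  rw [mul_add, zpow_add₀ hS] at *
  generalize S ^ (2 * e) = x at *
  generalize S ^ (2 * e') = y at *
  generalize t - t⁻¹ = h
  field_simp
  ring1

theorem diagCoeff_self (hS : S ≠ 0) (hS' : ∀ m : ℕ, 0 < m → S ^ m ≠ 1) (hN : N ≠ 0)
    (ht : S ^ N = t) : diagCoeff S t N = -t⁻¹ := by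
  have ht0 : t ≠ 0 := ht ▸ pow_ne_zero _ hS
  have := one_sub_zpow_ne_zero hS hS' (e := N) (by exact_mod_cast hN)
  have e : S ^ (2 * (N : ℤ)) = t ^ 2 := by
    rw [← ht, ← pow_mul, mul_comm N 2]; exact_mod_cast zpow_natCast S (2 * N)
  rw [e] at this
  rw [diagCoeff, e, div_eq_iff this]
  field_simp
  ring1

/-- For vertical neighbours the formula t⁻¹ + α vanishes by itself. For horizontal ones, e = −N, it
gives t + t⁻¹, so the definition has to put zero there. -/
theorem swapCoeff_self (hS : S ≠ 0) (hS' : ∀ m : ℕ, 0 < m → S ^ m ≠ 1) (hN : N ≠ 0)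
    (ht : S ^ N = t) : swapCoeff N S t N = 0 := by
  rw [swapCoeff, diagCoeff_self hS hS' hN ht]; simp

/-- With α the diagonal coefficient the right side is (t − α)(t⁻¹ + α). It says that T_i has
determinant −1 on the plane of a sequence and its exchange; the trace is t − t⁻¹ by `diagCoeff_neg`.
This gives the quadratic relation, also for e = ±N. -/
theorem swapCoeff_mul (hS : S ≠ 0) (hS' : ∀ m : ℕ, 0 < m → S ^ m ≠ 1) (hN : N ≠ 0)
    (ht : S ^ N = t) {e : ℤ} (he : e ≠ 0) :
    swapCoeff N S t e * swapCoeff N S t (-e) =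
      1 + diagCoeff S t e * (t - t⁻¹ - diagCoeff S t e) := by
  have ht0 : t ≠ 0 := ht ▸ pow_ne_zero _ hS
  have key := diagCoeff_self hS hS' hN ht
  by_cases h : e = -N
  · have : diagCoeff S t e = t := by
      rw [h, diagCoeff_neg hS hS' (by exact_mod_cast hN), key]; ring
    rw [this, swapCoeff, if_pos h]
    field_simp
    ring1
  by_cases h' : e = N
  · rw [h', swapCoeff_self hS hS' hN ht, key]
    field_simp
    ring1
  rw [swapCoeff, swapCoeff, if_neg h, if_neg (by omega), diagCoeff_neg hS hS' he]
  field_simp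
  ring1

/-- The equation t⁻¹ + α = 0 means q^{2e} = t² = q^{2N}, so e = N. -/
theorem swapCoeff_ne_zero (hS : S ≠ 0) (hS' : ∀ m : ℕ, 0 < m → S ^ m ≠ 1) (ht : S ^ N = t) {e : ℤ} (he0 : e ≠ 0) (he : e ≠ N) (he' : e ≠ -N) :
    swapCoeff N S t e ≠ 0 := by
  have ht0 : t ≠ 0 := ht ▸ pow_ne_zero _ hS
  rw [swapCoeff, if_neg he']
  intro H
  have h1 := one_sub_zpow_ne_zero hS hS' he0
  have h2 : S ^ (2 * e) = S ^ (2 * (N : ℤ)) := by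
    rw [show S ^ (2 * (N : ℤ)) = t ^ 2 by
      rw [← ht, ← pow_mul, mul_comm N 2]; exact_mod_cast zpow_natCast S (2 * N)]
    rw [diagCoeff] at H
    generalize S ^ (2 * e) = x at *
    field_simp at H
    linear_combination -H
  have := zpow_injective_of_not_root hS hS' h2
  omega

/-- The operator `T_i` on sequences of integers. -/
noncomputable def seqT (n N : ℕ) (S t : K) (i : ℤ) : Module.End K ((ℤ → ℤ) →₀ K) :=
  Finsupp.linearCombination K fun d =>
    diagCoeff S t (d i - d (i + 1)) • Finsupp.single d 1 +
      swapCoeff N S t (d i - d (i + 1)) • Finsupp.single (d ∘ aswap n i) 1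

/-- The operator `π ^ j` on sequences of integers. -/
noncomputable def seqPi (K : Type*) [Field K] (j : ℤ) : Module.End K ((ℤ → ℤ) →₀ K) :=
  Finsupp.linearCombination K fun d => Finsupp.single (fun i => d (i - j) + j) 1

/-- The operator `Z_i` on sequences of integers. -/
noncomputable def seqZ (S : K) (i : ℤ) : Module.End K ((ℤ → ℤ) →₀ K) :=
  Finsupp.linearCombination K fun d => S ^ (2 * d i) • Finsupp.single d 1

theorem seqT_single (n N : ℕ) (S t : K) (i : ℤ) (d : ℤ → ℤ) : seqT n N S t i (Finsupp.single d 1) =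
    diagCoeff S t (d i - d (i + 1)) • Finsupp.single d 1 +
      swapCoeff N S t (d i - d (i + 1)) • Finsupp.single (d ∘ aswap n i) 1 := by
  simp only [seqT, Finsupp.linearCombination_single, one_smul]

theorem seqPi_single (j : ℤ) (d : ℤ → ℤ) : seqPi K j (Finsupp.single d 1) =
    Finsupp.single (fun i => d (i - j) + j) 1 := by
  simp only [seqPi, Finsupp.linearCombination_single, one_smul]

theorem seqZ_single (i : ℤ) (d : ℤ → ℤ) :
    seqZ S i (Finsupp.single d 1) = S ^ (2 * d i) • Finsupp.single d 1 := by
  simp only [seqZ, Finsupp.linearCombination_single, one_smul]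

variable {n : ℕ} {d : ℤ → ℤ} {i : ℤ}

theorem comp_aswap_aswap (d : ℤ → ℤ) (i : ℤ) : (d ∘ aswap n i) ∘ aswap n i = d := by
  funext j; simp [aswap_aswap]

/-- T_i acts on the line of d if the exchange coefficient vanishes, and otherwise on the plane of d
and its exchange. In the second case `hc` ensures that the exchange really interchanges the values
at i and i + 1. -/
theorem seqT_seqT (hS : S ≠ 0) (hS' : ∀ m : ℕ, 0 < m → S ^ m ≠ 1) (hN : N ≠ 0) (ht : S ^ N = t)
    (hd : d i ≠ d (i + 1)) (hc : swapCoeff N S t (d i - d (i + 1)) ≠ 0 → ¬ (n : ℤ) ∣ 1) :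
    seqT n N S t i (seqT n N S t i (Finsupp.single d 1)) =
      (t - t⁻¹) • seqT n N S t i (Finsupp.single d 1) + Finsupp.single d 1 := by
  have he : d i - d (i + 1) ≠ 0 := sub_ne_zero.mpr hd
  have h1 := swapCoeff_mul hS hS' hN ht he
  rw [seqT_single]
  by_cases hc0 : swapCoeff N S t (d i - d (i + 1)) = 0
  · rw [hc0, zero_mul] at h1
    rw [hc0, zero_smul, add_zero, map_smul, seqT_single, hc0, zero_smul, add_zero]
    match_scalars
    linear_combination h1
  · have hn := hc hc0
    rw [map_add, map_smul, map_smul, seqT_single, seqT_single, comp_aswap_aswap,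
      Function.comp_apply, Function.comp_apply, aswap_self hn, aswap_succ hn,
      show d (i + 1) - d i = -(d i - d (i + 1)) by ring, diagCoeff_neg hS hS' he]
    match_scalars
    · linear_combination h1
    · ring1

theorem seqT_seqZ_seqT (hS : S ≠ 0) (hS' : ∀ m : ℕ, 0 < m → S ^ m ≠ 1) (hN : N ≠ 0)
    (ht : S ^ N = t)
    (hd : d i ≠ d (i + 1)) (hc : swapCoeff N S t (d i - d (i + 1)) ≠ 0 → ¬ (n : ℤ) ∣ 1) :
    seqT n N S t i (seqZ S i (seqT n N S t i (Finsupp.single d 1))) =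
      seqZ S (i + 1) (Finsupp.single d 1) := by
  have he : d i - d (i + 1) ≠ 0 := sub_ne_zero.mpr hd
  have h1 := swapCoeff_mul hS hS' hN ht he
  have h2 := diagCoeff_mul (t := t) hS hS' he
  have h3 : S ^ (2 * d i) = S ^ (2 * (d i - d (i + 1))) * S ^ (2 * d (i + 1)) := by
    rw [← zpow_add₀ hS]; congr 1; ring
  rw [seqT_single, seqZ_single]
  by_cases hc0 : swapCoeff N S t (d i - d (i + 1)) = 0
  · rw [hc0, zero_mul] at h1
    rw [hc0, zero_smul, add_zero, map_smul, map_smul, seqZ_single, map_smul, seqT_single, hc0,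
      zero_smul, add_zero, h3]
    match_scalars
    linear_combination S ^ (2 * d (i + 1)) * (diagCoeff S t (d i - d (i + 1)) * h2 + h1)
  · have hn := hc hc0
    rw [map_add, map_smul, map_smul, seqZ_single, seqZ_single, map_add, map_smul, map_smul,
      map_smul, map_smul, seqT_single, seqT_single, comp_aswap_aswap,
      Function.comp_apply, Function.comp_apply, aswap_self hn, aswap_succ hn,
      show d (i + 1) - d i = -(d i - d (i + 1)) by ring, diagCoeff_neg hS hS' he, h3]
    match_scalars
    · linear_combination S ^ (2 * d (i + 1)) * (diagCoeff S t (d i - d (i + 1)) * h2 + h1)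
    · linear_combination S ^ (2 * d (i + 1)) * swapCoeff N S t (d i - d (i + 1)) * h2

theorem seqT_seqZ {j : ℤ} (hj : ¬ (n : ℤ) ∣ j - i) (hj' : ¬ (n : ℤ) ∣ j - i - 1) :
    seqT n N S t i (seqZ S j (Finsupp.single d 1)) =
      seqZ S j (seqT n N S t i (Finsupp.single d 1)) := by
  rw [seqT_single, seqZ_single, map_smul, map_add, map_smul, map_smul, seqZ_single, seqZ_single,
    seqT_single, Function.comp_apply, aswap_other hj hj']
  match_scalars <;> ring1

theorem seqPi_seqT :
    seqPi K 1 (seqT n N S t i (Finsupp.single d 1)) =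
      seqT n N S t (i + 1) (seqPi K 1 (Finsupp.single d 1)) := by
  rw [seqT_single, seqPi_single, map_add, map_smul, map_smul, seqPi_single, seqPi_single,
    seqT_single]
  have e : (fun j => (d ∘ aswap n i) (j - 1) + 1) =
      (fun j => d (j - 1) + 1) ∘ aswap n (i + 1) := by
    funext j
    simp only [Function.comp_apply, aswap_sub_one]
  rw [e]
  simp only [add_sub_cancel_right, add_sub_add_right_eq_sub]

theorem seqPi_seqZ (hS : S ≠ 0) :
    seqPi K 1 (seqZ S i (Finsupp.single d 1)) =
      S ^ (-2 : ℤ) • seqZ S (i + 1) (seqPi K 1 (Finsupp.single d 1)) := by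
  rw [seqZ_single, seqPi_single, map_smul, seqPi_single, seqZ_single, smul_smul, ← zpow_add₀ hS]
  simp only [add_sub_cancel_right]
  congr 2
  ring

theorem seqT_comm {j : ℤ} (h1 : ¬ (n : ℤ) ∣ j - i - 1)
    (h2 : ¬ (n : ℤ) ∣ i - j - 1)
    (h3 : ¬ (n : ℤ) ∣ j - i) :
    seqT n N S t i (seqT n N S t j (Finsupp.single d 1)) =
      seqT n N S t j (seqT n N S t i (Finsupp.single d 1)) := by
  have h3' : ¬ (n : ℤ) ∣ i - j := by rwa [← dvd_neg, neg_sub]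
  have e1 : aswap n i j = j := aswap_other h3 h1
  have e2 : aswap n i (j + 1) = j + 1 := by
    refine aswap_other (fun h => h2 ?_) (fun h => h3 ?_)
    · rw [← dvd_neg]; rwa [show -(i - j - 1) = j + 1 - i by ring]
    · rwa [show j - i = j + 1 - i - 1 by ring]
  have e3 : aswap n j i = i := aswap_other h3' h2
  have e4 : aswap n j (i + 1) = i + 1 := by
    refine aswap_other (fun h => h1 ?_) (fun h => h3' ?_)
    · rw [← dvd_neg]; rwa [show -(j - i - 1) = i + 1 - j by ring]
    · rwa [show i - j = i + 1 - j - 1 by ring]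
  have e5 : (d ∘ aswap n i) ∘ aswap n j = (d ∘ aswap n j) ∘ aswap n i := by
    funext l
    simp only [Function.comp_apply, aswap_comm h1 h2]
  rw [seqT_single, seqT_single, map_add, map_add, map_smul, map_smul, map_smul, map_smul,
    seqT_single, seqT_single, seqT_single, seqT_single, e5]
  simp only [Function.comp_apply, e1, e2, e3, e4]
  match_scalars <;> ring1

/-- Expand both sides in the sequences permuted by the two exchanges. The coefficient of d itself
needs both quadratic identities and the additivity of `diagCoeff`; the others need at most the
latter. -/
theorem seqT_braid (hS : S ≠ 0) (hS' : ∀ m : ℕ, 0 < m → S ^ m ≠ 1) (hN : N ≠ 0) (ht : S ^ N = t)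
    (hn : ¬ (n : ℤ) ∣ 1) (hn2 : ¬ (n : ℤ) ∣ 2)
    (h1 : d i ≠ d (i + 1)) (h2 : d (i + 1) ≠ d (i + 2)) (h3 : d i ≠ d (i + 2)) :
    seqT n N S t i (seqT n N S t (i + 1) (seqT n N S t i (Finsupp.single d 1))) =
      seqT n N S t (i + 1) (seqT n N S t i (seqT n N S t (i + 1) (Finsupp.single d 1))) := by
  have e1 : aswap n i i = i + 1 := aswap_self hn i
  have e2 : aswap n i (i + 1) = i := aswap_succ hn i
  have e3 : aswap n (i + 1) (i + 1) = i + 2 := by rw [aswap_self hn]; ring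
  have e4 : aswap n (i + 1) (i + 2) = i + 1 := by
    rw [show i + 2 = i + 1 + 1 by ring, aswap_succ hn]
  have e5 : aswap n i (i + 2) = i + 2 := aswap_other (by simpa using hn2)
    (by rwa [show i + 2 - i - 1 = 1 by ring])
  have e6 : aswap n (i + 1) i = i := aswap_other
    (by rw [show i - (i + 1) = -1 by ring, dvd_neg]; exact hn)
    (by rw [show i - (i + 1) - 1 = -2 by ring, dvd_neg]; exact hn2)
  have e7 : ((d ∘ aswap n i) ∘ aswap n (i + 1)) ∘ aswap n i =
      ((d ∘ aswap n (i + 1)) ∘ aswap n i) ∘ aswap n (i + 1) := by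
    funext l
    simp only [Function.comp_apply, aswap_braid hn hn2]
  simp only [seqT_single, map_add, map_smul, e7, comp_aswap_aswap]
  simp only [Function.comp_apply, e1, e2, e3, e4, e5, e6, show i + 1 + 1 = i + 2 by ring]
  have g1 : d i - d (i + 1) ≠ 0 := sub_ne_zero.mpr h1
  have g2 : d (i + 1) - d (i + 2) ≠ 0 := sub_ne_zero.mpr h2
  have g3 : d i - d (i + 2) ≠ 0 := sub_ne_zero.mpr h3
  have s1 : d i - d (i + 2) = (d i - d (i + 1)) + (d (i + 1) - d (i + 2)) := by ring
  rw [show d (i + 1) - d i = -(d i - d (i + 1)) by ring,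
    show d (i + 2) - d (i + 1) = -(d (i + 1) - d (i + 2)) by ring]
  have k1 := swapCoeff_mul hS hS' hN ht g1
  have k2 := swapCoeff_mul hS hS' hN ht g2
  have k3 := diagCoeff_add (t := t) hS hS' g1 g2 (s1 ▸ g3)
  rw [← s1] at k3
  rw [diagCoeff_neg hS hS' g1, diagCoeff_neg hS hS' g2]
  generalize diagCoeff S t (d i - d (i + 1)) = a1 at *
  generalize diagCoeff S t (d (i + 1) - d (i + 2)) = a2 at *
  generalize diagCoeff S t (d i - d (i + 2)) = a3 at *
  generalize swapCoeff N S t (d i - d (i + 1)) = c1 at *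
  generalize swapCoeff N S t (d (i + 1) - d (i + 2)) = c2 at *
  generalize swapCoeff N S t (-(d i - d (i + 1))) = c1' at *
  generalize swapCoeff N S t (-(d (i + 1) - d (i + 2))) = c2' at *
  generalize swapCoeff N S t (d i - d (i + 2)) = c3 at *
  match_scalars
  · linear_combination a3 * k1 - a3 * k2 - (a1 - a2) * k3
  all_goals first | ring1 | linear_combination c1 * k3 | linear_combination -c1 * k3 | linear_combination c2 * k3

end Seminormal

/-! ## The representation on periodic tableaux -/

namespace PSYT

theorem rep_zero (n : ℕ) : rep (0 : ZMod n) = n := if_pos rfl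

theorem rep_one {n : ℕ} [NeZero n] : rep (1 : ZMod n) = 1 := by
  have := rep_intCast (n := n) 1
  simpa using this

theorem rep_add_one {n : ℕ} [NeZero n] {i : ZMod n} (hi : i ≠ 0) : rep (i + 1) = rep i + 1 := by
  have h := rep_mem i
  have hne : rep i ≠ n := by
    intro h'
    apply hi
    rw [← intCast_rep i, h']
    simp
  have := rep_intCast (n := n) (rep i + 1)
  rw [Int.cast_add, intCast_rep, Int.cast_one, add_sub_cancel_right,
    Int.emod_eq_of_lt (by omega) (by omega)] at this
  exact this

end PSYT

namespace PSYTBar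

variable {K : Type*} [Field K] {N k : ℕ} [NeZero N] [NeZero k] {S t : K}

open Classical in
/-- The class of the tableau with `i` and `i + 1` exchanged, if it is standard. -/
noncomputable def swap (i : ℤ) (Q : PSYTBar N k) : PSYTBar N k :=
  if h : ∃ Q' : PSYTBar N k, ∀ j, Q'.diag j = Q.diag (aswap (N * k) i j) then h.choose else Q

theorem swap_diag (i : ℤ) {Q Q' : PSYTBar N k} (h : ∀ j, Q'.diag j = Q.diag (aswap (N * k) i j)) :
    (Q.swap i).diag = Q.diag ∘ aswap (N * k) i := by
  have h' : ∃ Q' : PSYTBar N k, ∀ j, Q'.diag j = Q.diag (aswap (N * k) i j) := ⟨Q', h⟩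
  rw [swap, dif_pos h']
  exact funext h'.choose_spec

/-- The class of the tableau with all entries increased by `j`. -/
noncomputable def rot (j : ℤ) (Q : PSYTBar N k) : PSYTBar N k := (Q.exists_rot j).choose

theorem rot_diag (j : ℤ) (Q : PSYTBar N k) (i : ℤ) : (Q.rot j).diag i = Q.diag (i - j) + j :=
  (Q.exists_rot j).choose_spec i

theorem rot_eq {j : ℤ} {Q Q' : PSYTBar N k} (h : ∀ i, Q'.diag i = Q.diag (i - j) + j) :
    Q.rot j = Q' :=
  diag_injective (funext fun i => by rw [rot_diag, h])

theorem diag_add_mul (Q : PSYTBar N k) (i m : ℤ) :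
    Q.diag (i + (N * k : ℕ) * m) = Q.diag i + (N * k : ℕ) * m := by
  induction m using Int.induction_on with
  | zero => simp
  | succ m ih => rw [mul_add, ← add_assoc, mul_one, diag_add, ih]; ring
  | pred m ih =>
    have := Q.diag_add (i + (N * k : ℕ) * (-(m : ℤ) - 1))
    rw [show i + ((N * k : ℕ) : ℤ) * (-(m : ℤ) - 1) + (N * k : ℕ) = i + (N * k : ℕ) * (-m) by ring,
      ih] at this
    linarith

/-- The operator `T_i`. -/
noncomputable def opT (S t : K) (i : ℤ) : Module.End K (PSYTBar N k →₀ K) :=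
  Finsupp.linearCombination K fun Q =>
    diagCoeff S t (Q.diag i - Q.diag (i + 1)) • Finsupp.single Q 1 +
      swapCoeff N S t (Q.diag i - Q.diag (i + 1)) • Finsupp.single (Q.swap i) 1

/-- The operator `π ^ j`. -/
noncomputable def opPi (K : Type*) [Field K] (j : ℤ) : Module.End K (PSYTBar N k →₀ K) :=
  Finsupp.linearCombination K fun Q => Finsupp.single (Q.rot j) 1

/-- The operator that scales the basis vectors by `q ^ (m diag(i))`. -/
noncomputable def opZ (S : K) (m i : ℤ) : Module.End K (PSYTBar N k →₀ K) :=
  Finsupp.linearCombination K fun Q => S ^ (m * Q.diag i) • Finsupp.single Q 1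

theorem opT_single (i : ℤ) (Q : PSYTBar N k) : opT S t i (Finsupp.single Q 1) =
    diagCoeff S t (Q.diag i - Q.diag (i + 1)) • Finsupp.single Q 1 +
      swapCoeff N S t (Q.diag i - Q.diag (i + 1)) • Finsupp.single (Q.swap i) 1 := by
  simp only [opT, Finsupp.linearCombination_single, one_smul]

theorem opPi_single (j : ℤ) (Q : PSYTBar N k) :
    opPi K j (Finsupp.single Q 1) = Finsupp.single (Q.rot j) 1 := by
  simp only [opPi, Finsupp.linearCombination_single, one_smul]

theorem opZ_single (m i : ℤ) (Q : PSYTBar N k) : opZ S m i (Finsupp.single Q 1) =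
    S ^ (m * Q.diag i) • Finsupp.single Q 1 := by
  simp only [opZ, Finsupp.linearCombination_single, one_smul]

/-- The embedding into the space with basis the integer sequences. -/
noncomputable def toSeq (K : Type*) [Field K] : (PSYTBar N k →₀ K) →ₗ[K] ((ℤ → ℤ) →₀ K) :=
  Finsupp.lmapDomain K K diag

theorem toSeq_single (Q : PSYTBar N k) : toSeq K (Finsupp.single Q 1) = Finsupp.single Q.diag 1 := by
  simp [toSeq]

/-- Distinct classes have distinct labels, so identities of operators may be checked on sequences,
where exchanges are always defined. -/
theorem end_ext {f g : Module.End K (PSYTBar N k →₀ K)}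
    (h : ∀ Q, toSeq K (f (Finsupp.single Q 1)) = toSeq K (g (Finsupp.single Q 1))) : f = g := by
  refine Finsupp.lhom_ext' fun Q => LinearMap.ext_ring ?_
  exact Finsupp.mapDomain_injective diag_injective (h Q)

/-- Where no class has the exchanged labels, the coefficient is zero; thus the default value in
`swap` never contributes, and `toSeq` intertwines the operators. -/
theorem swapCoeff_eq_zero_or (hS : S ≠ 0) (hS' : ∀ m : ℕ, 0 < m → S ^ m ≠ 1) (ht : S ^ N = t)
    (Q : PSYTBar N k) (i : ℤ) : swapCoeff N S t (Q.diag i - Q.diag (i + 1)) = 0 ∨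
      (¬ ((N * k : ℕ) : ℤ) ∣ 1 ∧ (Q.swap i).diag = Q.diag ∘ aswap (N * k) i) := by
  by_cases h : Q.diag i - Q.diag (i + 1) = N
  · rw [h, swapCoeff_self hS hS' (NeZero.ne N) ht]; exact Or.inl rfl
  by_cases h' : Q.diag i - Q.diag (i + 1) = -N
  · rw [swapCoeff, if_pos h']; exact Or.inl rfl
  obtain ⟨h1, Q', hQ'⟩ := Q.exists_swap h h'
  exact Or.inr ⟨h1, swap_diag i hQ'⟩

theorem toSeq_opT (hS : S ≠ 0) (hS' : ∀ m : ℕ, 0 < m → S ^ m ≠ 1) (ht : S ^ N = t) (i : ℤ)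
    (v : PSYTBar N k →₀ K) :
    toSeq K (opT S t i v) = seqT (N * k) N S t i (toSeq K v) := by
  suffices h : (toSeq K).comp (opT S t i) = (seqT (N * k) N S t i).comp (toSeq (N := N) (k := k) K)
    from LinearMap.congr_fun h v
  refine Finsupp.lhom_ext' fun Q => LinearMap.ext_ring ?_
  simp only [LinearMap.comp_apply, Finsupp.lsingle_apply]
  rw [opT_single, toSeq_single, seqT_single, map_add, map_smul, map_smul, toSeq_single,
    toSeq_single]
  rcases swapCoeff_eq_zero_or hS hS' ht Q i with h | h
  · rw [h, zero_smul, zero_smul]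
  · rw [h.2]

theorem toSeq_opPi (j : ℤ) (v : PSYTBar N k →₀ K) :
    toSeq K (opPi K j v) = seqPi K j (toSeq K v) := by
  suffices h : (toSeq K).comp (opPi K j) = (seqPi K j).comp (toSeq (N := N) (k := k) K)
    from LinearMap.congr_fun h v
  refine Finsupp.lhom_ext' fun Q => LinearMap.ext_ring ?_
  simp only [LinearMap.comp_apply, Finsupp.lsingle_apply]
  rw [opPi_single, toSeq_single, toSeq_single, seqPi_single]
  congr 1
  exact funext (rot_diag j Q)

theorem toSeq_opZ (i : ℤ) (v : PSYTBar N k →₀ K) :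
    toSeq K (opZ S 2 i v) = seqZ S i (toSeq K v) := by
  suffices h : (toSeq K).comp (opZ S 2 i) = (seqZ S i).comp (toSeq (N := N) (k := k) K)
    from LinearMap.congr_fun h v
  refine Finsupp.lhom_ext' fun Q => LinearMap.ext_ring ?_
  simp only [LinearMap.comp_apply, Finsupp.lsingle_apply]
  rw [opZ_single, map_smul, toSeq_single, seqZ_single]

theorem opT_congr (hS : S ≠ 0) (hS' : ∀ m : ℕ, 0 < m → S ^ m ≠ 1) (ht : S ^ N = t) {i j : ℤ}
    (h : ((N * k : ℕ) : ℤ) ∣ i - j) :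
    (opT S t i : Module.End K (PSYTBar N k →₀ K)) = opT S t j := by
  refine end_ext fun Q => ?_
  rw [toSeq_opT hS hS' ht, toSeq_opT hS hS' ht, toSeq_single, seqT_single, seqT_single,
    aswap_congr h]
  obtain ⟨m, hm⟩ := h
  obtain rfl : i = j + (N * k : ℕ) * m := by linarith
  rw [diag_add_mul, show j + ((N * k : ℕ) : ℤ) * m + 1 = j + 1 + (N * k : ℕ) * m by ring,
    diag_add_mul, add_sub_add_right_eq_sub]

theorem opZ_add (hS : S ≠ 0) (i : ℤ) : (opZ S 2 (i + (N * k : ℕ)) :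
    Module.End K (PSYTBar N k →₀ K)) = S ^ (2 * (N * k : ℕ) : ℤ) • opZ S 2 i := by
  refine Finsupp.lhom_ext' fun Q => LinearMap.ext_ring ?_
  simp only [LinearMap.comp_apply, Finsupp.lsingle_apply, LinearMap.smul_apply]
  rw [opZ_single, opZ_single, smul_smul, ← zpow_add₀ hS, diag_add]
  congr 2
  ring

theorem opPi_opPi {j j' : ℤ} (h : ((N * k : ℕ) : ℤ) ∣ j + j') (v : PSYTBar N k →₀ K) :
    opPi K j (opPi K j' v) = v := by
  suffices h : opPi K j * opPi K j' = (1 : Module.End K (PSYTBar N k →₀ K)) from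
    LinearMap.congr_fun h v
  refine Finsupp.lhom_ext' fun Q => LinearMap.ext_ring ?_
  simp only [LinearMap.comp_apply, Finsupp.lsingle_apply, Module.End.mul_apply,
    Module.End.one_apply]
  rw [opPi_single, opPi_single]
  congr 1
  apply diag_injective
  funext i
  obtain ⟨m, hm⟩ := h
  have := Q.diag_add_mul (i - j - j') m
  rw [rot_diag, rot_diag]
  rw [← hm, show i - j - j' + (j + j') = i by ring] at this
  linarith

theorem opPi_pow (m : ℕ) : (opPi K 1 ^ m : Module.End K (PSYTBar N k →₀ K)) = opPi K m := by
  induction m with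
  | zero =>
    refine Finsupp.lhom_ext' fun Q => LinearMap.ext_ring ?_
    simp only [LinearMap.comp_apply, Finsupp.lsingle_apply, pow_zero, Module.End.one_apply]
    rw [opPi_single, rot_eq (Q' := Q)]
    intro i; simp
  | succ m ih =>
    rw [pow_succ, ih]
    refine Finsupp.lhom_ext' fun Q => LinearMap.ext_ring ?_
    simp only [LinearMap.comp_apply, Finsupp.lsingle_apply, Module.End.mul_apply]
    rw [opPi_single, opPi_single, opPi_single]
    congr 1
    symm
    apply rot_eq
    intro i
    rw [rot_diag, rot_diag, sub_sub]
    push_cast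
    ring

/-- The images of the generators. -/
noncomputable def opGen (S t : K) : DAHAGen (N * k) → Module.End K (PSYTBar N k →₀ K)
  | .T i => opT S t (PSYT.rep i)
  | .pi => opPi K 1
  | .piInv => opPi K (-1)
  | .Z i => opZ S 2 (PSYT.rep i)
  | .Zinv i => opZ S (-2) (PSYT.rep i)

theorem opZ_mul_opZ (hS : S ≠ 0) (m i : ℤ) :
    (opZ S m i * opZ S (-m) i : Module.End K (PSYTBar N k →₀ K)) = 1 := by
  refine Finsupp.lhom_ext' fun Q => LinearMap.ext_ring ?_
  simp only [LinearMap.comp_apply, Finsupp.lsingle_apply, Module.End.mul_apply,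
    Module.End.one_apply]
  rw [opZ_single, map_smul, opZ_single, smul_smul, ← zpow_add₀ hS]
  simp

theorem opPi_mul_opT (hS : S ≠ 0) (hS' : ∀ m : ℕ, 0 < m → S ^ m ≠ 1) (ht : S ^ N = t) (i : ℤ) :
    (opPi K 1 * opT S t i : Module.End K (PSYTBar N k →₀ K)) = opT S t (i + 1) * opPi K 1 := by
  refine end_ext fun Q => ?_
  rw [Module.End.mul_apply, Module.End.mul_apply]
  simp only [toSeq_opPi, toSeq_opT hS hS' ht, toSeq_single]
  exact seqPi_seqT

theorem opPi_mul_opZ (hS : S ≠ 0) (i : ℤ) :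
    (opPi K 1 * opZ S 2 i : Module.End K (PSYTBar N k →₀ K)) =
      S ^ (-2 : ℤ) • (opZ S 2 (i + 1) * opPi K 1) := by
  refine end_ext fun Q => ?_
  rw [Module.End.mul_apply, LinearMap.smul_apply, Module.End.mul_apply, map_smul]
  simp only [toSeq_opPi, toSeq_opZ, toSeq_single]
  exact seqPi_seqZ hS

theorem opT_mul_self (hS : S ≠ 0) (hS' : ∀ m : ℕ, 0 < m → S ^ m ≠ 1) (ht : S ^ N = t) (i : ℤ) :
    (opT S t i * opT S t i : Module.End K (PSYTBar N k →₀ K)) = (t - t⁻¹) • opT S t i + 1 := by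
  refine end_ext fun Q => ?_
  rw [Module.End.mul_apply, LinearMap.add_apply, LinearMap.smul_apply, Module.End.one_apply,
    map_add, map_smul]
  simp only [toSeq_opT hS hS' ht, toSeq_single]
  refine seqT_seqT hS hS' (NeZero.ne N) ht (Q.diag_ne_succ i) fun h => ?_
  exact ((swapCoeff_eq_zero_or hS hS' ht Q i).resolve_left h).1

theorem opT_mul_opZ_mul_opT (hS : S ≠ 0) (hS' : ∀ m : ℕ, 0 < m → S ^ m ≠ 1) (ht : S ^ N = t)
    (i : ℤ) : (opT S t i * opZ S 2 i * opT S t i : Module.End K (PSYTBar N k →₀ K)) =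
      opZ S 2 (i + 1) := by
  refine end_ext fun Q => ?_
  rw [Module.End.mul_apply, Module.End.mul_apply]
  simp only [toSeq_opT hS hS' ht, toSeq_opZ, toSeq_single]
  refine seqT_seqZ_seqT hS hS' (NeZero.ne N) ht (Q.diag_ne_succ i) fun h => ?_
  exact ((swapCoeff_eq_zero_or hS hS' ht Q i).resolve_left h).1

theorem opT_mul_opZ (hS : S ≠ 0) (hS' : ∀ m : ℕ, 0 < m → S ^ m ≠ 1) (ht : S ^ N = t)
    {i j : ℤ} (hj : ¬ ((N * k : ℕ) : ℤ) ∣ j - i) (hj' : ¬ ((N * k : ℕ) : ℤ) ∣ j - i - 1) :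
    (opT S t i * opZ S 2 j : Module.End K (PSYTBar N k →₀ K)) = opZ S 2 j * opT S t i := by
  refine end_ext fun Q => ?_
  rw [Module.End.mul_apply, Module.End.mul_apply]
  simp only [toSeq_opT hS hS' ht, toSeq_opZ, toSeq_single]
  exact seqT_seqZ hj hj'

theorem opT_comm (hS : S ≠ 0) (hS' : ∀ m : ℕ, 0 < m → S ^ m ≠ 1) (ht : S ^ N = t)
    {i j : ℤ} (h1 : ¬ ((N * k : ℕ) : ℤ) ∣ j - i - 1) (h2 : ¬ ((N * k : ℕ) : ℤ) ∣ i - j - 1) :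
    (opT S t i * opT S t j : Module.End K (PSYTBar N k →₀ K)) = opT S t j * opT S t i := by
  by_cases h : ((N * k : ℕ) : ℤ) ∣ j - i
  · rw [opT_congr hS hS' ht h]
  refine end_ext fun Q => ?_
  rw [Module.End.mul_apply, Module.End.mul_apply]
  simp only [toSeq_opT hS hS' ht, toSeq_single]
  exact seqT_comm h1 h2 h

theorem opT_braid (hS : S ≠ 0) (hS' : ∀ m : ℕ, 0 < m → S ^ m ≠ 1) (ht : S ^ N = t)
    (hn2 : N * k ≠ 2) (i : ℤ) :
    (opT S t i * opT S t (i + 1) * opT S t i : Module.End K (PSYTBar N k →₀ K)) =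
      opT S t (i + 1) * opT S t i * opT S t (i + 1) := by
  by_cases h1 : ((N * k : ℕ) : ℤ) ∣ 1
  · rw [opT_congr hS hS' ht (i := i + 1) (j := i) (by simpa only [add_sub_cancel_left] using h1)]
  refine end_ext fun Q => ?_
  simp only [Module.End.mul_apply]
  simp only [toSeq_opT hS hS' ht, toSeq_single]
  refine seqT_braid hS hS' (NeZero.ne N) ht h1 ?_ (Q.diag_ne_succ i) ?_ (Q.diag_ne_add_two i)
  · intro H
    have := (Nat.dvd_prime Nat.prime_two).mp (by exact_mod_cast H : N * k ∣ 2)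
    rcases this with h | h
    · rw [h] at h1; simp at h1
    · exact hn2 h
  · have := Q.diag_ne_succ (i + 1)
    rwa [show i + 1 + 1 = i + 2 by ring] at this

theorem prod_opZ (hS : S ≠ 0) {Y : K} (hY : Y = S ^ (1 - (N : ℤ) ^ 2)) :
    ((List.range (N * k)).map fun i : ℕ =>
      (opZ S 2 (PSYT.rep ((i : ZMod (N * k)) + 1)) : Module.End K (PSYTBar N k →₀ K))).prod =
      algebraMap K _ (S ^ (N * k * (N * k - 1)) * Y ^ (N * k)) := by
  refine Finsupp.lhom_ext' fun Q => LinearMap.ext_ring ?_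
  simp only [LinearMap.comp_apply, Finsupp.lsingle_apply, Module.algebraMap_end_apply]
  have key : ∀ m ≤ N * k, ((List.range m).map fun i : ℕ =>
      (opZ S 2 (PSYT.rep ((i : ZMod (N * k)) + 1)) : Module.End K (PSYTBar N k →₀ K))).prod
        (Finsupp.single Q 1) =
      S ^ (2 * ∑ i ∈ Finset.Icc (1 : ℤ) m, Q.diag i) • Finsupp.single Q 1 := by
    intro m
    induction m with
    | zero => simp
    | succ m ih =>
      intro hm
      have e : PSYT.rep ((m : ZMod (N * k)) + 1) = m + 1 := by
        have := PSYT.rep_intCast (n := N * k) ((m : ℤ) + 1)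
        rw [add_sub_cancel_right, Int.emod_eq_of_lt (by omega) (by exact_mod_cast hm)] at this
        rw [← this]; push_cast; rfl
      have e2 : Finset.Icc (1 : ℤ) (m + 1 : ℕ) = insert ((m : ℤ) + 1) (Finset.Icc (1 : ℤ) m) := by
        ext x; simp only [Finset.mem_Icc, Finset.mem_insert]; omega
      rw [List.range_succ, List.map_append, List.prod_append]
      simp only [List.map_cons, List.map_nil, List.prod_cons, List.prod_nil, mul_one,
        Module.End.mul_apply]
      rw [opZ_single, map_smul, ih (by omega), smul_smul, ← zpow_add₀ hS, e, e2,
        Finset.sum_insert (by simp), mul_add]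
  rw [key _ le_rfl, two_mul_sum_diag, hY]
  congr 1
  rw [← zpow_natCast, ← zpow_natCast (S ^ (1 - (N : ℤ) ^ 2)), ← zpow_mul, ← zpow_add₀ hS]
  congr 1
  have : 1 ≤ N * k := Nat.pos_of_neZero _
  push_cast [Nat.cast_sub this]
  ring

theorem opGen_rel (hS : S ≠ 0) (hS' : ∀ m : ℕ, 0 < m → S ^ m ≠ 1) (ht : S ^ N = t) {Y : K}
    (hY : Y = S ^ (1 - (N : ℤ) ^ 2)) {x y : FreeAlgebra K (DAHAGen (N * k))}
    (h : DAHARel (N * k) S t Y x y) :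
    FreeAlgebra.lift K (opGen S t : DAHAGen (N * k) → Module.End K (PSYTBar N k →₀ K)) x =
      FreeAlgebra.lift K (opGen S t) y := by
  have ht0 : t ≠ 0 := ht ▸ pow_ne_zero _ hS
  have eT : ∀ i : ZMod (N * k), (opT S t (PSYT.rep (i + 1)) : Module.End K (PSYTBar N k →₀ K)) =
      opT S t (PSYT.rep i + 1) := fun i => opT_congr hS hS' ht (by
    rw [← ZMod.intCast_zmod_eq_zero_iff_dvd]
    push_cast
    simp [PSYT.intCast_rep])
  have eZ : (opZ S 2 (PSYT.rep (0 : ZMod (N * k)) + 1) : Module.End K (PSYTBar N k →₀ K)) =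
      S ^ (2 * (N * k : ℕ) : ℤ) • opZ S 2 1 := by
    rw [PSYT.rep_zero, add_comm, opZ_add hS]
  have hdvd : ∀ {i j : ZMod (N * k)}, i ≠ j + 1 → ¬ ((N * k : ℕ) : ℤ) ∣ PSYT.rep i - PSYT.rep j - 1 := by
    intro i j hij H
    rw [← ZMod.intCast_zmod_eq_zero_iff_dvd] at H
    push_cast at H
    simp only [PSYT.intCast_rep] at H
    exact hij (by linear_combination H)
  have hdvd' : ∀ {i j : ZMod (N * k)}, i ≠ j → ¬ ((N * k : ℕ) : ℤ) ∣ PSYT.rep i - PSYT.rep j := by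
    intro i j hij H
    rw [← ZMod.intCast_zmod_eq_zero_iff_dvd] at H
    push_cast at H
    simp only [PSYT.intCast_rep] at H
    exact hij (by linear_combination H)
  have hpi : (opPi K 1 * opPi K (-1) : Module.End K (PSYTBar N k →₀ K)) = 1 :=
    LinearMap.ext fun v => opPi_opPi (by simp) v
  cases h
  case Z_prod =>
    rw [map_list_prod, List.map_map, AlgHom.commutes, ← prod_opZ hS hY]
    simp only [Function.comp_def, FreeAlgebra.lift_ι_apply, opGen]
  all_goals
    simp only [map_mul, map_one, map_sub, map_add, map_smul, map_zero, map_pow, AlgHom.commutes,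
      FreeAlgebra.lift_ι_apply, opGen]
  case pi_piInv => exact hpi
  case piInv_pi => exact LinearMap.ext fun v => opPi_opPi (by simp) v
  case Z_Zinv i => exact opZ_mul_opZ hS 2 _
  case Zinv_Z i => exact opZ_mul_opZ hS (-2) _
  case Z_comm i j =>
    refine Finsupp.lhom_ext' fun Q => LinearMap.ext_ring ?_
    simp only [LinearMap.comp_apply, Finsupp.lsingle_apply, Module.End.mul_apply]
    rw [opZ_single, opZ_single, map_smul, map_smul, opZ_single, opZ_single, smul_comm]
  case hecke i =>
    refine LinearMap.ext fun v => ?_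
    have h := LinearMap.congr_fun (opT_mul_self hS hS' ht (PSYT.rep i)) v
    change opT S t (PSYT.rep i) (opT S t (PSYT.rep i) v) = (t - t⁻¹) • opT S t (PSYT.rep i) v + v at h
    change opT S t (PSYT.rep i) (opT S t (PSYT.rep i) v + t⁻¹ • v) -
      t • (opT S t (PSYT.rep i) v + t⁻¹ • v) = 0
    rw [map_add, map_smul, h]
    match_scalars
    · ring1
    · rw [mul_one, mul_inv_cancel₀ ht0, sub_self]
  case braid hn i => rw [eT, opT_braid hS hS' ht hn]
  case T_comm hn i j h1 h2 => exact opT_comm hS hS' ht (hdvd h1) (hdvd h2)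
  case pi_T i => rw [eT, opPi_mul_opT hS hS' ht, mul_assoc, hpi, mul_one]
  case T_Z_T i hi => rw [PSYT.rep_add_one hi, opT_mul_opZ_mul_opT hS hS' ht]
  case T_Z_T_zero =>
    rw [opT_mul_opZ_mul_opT hS hS' ht, eZ, PSYT.rep_one]
    congr 1
    exact_mod_cast zpow_natCast S (2 * (N * k))
  case T_Z_comm i j h1 h2 => exact opT_mul_opZ hS hS' ht (hdvd' h1) (hdvd h2)
  case pi_pow =>
    rw [opPi_pow]
    refine Finsupp.lhom_ext' fun Q => LinearMap.ext_ring ?_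
    simp only [LinearMap.comp_apply, Finsupp.lsingle_apply, Module.End.one_apply]
    rw [opPi_single, rot_eq]
    intro i
    have := Q.diag_add (i - (N * k : ℕ))
    rw [sub_add_cancel] at this
    exact this
  case pi_Z i hi =>
    rw [PSYT.rep_add_one hi, opPi_mul_opZ hS, smul_mul_assoc, mul_assoc, hpi, mul_one]
  case pi_Z_zero =>
    rw [opPi_mul_opZ hS, smul_mul_assoc, mul_assoc, hpi, mul_one, eZ, PSYT.rep_one, smul_smul,
      ← zpow_add₀ hS]
    congr 2

/-- The representation on the space with basis the periodic tableaux up to horizontal shift. -/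
noncomputable def rectRep (N k : ℕ) [NeZero N] [NeZero k] (S t Y : K) (hS : S ≠ 0)
    (hS' : ∀ m : ℕ, 0 < m → S ^ m ≠ 1) (ht : S ^ N = t) (hY : Y = S ^ (1 - (N : ℤ) ^ 2)) :
    DAHA (N * k) S t Y →ₐ[K] Module.End K (PSYTBar N k →₀ K) :=
  RingQuot.liftAlgHom K ⟨FreeAlgebra.lift K (opGen S t), fun _ _ h => opGen_rel hS hS' ht hY h⟩

variable {Y : K} (hS : S ≠ 0) (hS' : ∀ m : ℕ, 0 < m → S ^ m ≠ 1) (ht : S ^ N = t)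
  (hY : Y = S ^ (1 - (N : ℤ) ^ 2))

theorem rectRep_mk (x : FreeAlgebra K (DAHAGen (N * k))) :
    rectRep N k S t Y hS hS' ht hY (DAHA.mk x) = FreeAlgebra.lift K (opGen S t) x :=
  RingQuot.liftAlgHom_mkAlgHom_apply K _ _ x

theorem rectRep_T (i : ZMod (N * k)) :
    rectRep N k S t Y hS hS' ht hY (DAHA.T i) = opT S t (PSYT.rep i) := by
  rw [DAHA.T, rectRep_mk, FreeAlgebra.lift_ι_apply, opGen]

theorem rectRep_Z (i : ZMod (N * k)) :
    rectRep N k S t Y hS hS' ht hY (DAHA.Z i) = opZ S 2 (PSYT.rep i) := by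
  rw [DAHA.Z, rectRep_mk, FreeAlgebra.lift_ι_apply, opGen]

theorem rectRep_Zinv (i : ZMod (N * k)) :
    rectRep N k S t Y hS hS' ht hY (DAHA.Zinv i) = opZ S (-2) (PSYT.rep i) := by
  rw [DAHA.Zinv, rectRep_mk, FreeAlgebra.lift_ι_apply, opGen]

theorem rectRep_pi : rectRep N k S t Y hS hS' ht hY DAHA.pi = opPi K 1 := by
  rw [DAHA.pi, rectRep_mk, FreeAlgebra.lift_ι_apply, opGen]

end PSYTBar

/-! ## Representations with a basis of weight vectors -/

namespace PSYTBar

variable {K : Type*} [Field K] {N k : ℕ} [NeZero N] [NeZero k] {S t : K}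

theorem opZ_apply (m i : ℤ) (f : PSYTBar N k →₀ K) (Q : PSYTBar N k) :
    opZ S m i f Q = S ^ (m * Q.diag i) * f Q := by
  induction f using Finsupp.induction_linear with
  | zero => simp
  | add f g hf hg => rw [map_add, Finsupp.add_apply, hf, hg, Finsupp.add_apply, mul_add]
  | single Q' c =>
    have : Finsupp.single Q' c = c • Finsupp.single Q' (1 : K) := by simp
    rw [this, map_smul, opZ_single]
    by_cases h : Q' = Q
    · subst h; simp [mul_comm]
    · simp [Finsupp.single_eq_of_ne' h]

/-- Another class in the support of f differs from Q in some label. Subtracting its eigenvalue from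
Z_i removes it without enlarging the support or losing Q. -/
theorem single_mem_of_mem (hS : S ≠ 0) (hS' : ∀ m : ℕ, 0 < m → S ^ m ≠ 1)
    {W : Submodule K (PSYTBar N k →₀ K)} (hW : ∀ i, ∀ f ∈ W, opZ S 2 i f ∈ W)
    {f : PSYTBar N k →₀ K} (hf : f ∈ W) {Q : PSYTBar N k} (hQ : f Q ≠ 0) :
    Finsupp.single Q 1 ∈ W := by
  induction hn : f.support.card using Nat.strong_induction_on generalizing f with
  | _ n ih =>
    by_cases h : ∃ Q', Q' ≠ Q ∧ f Q' ≠ 0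
    · obtain ⟨Q', hne, hQ'⟩ := h
      obtain ⟨i, hi⟩ : ∃ i, Q.diag i ≠ Q'.diag i := by
        by_contra! H
        exact hne (diag_injective (funext H)).symm
      have hg : ∀ Q₁, (opZ S 2 i f - S ^ (2 * Q'.diag i) • f) Q₁ =
          (S ^ (2 * Q₁.diag i) - S ^ (2 * Q'.diag i)) * f Q₁ := by
        intro Q₁
        rw [Finsupp.sub_apply, opZ_apply, Finsupp.smul_apply, smul_eq_mul, sub_mul]
      refine ih _ ?_ (W.sub_mem (hW i f hf) (W.smul_mem (S ^ (2 * Q'.diag i)) hf)) ?_ rfl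
      · rw [← hn]
        refine Finset.card_lt_card (Finset.ssubset_iff_of_subset ?_ |>.mpr ⟨Q', ?_, ?_⟩)
        · intro Q₁ h₁
          rw [Finsupp.mem_support_iff, hg] at h₁
          rw [Finsupp.mem_support_iff]
          exact right_ne_zero_of_mul h₁
        · rwa [Finsupp.mem_support_iff]
        · rw [Finsupp.mem_support_iff, hg, sub_self, zero_mul, not_not]
      · rw [hg]
        refine mul_ne_zero (sub_ne_zero.mpr fun H => hi ?_) hQ
        have := zpow_injective_of_not_root hS hS' H
        omega
    · push Not at h
      have : f = f Q • Finsupp.single Q 1 := by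
        ext Q'
        by_cases hQ' : Q' = Q
        · subst hQ'; simp
        · rw [h Q' hQ']; simp [Finsupp.single_eq_of_ne hQ']
      rw [this] at hf
      have := W.smul_mem (f Q)⁻¹ hf
      rwa [smul_smul, inv_mul_cancel₀ hQ, one_smul] at this

theorem diag_eq_of_opZ (hS : S ≠ 0) (hS' : ∀ m : ℕ, 0 < m → S ^ m ≠ 1) {f : PSYTBar N k →₀ K}
    {d : ℤ → ℤ} (hf : ∀ i, opZ S 2 i f = S ^ (2 * d i) • f) {Q : PSYTBar N k} (hQ : f Q ≠ 0) :
    Q.diag = d := by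
  funext i
  have := DFunLike.congr_fun (hf i) Q
  rw [opZ_apply, Finsupp.smul_apply, smul_eq_mul] at this
  have := zpow_injective_of_not_root hS hS' (mul_right_cancel₀ hQ this)
  omega

theorem mem_range_wt_of_opZ {f : PSYTBar N k →₀ K} (h0 : f ≠ 0) {z : ZMod (N * k) → K}
    (hf : ∀ i, opZ S 2 (PSYT.rep i) f = z i • f) : z ∈ Set.range fun R : PSYT N k => R.wt S := by
  obtain ⟨Q, hQ⟩ := Finsupp.ne_iff.mp h0
  rw [Finsupp.zero_apply] at hQ
  induction Q using Quotient.inductionOn with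
  | _ R =>
    refine ⟨R, funext fun i => ?_⟩
    have h := DFunLike.congr_fun (hf i) ⟦R⟧
    rw [opZ_apply, Finsupp.smul_apply, smul_eq_mul] at h
    exact mul_right_cancel₀ hQ h

theorem opPi_congr {i j : ℤ} (h : ((N * k : ℕ) : ℤ) ∣ i - j) :
    (opPi K i : Module.End K (PSYTBar N k →₀ K)) = opPi K j := by
  refine LinearMap.ext fun v => ?_
  have h1 := opPi_opPi (K := K) (N := N) (k := k) (j := i) (j' := -j) h (opPi K j v)
  rwa [opPi_opPi (j := -j) (by simp)] at h1

/-- The subspace contains a basis vector by `single_mem_of_mem`, and membership is passed both ways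
along rotations and along exchanges with non-zero coefficient. -/
theorem eq_top_of_invariant (hS : S ≠ 0) (hS' : ∀ m : ℕ, 0 < m → S ^ m ≠ 1) (ht : S ^ N = t)
    {W : Submodule K (PSYTBar N k →₀ K)} (hZ : ∀ i, ∀ f ∈ W, opZ S 2 i f ∈ W)
    (hT : ∀ i, ∀ f ∈ W, opT S t i f ∈ W) (hpi : ∀ f ∈ W, opPi K 1 f ∈ W)
    {f : PSYTBar N k →₀ K} (hf : f ∈ W) (h0 : f ≠ 0) : W = ⊤ := by
  have hpi' : ∀ j : ℤ, ∀ v ∈ W, opPi K j v ∈ W := by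
    intro j v hv
    have hn : ((N * k : ℕ) : ℤ) ≠ 0 := by exact_mod_cast NeZero.ne (N * k)
    have hj := Int.emod_nonneg j hn
    -- Since π^n = 1, a negative power of π is also a non-negative one.
    rw [opPi_congr (i := j) (j := ((j % (N * k : ℕ)).toNat : ℤ)) (by
      rw [Int.toNat_of_nonneg hj]; exact Int.dvd_self_sub_emod), ← opPi_pow]
    generalize (j % (N * k : ℕ)).toNat = m
    induction m with
    | zero => simpa using hv
    | succ m ih => rw [pow_succ']; exact hpi _ ih
  have hall : ∀ Q : PSYTBar N k, Finsupp.single Q (1 : K) ∈ W ↔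
      Finsupp.single (⟦PSYT.R₀ N k⟧ : PSYTBar N k) (1 : K) ∈ W := by
    intro Q
    induction Q using induction_diag with
    | h0 => exact Iff.rfl
    | hrot Q Q' j hQ ih =>
      rw [← ih]
      have e : Q.rot j = Q' := rot_eq hQ
      have e' : Q'.rot (-j) = Q := rot_eq fun i => by rw [hQ]; simp
      constructor
      · intro h
        have := hpi' (-j) _ h
        rwa [opPi_single, e'] at this
      · intro h
        have := hpi' j _ h
        rwa [opPi_single, e] at this
    | hswap Q Q' i hn h1 h2 hQ ih =>
      rw [← ih]
      have key : ∀ Q Q' : PSYTBar N k, Q.diag i - Q.diag (i + 1) ≠ N →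
          Q.diag i - Q.diag (i + 1) ≠ -N →
          (∀ j, Q'.diag j = Q.diag (aswap (N * k) i j)) →
          Finsupp.single Q (1 : K) ∈ W → Finsupp.single Q' (1 : K) ∈ W := by
        intro Q Q' h1 h2 hQ h
        have h3 := hT i _ h
        have e : Q.swap i = Q' := diag_injective (by rw [swap_diag i hQ]; exact (funext hQ).symm)
        rw [opT_single, e] at h3
        have hc := swapCoeff_ne_zero hS hS' ht (sub_ne_zero.mpr (Q.diag_ne_succ i)) h1 h2
        have h4 := (Submodule.add_mem_iff_right W (W.smul_mem _ h)).mp h3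
        have := W.smul_mem (swapCoeff N S t (Q.diag i - Q.diag (i + 1)))⁻¹ h4
        rwa [smul_smul, inv_mul_cancel₀ hc, one_smul] at this
      refine ⟨key Q' Q ?_ ?_ fun j => ?_, key Q Q' h1 h2 hQ⟩
      · rw [hQ, hQ, aswap_self hn, aswap_succ hn]
        omega
      · rw [hQ, hQ, aswap_self hn, aswap_succ hn]
        omega
      · rw [hQ, aswap_aswap]
  obtain ⟨Q, hQ⟩ := Finsupp.ne_iff.mp h0
  have h1 := (hall Q).mp (single_mem_of_mem hS hS' hZ hf hQ)
  refine eq_top_iff.mpr fun v _ => ?_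
  induction v using Finsupp.induction_linear with
  | zero => exact W.zero_mem
  | add f g hf hg => exact W.add_mem (hf trivial) (hg trivial)
  | single Q c =>
    have := W.smul_mem c ((hall Q).mpr h1)
    simpa using this

theorem eq_smul_single_of_opZ (hS : S ≠ 0) (hS' : ∀ m : ℕ, 0 < m → S ^ m ≠ 1)
    {f : PSYTBar N k →₀ K} {Q : PSYTBar N k}
    (hf : ∀ i, opZ S 2 i f = S ^ (2 * Q.diag i) • f) : f = f Q • Finsupp.single Q 1 := by
  ext Q'
  by_cases hQ' : Q' = Q
  · subst hQ'; simp
  · rw [Finsupp.smul_apply, Finsupp.single_eq_of_ne hQ', smul_zero]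
    by_contra h
    exact hQ' (diag_injective (diag_eq_of_opZ hS hS' hf h))

end PSYTBar

/-! ### Modules with the weights of periodic tableaux, and their twists -/

namespace DAHA

open PSYTBar

variable {K : Type*} [Field K] {N k : ℕ} [NeZero N] [NeZero k] {S t Y : K}

/-- The basis vectors `v_R` are weight vectors of weight `wt(R)`. -/
def HasWeights (ρ : DAHA (N * k) S t Y →ₐ[K] Module.End K (PSYTBar N k →₀ K)) : Prop :=
  ∀ (R : PSYT N k) (i : ZMod (N * k)),
    ρ (Z i) (Finsupp.single ⟦R⟧ 1) = R.wt S i • Finsupp.single ⟦R⟧ 1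

variable {ρ : DAHA (N * k) S t Y →ₐ[K] Module.End K (PSYTBar N k →₀ K)}

theorem HasWeights.twist (h : HasWeights ρ) (b : rootsOfUnity (N * k) K) :
    HasWeights (ρ.comp (twist b)) := by
  intro R i
  rw [AlgHom.comp_apply, twist_Z, h]

theorem HasWeights.map_Zi (hS : S ≠ 0) (h : HasWeights ρ) (i : ℤ) : ρ (Zi i) = opZ S 2 i := by
  refine Finsupp.lhom_ext' fun Q => LinearMap.ext_ring ?_
  simp only [LinearMap.comp_apply, Finsupp.lsingle_apply]
  induction Q using Quotient.inductionOn with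
  | _ R =>
    have := Zi_smul_of_weight (t := t) (Y := Y) hS (M := RepMod ρ) (m := Finsupp.single ⟦R⟧ 1)
      R.diagN_add (h R) i
    rw [opZ_single]
    exact this

/-- The basis vector `v_{R₀}`. -/
noncomputable def columnVector (ρ : DAHA (N * k) S t Y →ₐ[K] Module.End K (PSYTBar N k →₀ K)) :
    RepMod ρ := Finsupp.single (⟦PSYT.R₀ N k⟧ : PSYTBar N k) (1 : K)

theorem columnVector_ne_zero : columnVector ρ ≠ 0 := by
  intro h
  exact one_ne_zero (Finsupp.single_eq_zero.mp h)

theorem HasWeights.weight_columnVector (h : HasWeights ρ) (i : ZMod (N * k)) :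
    (Z i : DAHA (N * k) S t Y) • columnVector ρ = (PSYT.R₀ N k).wt S i • columnVector ρ :=
  h _ i

theorem HasWeights.eq_smul_columnVector (hS : S ≠ 0) (hS' : ∀ m : ℕ, 0 < m → S ^ m ≠ 1)
    (h : HasWeights ρ) {v : RepMod ρ}
    (hv : ∀ i : ZMod (N * k), (Z i : DAHA (N * k) S t Y) • v = (PSYT.R₀ N k).wt S i • v) :
    ∃ c : K, v = c • columnVector ρ := by
  refine ⟨_, eq_smul_single_of_opZ (S := S) hS hS' (Q := ⟦PSYT.R₀ N k⟧) fun i => ?_⟩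
  rw [← h.map_Zi hS]
  exact Zi_smul_of_weight (M := RepMod ρ) hS (PSYT.R₀ N k).diagN_add hv i

variable {M : Type*} [AddCommGroup M] [Module K M] [Module (DAHA (N * k) S t Y) M]
  [IsScalarTower K (DAHA (N * k) S t Y) M]

theorem mem_supp_iff {z : ZMod (N * k) → K} : z ∈ supp (N * k) S t Y M ↔
    ∃ v : M, v ≠ 0 ∧ ∀ i, (Z i : DAHA (N * k) S t Y) • v = z i • v := by
  rw [supp, Set.mem_ofPred_eq, Submodule.ne_bot_iff]
  exact ⟨fun ⟨v, h, h0⟩ => ⟨v, h0, h⟩, fun ⟨v, h0, h⟩ => ⟨v, h, h0⟩⟩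

theorem HasWeights.supp_eq (hS : S ≠ 0) (h : HasWeights ρ) :
    supp (N * k) S t Y (RepMod ρ) = Set.range fun R : PSYT N k => R.wt S := by
  ext z
  rw [mem_supp_iff]
  constructor
  · rintro ⟨v, h0, hv⟩
    refine mem_range_wt_of_opZ h0 fun i => ?_
    rw [← h.map_Zi hS, ← Z_eq_Zi]
    exact hv i
  · rintro ⟨R, rfl⟩
    refine ⟨Finsupp.single ⟦R⟧ 1, ?_, h R⟩
    intro H
    exact one_ne_zero (Finsupp.single_eq_zero.mp H)

/-- In a module all of whose weights come from periodic tableaux, the vectors of weight `wt(R₀)`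
are antisymmetric for the column group. -/
theorem Ti_smul_of_supp_subset (hS : S ≠ 0) (hS' : ∀ m : ℕ, 0 < m → S ^ m ≠ 1) (ht : S ^ N = t)
    (hM : supp (N * k) S t Y M ⊆ Set.range fun R : PSYT N k => R.wt S) {x : M}
    (hx : ∀ i : ZMod (N * k), (Z i : DAHA (N * k) S t Y) • x = (PSYT.R₀ N k).wt S i • x) {i : ℤ}
    (hi : ¬ (N : ℤ) ∣ i) : (Ti i : DAHA (N * k) S t Y) • x = (-t⁻¹) • x := by
  have h1 : ¬ ((N * k : ℕ) : ℤ) ∣ 1 := by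
    intro h1
    apply hi
    refine dvd_trans ?_ (h1.trans (one_dvd i))
    push_cast
    exact dvd_mul_right _ _
  refine Ti_smul_of_not_weight hS hS' ht
    (fun j => Zi_smul_of_weight hS (PSYT.R₀ N k).diagN_add hx j) hi h1 fun y hy => ?_
  by_contra hy0
  have hmem : (fun j : ZMod (N * k) => S ^ (2 * (PSYT.R₀ N k).diagN (aswap (N * k) i (PSYT.rep j))))
      ∈ supp (N * k) S t Y M := mem_supp_iff.mpr ⟨y, hy0, fun j =>
        Z_smul_of_Zi (d := fun j => (PSYT.R₀ N k).diagN (aswap (N * k) i j)) hy j⟩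
  obtain ⟨R, hR⟩ := hM hmem
  refine PSYT.diagN_ne_comp_aswap (R := R) h1 (PSYT.R₀_col_eq (k := k) hi) fun j => ?_
  have e : ∀ j : ZMod (N * k), R.diagN (PSYT.rep j) =
      (PSYT.R₀ N k).diagN (aswap (N * k) i (PSYT.rep j)) := by
    intro j
    have := zpow_injective_of_not_root hS hS' (congrFun hR j)
    omega
  -- So far the labels agree only on the representatives 1, …, n. Comparing the eigenvalues of Z_j
  -- on y ≠ 0 for all integers j extends this to the whole sequence.
  have h2 := Zi_smul_of_weight (S := S) (t := t) (Y := Y) (M := M) hS (m := y) R.diagN_add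
    (fun j => by rw [e]; exact Z_smul_of_Zi (d := fun j => (PSYT.R₀ N k).diagN (aswap (N * k) i j)) hy j) j
  rw [hy] at h2
  have := zpow_injective_of_not_root hS hS' (smul_left_injective K hy0 h2)
  omega

theorem isColumnVector_of_supp_subset (hS : S ≠ 0) (hS' : ∀ m : ℕ, 0 < m → S ^ m ≠ 1)
    (ht : S ^ N = t)
    (hM : supp (N * k) S t Y M ⊆ Set.range fun R : PSYT N k => R.wt S) {x : M}
    (hx : ∀ i : ZMod (N * k), (Z i : DAHA (N * k) S t Y) • x = (PSYT.R₀ N k).wt S i • x) {β : K}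
    (hβ : (pi ^ N : DAHA (N * k) S t Y) • x = β • x) :
    IsColumnVector (N := N) (k := k) S t Y β x :=
  ⟨hx, fun _ hi => Ti_smul_of_supp_subset hS hS' ht hM hx hi, hβ⟩

theorem HasWeights.isColumnVector (hS : S ≠ 0) (hS' : ∀ m : ℕ, 0 < m → S ^ m ≠ 1)
    (ht : S ^ N = t) (h : HasWeights ρ) {β : K}
    (hβ : (pi ^ N : DAHA (N * k) S t Y) • columnVector ρ = β • columnVector ρ) :
    IsColumnVector (N := N) (k := k) S t Y β (columnVector ρ) :=
  isColumnVector_of_supp_subset hS hS' ht (h.supp_eq hS).subset h.weight_columnVector hβ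

/-- `π ^ N` preserves the weight space of weight `wt(R₀)`. -/
theorem weight_pi_pow_smul (hS : S ≠ 0) {x : M}
    (hx : ∀ i : ZMod (N * k), (Z i : DAHA (N * k) S t Y) • x = (PSYT.R₀ N k).wt S i • x)
    (i : ZMod (N * k)) : (Z i : DAHA (N * k) S t Y) • (pi ^ N : DAHA (N * k) S t Y) • x =
      (PSYT.R₀ N k).wt S i • (pi ^ N : DAHA (N * k) S t Y) • x := by
  refine Z_smul_of_Zi (fun j => ?_) i
  have h1 := Zi_smul_of_weight hS (PSYT.R₀ N k).diagN_add hx (j - N)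
  have h2 := pi_pow_Zi (n := N * k) (S := S) (t := t) (Y := Y) hS N (j - N)
  rw [sub_add_cancel] at h2
  have h3 := congrArg (· • x) h2
  simp only [mul_smul, smul_assoc] at h3
  rw [h1, smul_comm (pi ^ N : DAHA (N * k) S t Y)] at h3
  have h4 := congrArg ((S ^ (-2 * (N : ℤ)))⁻¹ • ·) h3
  rw [inv_smul_smul₀ (zpow_ne_zero _ hS), smul_smul, ← zpow_neg, ← zpow_add₀ hS] at h4
  rw [← h4]
  congr 2
  -- Advancing by N entries in R₀ moves one column to the right and raises the label by N, which
  -- cancels the power of q from commuting Z_j with π^N.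
  have := PSYT.R₀_diagN_add (N := N) (k := k) (j - N)
  rw [sub_add_cancel] at this
  rw [this]; ring

theorem twist_twist_inv (b : rootsOfUnity (N * k) K) (x : DAHA (N * k) S t Y) :
    twist b (twist b⁻¹ x) = x := by
  refine induction_generators (AlgHom.equalizer ((twist b).comp (twist b⁻¹)) (AlgHom.id K _))
    (fun i => ?_) ?_ (fun i => ?_) (fun i => ?_) x <;>
    rw [AlgHom.mem_equalizer, AlgHom.comp_apply, AlgHom.id_apply]
  · rw [twist_T, twist_T]
  · rw [twist_pi, map_smul, twist_pi, smul_smul, InvMemClass.coe_inv, ← Units.val_mul,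
      inv_mul_cancel, Units.val_one, one_smul]
  · rw [twist_Z, twist_Z]
  · rw [twist_Zinv, twist_Zinv]

theorem isSimpleModule_twist (hρ : IsSimpleModule (DAHA (N * k) S t Y) (RepMod ρ))
    (b : rootsOfUnity (N * k) K) : IsSimpleModule (DAHA (N * k) S t Y) (TwistMod ρ b) := by
  rw [isSimpleModule_iff_toSpanSingleton_surjective] at hρ ⊢
  refine ⟨hρ.1, fun x hx y => ?_⟩
  obtain ⟨a, ha⟩ := hρ.2 x hx y
  refine ⟨twist b⁻¹ a, ?_⟩
  change ρ (twist b (twist b⁻¹ a)) x = y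
  rw [twist_twist_inv]
  exact ha

theorem twist_pi_pow (b : rootsOfUnity (N * k) K) :
    twist b (pi ^ N : DAHA (N * k) S t Y) = ((b : Kˣ) : K) ^ N • pi ^ N := by
  rw [map_pow, twist_pi, smul_pow]

section IsRectRep

variable (hS : S ≠ 0) (hS' : ∀ m : ℕ, 0 < m → S ^ m ≠ 1) (ht : S ^ N = t)

theorem _root_.IsRectRep.hasWeights (h : IsRectRep N k S t Y ρ) : HasWeights ρ := h.weight

theorem _root_.IsRectRep.twist_pi_pow_columnVector (h : IsRectRep N k S t Y ρ)
    (b : rootsOfUnity (N * k) K) :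
    (ρ.comp (twist b)) (pi ^ N) (Finsupp.single ⟦PSYT.R₀ N k⟧ 1) =
      ((b : Kˣ) : K) ^ N • Finsupp.single ⟦PSYT.R₀ N k⟧ 1 := by
  rw [AlgHom.comp_apply, twist_pi_pow, map_smul, LinearMap.smul_apply, h.pi_pow]

include hS hS' ht in
theorem _root_.IsRectRep.isColumnVector_twist (h : IsRectRep N k S t Y ρ)
    (b : rootsOfUnity (N * k) K) :
    IsColumnVector (N := N) (k := k) S t Y (((b : Kˣ) : K) ^ N)
      (columnVector (ρ.comp (twist b))) :=
  (h.hasWeights.twist b).isColumnVector hS hS' ht (h.twist_pi_pow_columnVector b)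

include hS hS' ht in
theorem _root_.IsRectRep.nonempty_equiv {ρ' : DAHA (N * k) S t Y →ₐ[K] Module.End K (PSYTBar N k →₀ K)}
    (h : IsRectRep N k S t Y ρ) (h' : IsRectRep N k S t Y ρ') :
    Nonempty (RepMod ρ ≃ₗ[DAHA (N * k) S t Y] RepMod ρ') := by
  have := h.irreducible
  have := h'.irreducible
  have e : (pi ^ N : DAHA (N * k) S t Y) • columnVector ρ = (1 : K) • columnVector ρ := by
    rw [one_smul]; exact h.pi_pow
  have e' : (pi ^ N : DAHA (N * k) S t Y) • columnVector ρ' = (1 : K) • columnVector ρ' := by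
    rw [one_smul]; exact h'.pi_pow
  exact nonempty_equiv_of_isColumnVector hS hS' ht (h.hasWeights.isColumnVector hS hS' ht e)
    (h'.hasWeights.isColumnVector hS hS' ht e') columnVector_ne_zero columnVector_ne_zero

include hS hS' ht in
theorem _root_.IsRectRep.nonempty_equiv_twist (h : IsRectRep N k S t Y ρ)
    [IsSimpleModule (DAHA (N * k) S t Y) M] {b : rootsOfUnity (N * k) K} {x : M} (hx0 : x ≠ 0)
    (hx : IsColumnVector (N := N) (k := k) S t Y (((b : Kˣ) : K) ^ N) x) :
    Nonempty (M ≃ₗ[DAHA (N * k) S t Y] TwistMod ρ b) := by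
  have := isSimpleModule_twist h.irreducible b
  exact nonempty_equiv_of_isColumnVector hS hS' ht hx (h.isColumnVector_twist hS hS' ht b) hx0
    columnVector_ne_zero

/-- The scalar by which `π ^ N` acts on the weight space of weight `wt(R₀)` can be read off from
any isomorphism with a twist. -/
theorem _root_.IsRectRep.pi_pow_smul_of_equiv (h : IsRectRep N k S t Y ρ)
    (hS : S ≠ 0) (hS' : ∀ m : ℕ, 0 < m → S ^ m ≠ 1)
    {b : rootsOfUnity (N * k) K} (e : M ≃ₗ[DAHA (N * k) S t Y] TwistMod ρ b) {v : M}
    (hv : ∀ i : ZMod (N * k), (Z i : DAHA (N * k) S t Y) • v = (PSYT.R₀ N k).wt S i • v) :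
    (pi ^ N : DAHA (N * k) S t Y) • v = ((b : Kˣ) : K) ^ N • v := by
  obtain ⟨c, hc⟩ := (h.hasWeights.twist b).eq_smul_columnVector hS hS' (v := e v) (fun i => by
    rw [← map_smul, hv]; exact e.toLinearMap.map_smul_of_tower _ _)
  apply e.injective
  rw [map_smul, show e (((b : Kˣ) : K) ^ N • v) = ((b : Kˣ) : K) ^ N • e v from
    e.toLinearMap.map_smul_of_tower _ _, hc, smul_comm _ c, smul_comm _ c]
  congr 1
  exact h.twist_pi_pow_columnVector b

include hS hS' ht in
-- The scalar of π^N on the line of weight wt(R₀) is an invariant of the module, and it is complete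
-- by uniqueness of simple modules with a column vector.
theorem _root_.IsRectRep.nonempty_twist_equiv_iff (h : IsRectRep N k S t Y ρ)
    (b c : rootsOfUnity (N * k) K) :
    Nonempty (TwistMod ρ b ≃ₗ[DAHA (N * k) S t Y] TwistMod ρ c) ↔
      ((b : Kˣ) : K) ^ N = ((c : Kˣ) : K) ^ N := by
  have := isSimpleModule_twist h.irreducible b
  have hb := h.isColumnVector_twist hS hS' ht b
  constructor
  · rintro ⟨e⟩
    have h1 := h.pi_pow_smul_of_equiv hS hS' e hb.weight
    rw [hb.pi_pow] at h1
    exact smul_left_injective K columnVector_ne_zero h1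
  · intro e
    rw [e] at hb
    exact h.nonempty_equiv_twist hS hS' ht columnVector_ne_zero hb

end IsRectRep

end DAHA

/-! ### The model is the module L̄(k^N) -/

namespace PSYTBar

variable {K : Type*} [Field K] {N k : ℕ} [NeZero N] [NeZero k] {S t Y : K}

theorem isRectRep_rectRep (hS : S ≠ 0) (hS' : ∀ m : ℕ, 0 < m → S ^ m ≠ 1) (ht : S ^ N = t)
    (hY : Y = S ^ (1 - (N : ℤ) ^ 2)) :
    IsRectRep N k S t Y (rectRep N k S t Y hS hS' ht hY) := by
  have hw : DAHA.HasWeights (rectRep N k S t Y hS hS' ht hY) := by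
    intro R i
    rw [rectRep_Z, opZ_single, diag_mk]
    rfl
  refine ⟨?_, hw, ?_⟩
  · rw [isSimpleModule_iff_toSpanSingleton_surjective]
    refine ⟨⟨_, _, DAHA.columnVector_ne_zero⟩, fun x hx => ?_⟩
    rw [← LinearMap.range_eq_top]
    set D := LinearMap.range (LinearMap.toSpanSingleton (DAHA (N * k) S t Y)
      (RepMod (rectRep N k S t Y hS hS' ht hY)) x)
    have hsmul : ∀ a : DAHA (N * k) S t Y, ∀ v ∈ D.restrictScalars K,
        rectRep N k S t Y hS hS' ht hY a v ∈ D.restrictScalars K := fun a v hv => D.smul_mem a hv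
    have htop : D.restrictScalars K = ⊤ := by
      refine eq_top_of_invariant (f := x) hS hS' ht ?_ ?_ ?_ ⟨1, one_smul _ x⟩ hx
      · intro i v hv
        rw [← hw.map_Zi hS]
        exact hsmul _ v hv
      · intro i v hv
        have := hsmul (DAHA.T (i : ZMod (N * k))) v hv
        rw [rectRep_T] at this
        rwa [opT_congr hS hS' ht (i := i) (j := PSYT.rep (i : ZMod (N * k)))]
        rw [← ZMod.intCast_zmod_eq_zero_iff_dvd, Int.cast_sub, PSYT.intCast_rep, sub_self]
      · intro v hv
        rw [← rectRep_pi hS hS' ht hY]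
        exact hsmul _ v hv
    exact (Submodule.restrictScalars_eq_top_iff K _ _).mp htop
  · rw [map_pow, rectRep_pi, opPi_pow, opPi_single, rot_eq (Q' := ⟦PSYT.R₀ N k⟧)]
    intro i
    rw [diag_mk]
    have := PSYT.R₀_diagN_add (N := N) (k := k) (i - N)
    rw [sub_add_cancel] at this
    exact this

end PSYTBar

/-! ## Simple modules with the support of the rectangular representation -/

theorem aeval_smul_of_smul_eq {K A M : Type*} [Field K] [Ring A] [Algebra K A] [AddCommGroup M]
    [Module K M] [Module A M] [IsScalarTower K A M] {p : A} {β : K} {v : M} (h : p • v = β • v)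
    (P : Polynomial K) : Polynomial.aeval p P • v = P.eval β • v := by
  have hpow : ∀ m : ℕ, p ^ m • v = β ^ m • v := by
    intro m
    induction m with
    | zero => simp
    | succ m ih => rw [pow_succ, mul_smul, h, smul_comm, ih, smul_smul, ← pow_succ']
  induction P using Polynomial.induction_on' with
  | add P Q hP hQ => rw [map_add, add_smul, hP, hQ, Polynomial.eval_add, add_smul]
  | monomial m c =>
    rw [Polynomial.aeval_monomial, Polynomial.eval_monomial, mul_smul, hpow, algebraMap_smul,
      smul_smul]

/-- Remove one linear factor at a time: either x is an eigenvector for ζ, or (p − ζ)x is a non-zero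
vector of V killed by the remaining factors. No finite dimension is needed. -/
theorem exists_eigenvector_of_aeval_prod {K A M : Type*} [Field K] [Ring A] [Algebra K A]
    [AddCommGroup M] [Module K M] [Module A M] [IsScalarTower K A M] {p : A} {V : Submodule K M}
    (hV : ∀ v ∈ V, p • v ∈ V) (s : Finset K) {x : M} (hx : x ∈ V) (h0 : x ≠ 0)
    (h : Polynomial.aeval p (∏ ζ ∈ s, (Polynomial.X - Polynomial.C ζ)) • x = 0) :
    ∃ ζ ∈ s, ∃ y ∈ V, y ≠ 0 ∧ p • y = ζ • y := by
  classical
  induction s using Finset.induction_on generalizing x with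
  | empty => simp [h0] at h
  | insert ζ s hζ ih =>
    by_cases hy : p • x - ζ • x = 0
    · exact ⟨ζ, Finset.mem_insert_self _ _, x, hx, h0, sub_eq_zero.mp hy⟩
    · rw [Finset.prod_insert hζ, mul_comm, map_mul, mul_smul, map_sub, Polynomial.aeval_X,
        Polynomial.aeval_C, sub_smul, algebraMap_smul] at h
      obtain ⟨ξ, hξ, y, hy⟩ := ih (V.sub_mem (hV x hx) (V.smul_mem ζ hx)) hy h
      exact ⟨ξ, Finset.mem_insert_of_mem hξ, y, hy⟩

namespace DAHA

open PSYTBar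

variable {K : Type*} [Field K] {N k : ℕ} [NeZero N] [NeZero k] {S t Y : K}
variable {M : Type*} [AddCommGroup M] [Module K M] [Module (DAHA (N * k) S t Y) M]
  [IsScalarTower K (DAHA (N * k) S t Y) M]
variable {ρ : DAHA (N * k) S t Y →ₐ[K] Module.End K (PSYTBar N k →₀ K)}

variable {a : rootsOfUnity (N * k) K} (ha : IsPrimitiveRoot ((a : Kˣ) : K) (N * k))

include ha

theorem isPrimitiveRoot_pow : IsPrimitiveRoot (((a : Kˣ) : K) ^ N) k :=
  ha.pow (Nat.pos_of_neZero _) rfl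

/-- A non-zero subspace that is stable under `π ^ N` contains an eigenvector of `π ^ N`. -/
theorem exists_eigenvector {V : Submodule K M}
    (hV : ∀ v ∈ V, (pi ^ N : DAHA (N * k) S t Y) • v ∈ V) {x : M} (hx : x ∈ V) (h0 : x ≠ 0) :
    ∃ j : Fin k, ∃ y ∈ V, y ≠ 0 ∧ (pi ^ N : DAHA (N * k) S t Y) • y =
      (((a ^ (j : ℕ) : rootsOfUnity (N * k) K) : Kˣ) : K) ^ N • y := by
  have hk := Nat.pos_of_neZero k
  have hprim := isPrimitiveRoot_pow ha
  have h1 : Polynomial.aeval (pi ^ N : DAHA (N * k) S t Y)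
      (∏ ζ ∈ Polynomial.nthRootsFinset k (1 : K), (Polynomial.X - Polynomial.C ζ)) • x = 0 := by
    -- The k-th power of π^N is π^n = 1, and X^k − 1 splits because a^N is a primitive k-th root of
    -- unity.
    rw [← Polynomial.X_pow_sub_one_eq_prod hk hprim, map_sub, map_pow, Polynomial.aeval_X,
      ← pow_mul, pi_pow_n, map_one, sub_self, zero_smul]
  obtain ⟨ζ, hζ, y, hy, hy0, he⟩ := exists_eigenvector_of_aeval_prod hV _ hx h0 h1
  rw [Polynomial.mem_nthRootsFinset hk] at hζ
  obtain ⟨j, hj, rfl⟩ := hprim.eq_pow_of_pow_eq_one hζ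
  refine ⟨⟨j, hj⟩, y, hy, hy0, ?_⟩
  rw [he]
  congr 1
  push_cast
  exact pow_right_comm _ _ _

theorem _root_.IsRectRep.exists_equiv_twist (hS : S ≠ 0) (hS' : ∀ m : ℕ, 0 < m → S ^ m ≠ 1)
    (ht : S ^ N = t) (h : IsRectRep N k S t Y ρ) [IsSimpleModule (DAHA (N * k) S t Y) M]
    (hM : supp (N * k) S t Y M = supp (N * k) S t Y (RepMod ρ)) :
    ∃ j : Fin k, Nonempty (M ≃ₗ[DAHA (N * k) S t Y] TwistMod ρ (a ^ (j : ℕ))) := by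
  rw [h.hasWeights.supp_eq hS] at hM
  obtain ⟨x, hx0, hx⟩ := mem_supp_iff.mp (hM.superset ⟨PSYT.R₀ N k, rfl⟩)
  obtain ⟨j, y, hy, hy0, he⟩ := exists_eigenvector (S := S) (t := t) (Y := Y) ha
    (V := weightSpace (N * k) S t Y M ((PSYT.R₀ N k).wt S))
    (fun v hv => weight_pi_pow_smul hS hv) hx hx0
  exact ⟨j, h.nonempty_equiv_twist hS hS' ht hy0
    (isColumnVector_of_supp_subset hS hS' ht hM.subset hy he)⟩

omit ha in
theorem _root_.IsRectRep.finrank_weightSpace (hS : S ≠ 0) (hS' : ∀ m : ℕ, 0 < m → S ^ m ≠ 1)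
    (h : IsRectRep N k S t Y ρ) {b : rootsOfUnity (N * k) K}
    (e : M ≃ₗ[DAHA (N * k) S t Y] TwistMod ρ b) :
    Module.finrank K (weightSpace (N * k) S t Y M ((PSYT.R₀ N k).wt S)) = 1 := by
  have hw := h.hasWeights.twist b
  have hsymm : ∀ (c : K) (v : TwistMod ρ b), e.symm (c • v) = c • e.symm v :=
    e.symm.toLinearMap.map_smul_of_tower
  refine finrank_eq_one (⟨e.symm (columnVector _), fun i => ?_⟩ :
    weightSpace (N * k) S t Y M ((PSYT.R₀ N k).wt S)) (fun H => ?_) (fun w => ?_)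
  · rw [← map_smul, hw.weight_columnVector, hsymm]
  · have := congrArg Subtype.val H
    exact columnVector_ne_zero (e.symm.map_eq_zero_iff.mp this)
  · obtain ⟨c, hc⟩ := hw.eq_smul_columnVector hS hS' (v := e w.1) (fun i => by
      rw [← map_smul, w.2 i]; exact e.toLinearMap.map_smul_of_tower _ _)
    refine ⟨c, Subtype.ext ?_⟩
    apply e.injective
    rw [hc]
    change e (c • e.symm _) = _
    rw [← hsymm, LinearEquiv.apply_symm_apply]

omit ha in
theorem _root_.IsRectRep.nonempty_equiv_twist_iff (hS : S ≠ 0)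
    (hS' : ∀ m : ℕ, 0 < m → S ^ m ≠ 1)
    (ht : S ^ N = t) (h : IsRectRep N k S t Y ρ) [IsSimpleModule (DAHA (N * k) S t Y) M]
    (hM : supp (N * k) S t Y M = supp (N * k) S t Y (RepMod ρ)) (b : rootsOfUnity (N * k) K) :
    Nonempty (M ≃ₗ[DAHA (N * k) S t Y] TwistMod ρ b) ↔
      ∀ v ∈ weightSpace (N * k) S t Y M ((PSYT.R₀ N k).wt S),
        (pi ^ N : DAHA (N * k) S t Y) • v = ((b : Kˣ) : K) ^ N • v := by
  constructor
  · rintro ⟨e⟩ v hv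
    exact h.pi_pow_smul_of_equiv hS hS' e hv
  · intro H
    rw [h.hasWeights.supp_eq hS] at hM
    obtain ⟨x, hx0, hx⟩ := mem_supp_iff.mp (hM.superset ⟨PSYT.R₀ N k, rfl⟩)
    exact h.nonempty_equiv_twist hS hS' ht hx0
      (isColumnVector_of_supp_subset hS hS' ht hM.subset hx (H x hx))

end DAHA

/-! ## Standard tableaux as periodic tableaux -/

theorem aswap_add_mul (n : ℕ) (i j m : ℤ) : aswap n i (j + n * m) = aswap n i j + n * m := by
  induction m using Int.induction_on with
  | zero => simp
  | succ m ih => rw [mul_add, mul_one, ← add_assoc, aswap_add, ih, add_assoc]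
  | pred m ih =>
    have := aswap_add n i (j + n * (-(m : ℤ) - 1))
    rw [show j + (n : ℤ) * (-(m : ℤ) - 1) + n = j + n * (-m) by ring, ih] at this
    linarith

theorem aswap_of_mem {n i e : ℕ} (hi : 1 ≤ i) (hi' : i < n) (he : 1 ≤ e) (he' : e ≤ n) :
    aswap n i e = (Equiv.swap i (i + 1) e : ℕ) := by
  have h1 : ¬ (n : ℤ) ∣ 1 := by
    intro h
    have := Int.le_of_dvd one_pos h
    omega
  rw [Equiv.swap_apply_def]
  split_ifs with h h'
  · subst h
    rw [aswap_self h1]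
    push_cast; rfl
  · subst h'
    push_cast
    rw [aswap_succ h1]
  · refine aswap_other (fun H => h ?_) (fun H => h' ?_)
    · have := Int.eq_zero_of_abs_lt_dvd H (by rw [abs_lt]; omega)
      omega
    · have := Int.eq_zero_of_abs_lt_dvd H (by rw [abs_lt]; omega)
      omega

namespace SYT

variable {N k : ℕ} [NeZero N] [NeZero k]

/-- The column of the rectangle `(k^N)` that is congruent to the column `c` of the strip. -/
def colIndex (k : ℕ) [NeZero k] (c : ℤ) : Fin k :=
  ⟨((c - 1) % k).toNat, by
    have h0 : (k : ℤ) ≠ 0 := by exact_mod_cast NeZero.ne k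
    have h1 := Int.emod_nonneg (c - 1) h0
    have h2 := Int.emod_lt_of_pos (c - 1) (by positivity : (0 : ℤ) < k)
    omega⟩

theorem colIndex_val (c : ℤ) : ((colIndex k c : ℕ) : ℤ) = (c - 1) % k :=
  Int.toNat_of_nonneg (Int.emod_nonneg _ (by exact_mod_cast NeZero.ne k))

theorem colIndex_add_one (c : Fin k) : colIndex k ((c : ℕ) + 1 : ℤ) = c := by
  apply Fin.ext
  have h := colIndex_val (k := k) ((c : ℕ) + 1 : ℤ)
  rw [add_sub_cancel_right, Int.emod_eq_of_lt (by positivity) (by exact_mod_cast c.2)] at h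
  exact_mod_cast h

theorem colIndex_add (c : ℤ) : colIndex k (c + k) = colIndex k c := by
  apply Fin.ext
  have h : ((colIndex k (c + k) : ℕ) : ℤ) = (colIndex k c : ℕ) := by
    rw [colIndex_val, colIndex_val, show c + (k : ℤ) - 1 = c - 1 + k by ring, Int.add_emod_right]
  exact_mod_cast h

theorem one_le_entry (R : SYT N k) (r : Fin N) (c : Fin k) : 1 ≤ R.entry r c :=
  (Finset.mem_Icc.mp (R.entry_mem r c)).1

theorem entry_le (R : SYT N k) (r : Fin N) (c : Fin k) : R.entry r c ≤ N * k :=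
  (Finset.mem_Icc.mp (R.entry_mem r c)).2

theorem exists_entry_eq (R : SYT N k) {i : ℕ} (hi : 1 ≤ i) (hi' : i ≤ N * k) :
    ∃ r c, R.entry r c = i := by
  have hinj : Set.InjOn (fun b : Fin N × Fin k => R.entry b.1 b.2)
      ((Finset.univ : Finset (Fin N × Fin k)) : Set (Fin N × Fin k)) := by
    intro b _ b' _ h
    exact Prod.ext_iff.mpr (R.entry_inj _ _ _ _ h)
  have := Finset.surj_on_of_inj_on_of_card_le (s := (Finset.univ : Finset (Fin N × Fin k)))
    (t := Finset.Icc 1 (N * k)) (fun b _ => R.entry b.1 b.2) (fun b _ => R.entry_mem _ _)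
    (fun b b' _ _ h => hinj (Finset.mem_coe.mpr (Finset.mem_univ b))
      (Finset.mem_coe.mpr (Finset.mem_univ b')) h) (by simp) i (Finset.mem_Icc.mpr ⟨hi, hi'⟩)
  obtain ⟨b, _, hb⟩ := this
  exact ⟨b.1, b.2, hb.symm⟩

/-- The periodic extension of a filling of the rectangle. -/
def fill (R : SYT N k) (b : Fin N × ℤ) : ℤ :=
  R.entry b.1 (colIndex k b.2) + (N * k : ℕ) * ((b.2 - 1) / k)

theorem fill_add (R : SYT N k) (r : Fin N) (c : ℤ) :
    R.fill (r, c + k) = R.fill (r, c) + (N * k : ℕ) := by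
  have hk : (k : ℤ) ≠ 0 := by exact_mod_cast NeZero.ne k
  simp only [fill]
  rw [colIndex_add, show c + (k : ℤ) - 1 = c - 1 + k * 1 by ring, Int.add_mul_ediv_left _ _ hk]
  ring

theorem fill_window (R : SYT N k) (r : Fin N) (c : Fin k) :
    R.fill (r, (c : ℕ) + 1) = R.entry r c := by
  simp only [fill, colIndex_add_one]
  rw [add_sub_cancel_right, Int.ediv_eq_zero_of_lt (by positivity) (by exact_mod_cast c.2)]
  simp

theorem eq_of_fill_eq {e e' : ℕ} {n : ℕ} {q q' : ℤ} (he : 1 ≤ e) (hn : e ≤ n) (he' : 1 ≤ e')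
    (hn' : e' ≤ n) (h : (e : ℤ) + n * q = e' + n * q') : e = e' ∧ q = q' := by
  have hn0 : (n : ℤ) ≠ 0 := by omega
  have hq : q = q' := by
    have h1 : ((e : ℤ) + n * q - 1) / n = q := by
      rw [show (e : ℤ) + n * q - 1 = (e - 1) + n * q by ring, Int.add_mul_ediv_left _ _ hn0,
        Int.ediv_eq_zero_of_lt (by omega) (by omega), zero_add]
    have h2 : ((e' : ℤ) + n * q' - 1) / n = q' := by
      rw [show (e' : ℤ) + n * q' - 1 = (e' - 1) + n * q' by ring, Int.add_mul_ediv_left _ _ hn0,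
        Int.ediv_eq_zero_of_lt (by omega) (by omega), zero_add]
    rw [← h1, h, h2]
  subst hq
  exact ⟨by exact_mod_cast add_right_cancel h, rfl⟩

theorem fill_bijective (R : SYT N k) : Function.Bijective R.fill := by
  constructor
  · rintro ⟨r, c⟩ ⟨r', c'⟩ h
    obtain ⟨h1, h2⟩ := eq_of_fill_eq (R.one_le_entry _ _) (R.entry_le _ _) (R.one_le_entry _ _)
      (R.entry_le _ _) h
    obtain ⟨h3, h4⟩ := R.entry_inj _ _ _ _ h1
    simp only at h2 h3 h4
    have h5 := colIndex_val (k := k) c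
    rw [h4, colIndex_val] at h5
    have h6 := Int.emod_add_mul_ediv (c - 1) k
    have h7 := Int.emod_add_mul_ediv (c' - 1) k
    rw [← h5, h2] at h6
    refine Prod.ext h3 ?_
    simp only
    linarith
  · intro i
    have hn : (0 : ℤ) < (N * k : ℕ) := by have := Nat.pos_of_neZero (N * k); exact_mod_cast this
    have hk : (k : ℤ) ≠ 0 := by exact_mod_cast NeZero.ne k
    have h1 := Int.emod_nonneg (i - 1) hn.ne'
    have h2 := Int.emod_lt_of_pos (i - 1) hn
    have h3 := Int.emod_add_mul_ediv (i - 1) (N * k : ℕ)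
    obtain ⟨r, c, h⟩ := R.exists_entry_eq (i := ((i - 1) % (N * k : ℕ)).toNat + 1) (by omega)
      (by omega)
    refine ⟨(r, (c : ℕ) + 1 + k * ((i - 1) / (N * k : ℕ))), ?_⟩
    have h4 : R.fill (r, (c : ℕ) + 1 + k * ((i - 1) / (N * k : ℕ))) =
        R.fill (r, (c : ℕ) + 1) + (N * k : ℕ) * ((i - 1) / (N * k : ℕ)) := by
      generalize (i - 1) / ((N * k : ℕ) : ℤ) = m
      simp only [fill]
      have e : colIndex k ((c : ℕ) + 1 + k * m : ℤ) = colIndex k ((c : ℕ) + 1 : ℤ) := by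
        apply Fin.ext
        have : ((colIndex k ((c : ℕ) + 1 + k * m : ℤ) : ℕ) : ℤ) =
            (colIndex k ((c : ℕ) + 1 : ℤ) : ℕ) := by
          rw [colIndex_val, colIndex_val, show ((c : ℕ) : ℤ) + 1 + k * m - 1 =
            ((c : ℕ) : ℤ) + 1 - 1 + k * m by ring, Int.add_mul_emod_self_left]
        exact_mod_cast this
      rw [e, show ((c : ℕ) : ℤ) + 1 + k * m - 1 = ((c : ℕ) : ℤ) + 1 - 1 + k * m by ring,
        Int.add_mul_ediv_left _ _ hk]
      ring
    rw [h4, fill_window, h]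
    rw [Nat.cast_add, Int.toNat_of_nonneg h1]
    push_cast at h3 ⊢
    linarith

/-- The periodic extension of a standard tableau. -/
noncomputable def toPSYT (R : SYT N k) : PSYT N k where
  box := (Equiv.ofBijective R.fill R.fill_bijective).symm
  row_lt r c c' h := by
    simp only [Equiv.symm_symm, Equiv.ofBijective_apply]
    have hk : (0 : ℤ) < k := by have := Nat.pos_of_neZero k; exact_mod_cast this
    have hq : (c - 1) / k ≤ (c' - 1) / k := Int.ediv_le_ediv hk (by omega)
    rcases hq.eq_or_lt with e | e
    · have h5 := colIndex_val (k := k) c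
      have h5' := colIndex_val (k := k) c'
      have h6 := Int.emod_add_mul_ediv (c - 1) k
      have h7 := Int.emod_add_mul_ediv (c' - 1) k
      rw [e] at h6
      have hlt : colIndex k c < colIndex k c' := by
        rw [Fin.lt_def]
        have : ((colIndex k c : ℕ) : ℤ) < (colIndex k c' : ℕ) := by rw [h5, h5']; linarith
        exact_mod_cast this
      have := R.row_lt r _ _ hlt
      simp only [fill, e]
      omega
    · have h1 := R.entry_le r (colIndex k c)
      have h2 := R.one_le_entry r (colIndex k c')
      have h3 : ((N * k : ℕ) : ℤ) * ((c - 1) / k + 1) ≤ (N * k : ℕ) * ((c' - 1) / k) :=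
        mul_le_mul_of_nonneg_left e (by positivity)
      rw [mul_add, mul_one] at h3
      simp only [fill]
      generalize ((N * k : ℕ) : ℤ) * ((c - 1) / k) = u at *
      generalize ((N * k : ℕ) : ℤ) * ((c' - 1) / k) = v at *
      omega
  col_lt r r' c h := by
    simp only [Equiv.symm_symm, Equiv.ofBijective_apply, fill]
    have := R.col_lt r r' (colIndex k c) h
    omega
  periodic i := by
    obtain ⟨⟨r, c⟩, rfl⟩ := R.fill_bijective.2 i
    rw [← fill_add, ← Equiv.ofBijective_apply R.fill R.fill_bijective,
      ← Equiv.ofBijective_apply R.fill R.fill_bijective, Equiv.symm_apply_apply,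
      Equiv.symm_apply_apply]

theorem toPSYT_symm (R : SYT N k) (b : Fin N × ℤ) : R.toPSYT.box.symm b = R.fill b := rfl

theorem toPSYT_box_fill (R : SYT N k) (b : Fin N × ℤ) : R.toPSYT.box (R.fill b) = b := by
  rw [← toPSYT_symm, Equiv.apply_symm_apply]

theorem toPSYT_box_entry (R : SYT N k) (r : Fin N) (c : Fin k) :
    R.toPSYT.box (R.entry r c) = (r, ((c : ℕ) : ℤ) + 1) := by
  rw [← fill_window, toPSYT_box_fill]

theorem toPSYT_p (R : SYT N k) : R.toPSYT.p = 0 := by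
  refine PSYT.p_eq_zero _ fun r c hc => ?_
  rw [Finset.mem_Icc] at hc
  obtain ⟨m, hm⟩ := Int.eq_ofNat_of_zero_le (by omega : 0 ≤ c - 1)
  have e : c = ((⟨m, by omega⟩ : Fin k) : ℕ) + 1 := by simp only; omega
  rw [toPSYT_symm, e, fill_window, Finset.mem_Icc]
  have h1 := R.one_le_entry r ⟨m, by omega⟩
  have h2 := R.entry_le r ⟨m, by omega⟩
  omega

theorem toPSYT_diagN_entry (R : SYT N k) (r : Fin N) (c : Fin k) :
    R.toPSYT.diagN (R.entry r c) = N * (((c : ℕ) : ℤ) - (r : ℕ)) := by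
  rw [PSYT.diagN, toPSYT_p, toPSYT_box_entry]
  ring

/-- Both periodic extensions have p = 0, so a horizontal shift relating them is trivial. -/
theorem toPSYT_injective : Function.Injective fun R : SYT N k => (⟦R.toPSYT⟧ : PSYTBar N k) := by
  intro R R' h
  have hd : R.toPSYT.diagN = R'.toPSYT.diagN := congrArg PSYTBar.diag h
  obtain ⟨s, hs⟩ := PSYT.diagN_injective hd
  have hN : (N : ℤ) ≠ 0 := by exact_mod_cast NeZero.ne N
  have hs0 : s = 0 := by
    have := congrFun hd 0
    rw [PSYT.diagN, PSYT.diagN, toPSYT_p, toPSYT_p, hs] at this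
    have := mul_left_cancel₀ hN (add_right_cancel this)
    simp only at this
    omega
  ext r c
  have h1 := hs (R.entry r c)
  rw [toPSYT_box_entry, hs0, add_zero] at h1
  have h2 := congrArg R'.toPSYT.box.symm h1
  rw [Equiv.symm_apply_apply, toPSYT_symm, fill_window] at h2
  exact_mod_cast h2

variable {R R' : SYT N k} {i : ℕ}

theorem exists_isSwap (h : R.toPSYT.Free i) (hi : 1 ≤ i) (hi' : i < N * k) :
    ∃ R', R.IsSwap i R' := by
  have key : ∀ e e' : ℕ, e < e' → ¬ (e = i ∧ e' = i + 1) →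
      Equiv.swap i (i + 1) e < Equiv.swap i (i + 1) e' := by
    intro e e' h1 h2
    rw [Equiv.swap_apply_def, Equiv.swap_apply_def]
    split_ifs <;> omega
  refine ⟨⟨fun r c => Equiv.swap i (i + 1) (R.entry r c), fun r c => ?_, fun r c r' c' h => ?_,
    fun r c c' hc => key _ _ (R.row_lt r c c' hc) ?_,
    fun r r' c hr => key _ _ (R.col_lt r r' c hr) ?_⟩, fun r c => rfl⟩
  · rw [Finset.mem_Icc, Equiv.swap_apply_def]
    have h1 := R.one_le_entry r c
    have h2 := R.entry_le r c
    split_ifs <;> omega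
  · exact R.entry_inj _ _ _ _ ((Equiv.swap i (i + 1)).injective h)
  · rintro ⟨h1, h2⟩
    apply h.1
    rw [← h1, R.toPSYT_box_entry, h1, show (i : ℤ) + 1 = (i + 1 : ℕ) by push_cast; rfl, ← h2,
      R.toPSYT_box_entry]
  · rintro ⟨h1, h2⟩
    apply h.2
    rw [← h1, R.toPSYT_box_entry, h1, show (i : ℤ) + 1 = (i + 1 : ℕ) by push_cast; rfl, ← h2,
      R.toPSYT_box_entry]

theorem IsSwap.free (h : R.IsSwap i R') (hi : 1 ≤ i) (hi' : i < N * k) : R.toPSYT.Free i := by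
  obtain ⟨r, c, h1⟩ := R.exists_entry_eq hi hi'.le
  obtain ⟨r', c', h2⟩ := R.exists_entry_eq (i := i + 1) (by omega) hi'
  have e1 : R'.entry r c = i + 1 := by rw [h, h1, Equiv.swap_apply_left]
  have e2 : R'.entry r' c' = i := by rw [h, h2, Equiv.swap_apply_right]
  have b1 := R.toPSYT_box_entry r c
  have b2 := R.toPSYT_box_entry r' c'
  rw [h1] at b1
  rw [h2] at b2
  push_cast at b2
  constructor
  · rw [b1, b2]
    intro hr
    obtain rfl : r = r' := hr
    rcases lt_trichotomy c c' with hc | rfl | hc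
    · have := R'.row_lt r c c' hc
      omega
    · omega
    · have := R.row_lt r c' c hc
      omega
  · rw [b1, b2]
    intro hc
    obtain rfl : c = c' := by
      apply Fin.ext
      simp only at hc
      omega
    rcases lt_trichotomy r r' with hr | rfl | hr
    · have := R'.col_lt r r' c hr
      omega
    · omega
    · have := R.col_lt r' r c hr
      omega

theorem IsSwap.box (h : R.IsSwap i R') (hi : 1 ≤ i) (hi' : i < N * k) (j : ℤ) :
    R'.toPSYT.box j = R.toPSYT.box (aswap (N * k) i j) := by
  obtain ⟨b, rfl⟩ := R'.fill_bijective.2 j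
  rw [toPSYT_box_fill]
  have : aswap (N * k) i (R'.fill b) = R.fill b := by
    rw [fill, aswap_add_mul, h, aswap_of_mem hi hi', Equiv.swap_apply_self, fill]
    · rw [Equiv.swap_apply_def]
      have := R.one_le_entry b.1 (colIndex k b.2)
      split_ifs <;> omega
    · rw [Equiv.swap_apply_def]
      have := R.entry_le b.1 (colIndex k b.2)
      split_ifs <;> omega
  rw [this, toPSYT_box_fill]

theorem IsSwap.swap_eq (h : R.IsSwap i R') (hi : 1 ≤ i) (hi' : i < N * k) :
    PSYTBar.swap (i : ℤ) (⟦R.toPSYT⟧ : PSYTBar N k) = ⟦R'.toPSYT⟧ := by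
  have := PSYT.diagN_aswap R.toPSYT R'.toPSYT i (h.free hi hi').not_dvd (h.box hi hi')
  apply PSYTBar.diag_injective
  rw [PSYTBar.swap_diag (Q := ⟦R.toPSYT⟧) (Q' := ⟦R'.toPSYT⟧) _ this]
  exact (funext this).symm

theorem IsSwap.symm (h : R.IsSwap i R') : R'.IsSwap i R := by
  intro r c
  rw [h, Equiv.swap_apply_self]

/-- The tableau whose columns are filled with consecutive integers. -/
def R₀ (N k : ℕ) [NeZero N] [NeZero k] : SYT N k where
  entry r c := r + 1 + N * c
  entry_mem r c := by
    rw [Finset.mem_Icc]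
    refine ⟨by omega, ?_⟩
    have h1 : N * ((c : ℕ) + 1) ≤ N * k := Nat.mul_le_mul_left N c.2
    have h2 := r.2
    rw [mul_add] at h1
    omega
  entry_inj r c r' c' h := by
    have hN := Nat.pos_of_neZero N
    have h1 := congrArg (fun m => (m - 1) % N) h
    have h2 : ∀ (r : Fin N) (c : Fin k), ((r : ℕ) + 1 + N * c - 1) = r + N * c := by
      intro r c; omega
    simp only [h2, Nat.add_mul_mod_self_left, Nat.mod_eq_of_lt r.2, Nat.mod_eq_of_lt r'.2] at h1
    refine ⟨Fin.ext h1, Fin.ext ?_⟩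
    rw [h1] at h
    exact Nat.eq_of_mul_eq_mul_left hN (Nat.add_left_cancel h)
  row_lt r c c' h := by
    have hN := Nat.pos_of_neZero N
    have := Nat.mul_lt_mul_of_pos_left (Fin.lt_def.mp h) hN
    omega
  col_lt r r' c h := by
    have := Fin.lt_def.mp h
    omega

theorem R₀_fill (b : Fin N × ℤ) : (R₀ N k).fill b = (PSYT.R₀ N k).box.symm b := by
  obtain ⟨r, c⟩ := b
  rw [PSYT.R₀_symm]
  simp only [fill, R₀]
  push_cast
  rw [colIndex_val]
  have := Int.emod_add_mul_ediv (c - 1) k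
  linear_combination (N : ℤ) * this

theorem toPSYT_R₀_box (j : ℤ) : (R₀ N k).toPSYT.box j = (PSYT.R₀ N k).box j := by
  obtain ⟨b, rfl⟩ := (R₀ N k).fill_bijective.2 j
  rw [toPSYT_box_fill, R₀_fill, Equiv.apply_symm_apply]

theorem mk_toPSYT_R₀ : (⟦(R₀ N k).toPSYT⟧ : PSYTBar N k) = ⟦PSYT.R₀ N k⟧ := by
  symm
  exact Quotient.sound ⟨0, fun i => by rw [toPSYT_R₀_box]; simp⟩

theorem entry_zero_zero (R : SYT N k) : R.entry 0 0 = 1 := by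
  obtain ⟨r, c, h⟩ := R.exists_entry_eq (i := 1) le_rfl (Nat.pos_of_neZero _)
  have h1 := R.toPSYT.mono (Fin.zero_le r) (c := ((0 : Fin k) : ℕ) + 1) (c' := ((c : ℕ) : ℤ) + 1)
    (by simp)
  rw [toPSYT_symm, toPSYT_symm, fill_window, fill_window, h] at h1
  have := R.one_le_entry 0 0
  omega

/-- A tableau without descents of columns is `R₀`. -/
theorem eq_R₀ (h : ∀ i : ℕ, 1 ≤ i → i < N * k → (R.toPSYT.box i).2 ≤ (R.toPSYT.box (i + 1)).2) :
    R = R₀ N k := by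
  have hn : (0 : ℤ) < (N * k : ℕ) := by have := Nat.pos_of_neZero (N * k); exact_mod_cast this
  have hk : 0 < k := Nat.pos_of_neZero k
  have hall : ∀ i, (R.toPSYT.box i).2 ≤ (R.toPSYT.box (i + 1)).2 := by
    intro i
    have h1 := Int.emod_nonneg (i - 1) hn.ne'
    have h2 := Int.emod_lt_of_pos (i - 1) hn
    have h3 := Int.emod_add_mul_ediv (i - 1) (N * k : ℕ)
    obtain ⟨m, hm⟩ := Int.eq_ofNat_of_zero_le h1
    generalize (i - 1) / ((N * k : ℕ) : ℤ) = q at h3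
    rw [hm] at h2 h3
    obtain rfl : i = (m + 1 : ℕ) + (N * k : ℕ) * q := by push_cast at *; linarith
    have a := R.toPSYT.boxPeriodic.add_mul (m + 1 : ℕ) q
    have b := R.toPSYT.boxPeriodic.add_mul ((m + 1 : ℕ) + 1) q
    rw [show ((m + 1 : ℕ) : ℤ) + 1 + (N * k : ℕ) * q = (m + 1 : ℕ) + (N * k : ℕ) * q + 1 by ring]
      at b
    rw [a, b]
    simp only
    -- The hypothesis does not cover the passage from n to n + 1. There n + 1 lies k columns to the
    -- right of the corner entry 1, in column k + 1, and n lies in the rectangle.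
    have key : (R.toPSYT.box (m + 1 : ℕ)).2 ≤ (R.toPSYT.box ((m + 1 : ℕ) + 1)).2 := by
      by_cases hm' : m + 1 < N * k
      · exact h _ (by omega) hm'
      · obtain ⟨r, c, e⟩ := R.exists_entry_eq (i := m + 1) (by omega) (by omega)
        have e1 := R.toPSYT_box_entry r c
        rw [e] at e1
        have e2 := R.toPSYT.periodic 1
        have e3 := R.toPSYT_box_entry 0 0
        rw [entry_zero_zero] at e3
        rw [show ((m + 1 : ℕ) : ℤ) + 1 = 1 + (N * k : ℕ) by omega, e2, e1]
        rw [show ((1 : ℕ) : ℤ) = 1 from rfl] at e3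
        rw [e3]
        simp only
        have := c.2
        omega
    omega
  obtain ⟨j, hj⟩ := R.toPSYT.exists_rot_eq hall
  -- Both fillings have 1 in the top left corner, which excludes a proper rotation.
  have hj0 : j = 0 := by
    have e3 := R.toPSYT_box_entry 0 0
    have e4 := (R₀ N k).toPSYT_box_entry 0 0
    rw [entry_zero_zero, hj, PSYT.rot_box] at e3
    rw [entry_zero_zero, toPSYT_R₀_box] at e4
    have := (PSYT.R₀ N k).box.injective (e3.trans e4.symm)
    omega
  apply toPSYT_injective
  change (⟦R.toPSYT⟧ : PSYTBar N k) = ⟦(R₀ N k).toPSYT⟧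
  rw [mk_toPSYT_R₀]
  refine Quotient.sound ⟨0, fun i => ?_⟩
  rw [hj, hj0, PSYT.rot_box]
  simp

/-- Every standard tableau is reached from `R₀` by exchanging entries. -/
theorem induction_isSwap {P : SYT N k → Prop} (h0 : P (R₀ N k))
    (hswap : ∀ (R R' : SYT N k) (i : ℕ), 1 ≤ i → i < N * k → R.IsSwap i R' → P R → P R')
    (R : SYT N k) : P R := by
  obtain ⟨m, hm⟩ : ∃ m : ℕ, R.toPSYT.energy.toNat = m := ⟨_, rfl⟩
  induction m using Nat.strong_induction_on generalizing R with
  | _ m ih =>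
    by_cases h : ∀ i : ℕ, 1 ≤ i → i < N * k → (R.toPSYT.box i).2 ≤ (R.toPSYT.box (i + 1)).2
    · rw [eq_R₀ h]; exact h0
    · push Not at h
      obtain ⟨i, hi, hi', h⟩ := h
      have hf := R.toPSYT.free_of_col_lt h
      obtain ⟨R', hR'⟩ := exists_isSwap hf hi hi'
      refine hswap R' R i hi hi' hR'.symm (ih _ ?_ _ rfl)
      have a := PSYT.energy_lt R.toPSYT R'.toPSYT i hf.not_dvd (hR'.box hi hi') h
      have b := R'.toPSYT.energy_nonneg
      have c := R.toPSYT.energy_nonneg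
      omega

end SYT

/-! ## The module `rect` -/

namespace SYT

variable {K : Type*} [Field K] {N k : ℕ} [NeZero N] [NeZero k] {S t Y : K}

/-- The embedding of `rect` into the representation on periodic tableaux. -/
noncomputable def embed (K : Type*) [Field K] : (SYT N k →₀ K) →ₗ[K] (PSYTBar N k →₀ K) :=
  Finsupp.lmapDomain K K fun R : SYT N k => (⟦R.toPSYT⟧ : PSYTBar N k)

theorem embed_single (R : SYT N k) :
    embed K (Finsupp.single R 1) = Finsupp.single (⟦R.toPSYT⟧ : PSYTBar N k) 1 := by
  simp [embed]

theorem embed_injective : Function.Injective (embed K : (SYT N k →₀ K) →ₗ[K] _) :=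
  Finsupp.mapDomain_injective toPSYT_injective

theorem diagCoeff_mul_natCast (ht : S ^ N = t) (d : ℤ) :
    diagCoeff S t (N * d) = seminormalCoeff t d := by
  rw [diagCoeff, seminormalCoeff, ← ht, ← zpow_natCast S N, ← zpow_mul]
  congr 3
  ring

variable {R R' : SYT N k} {i : ℕ} {r r' : Fin N} {c c' : Fin k}

theorem content_sub (h : R.entry r c = i) (h' : R.entry r' c' = i + 1) :
    R.toPSYT.content i - R.toPSYT.content (i + 1) =
      (((c : ℕ) : ℤ) - (r : ℕ)) - (((c' : ℕ) : ℤ) - (r' : ℕ)) := by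
  have b1 := R.toPSYT_box_entry r c
  have b2 := R.toPSYT_box_entry r' c'
  rw [h] at b1
  rw [h'] at b2
  push_cast at b2
  rw [PSYT.content, PSYT.content, b1, b2]
  ring

theorem diag_sub (h : R.entry r c = i) (h' : R.entry r' c' = i + 1) :
    PSYTBar.diag (⟦R.toPSYT⟧ : PSYTBar N k) i - PSYTBar.diag (⟦R.toPSYT⟧ : PSYTBar N k) (i + 1) =
      N * ((((c : ℕ) : ℤ) - (r : ℕ)) - (((c' : ℕ) : ℤ) - (r' : ℕ))) := by
  rw [PSYTBar.diag_mk, PSYT.diagN_eq, PSYT.diagN_eq, ← content_sub h h']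
  ring

theorem opT_toPSYT_of_isSwap (ht : S ^ N = t) (hi : 1 ≤ i) (hi' : i < N * k)
    (h : R.entry r c = i) (h' : R.entry r' c' = i + 1) (hR : R.IsSwap i R') :
    PSYTBar.opT S t i (embed K (Finsupp.single R 1)) =
      embed K (seminormalCoeff t (((c : ℤ) - r) - ((c' : ℤ) - r')) • Finsupp.single R 1 +
        (t⁻¹ + seminormalCoeff t (((c : ℤ) - r) - ((c' : ℤ) - r'))) • Finsupp.single R' 1) := by
  have hN : (N : ℤ) ≠ 0 := by exact_mod_cast NeZero.ne N
  have hc := (hR.free hi hi').content_sub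
  rw [content_sub h h'] at hc
  rw [map_add, map_smul, map_smul, embed_single, embed_single, PSYTBar.opT_single,
    diag_sub h h', hR.swap_eq hi hi', swapCoeff, if_neg, diagCoeff_mul_natCast ht]
  intro H
  have := mul_left_cancel₀ hN (H.trans (by ring : -(N : ℤ) = N * (-1)))
  omega

theorem opT_toPSYT_of_not_isSwap (hS : S ≠ 0) (hS' : ∀ m : ℕ, 0 < m → S ^ m ≠ 1) (ht : S ^ N = t)
    (hi : 1 ≤ i) (hi' : i < N * k) (h : R.entry r c = i) (h' : R.entry r' c' = i + 1)
    (hR : ¬ ∃ R', R.IsSwap i R') :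
    PSYTBar.opT S t i (embed K (Finsupp.single R 1)) =
      embed K (seminormalCoeff t (((c : ℤ) - r) - ((c' : ℤ) - r')) • Finsupp.single R 1) := by
  have h0 : swapCoeff N S t (N * ((((c : ℕ) : ℤ) - (r : ℕ)) - (((c' : ℕ) : ℤ) - (r' : ℕ)))) = 0 := by
    rw [← content_sub h h']
    by_cases h1 : (R.toPSYT.box i).1 = (R.toPSYT.box (i + 1)).1
    · rw [R.toPSYT.content_succ_of_fst_eq h1, swapCoeff, if_pos (by ring)]
    by_cases h2 : (R.toPSYT.box i).2 = (R.toPSYT.box (i + 1)).2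
    · rw [R.toPSYT.content_succ_of_snd_eq h2, mul_one, swapCoeff_self hS hS' (NeZero.ne N) ht]
    exact absurd (exists_isSwap ⟨h1, h2⟩ hi hi') hR
  rw [map_smul, embed_single, PSYTBar.opT_single, diag_sub h h', h0, zero_smul, add_zero,
    diagCoeff_mul_natCast ht]

theorem val_of_ne_zero {n : ℕ} [NeZero n] {i : ZMod n} (hi : i ≠ 0) :
    1 ≤ i.val ∧ i.val < n ∧ PSYT.rep i = (i.val : ℕ) :=
  ⟨Nat.one_le_iff_ne_zero.mpr (by rwa [Ne, ZMod.val_eq_zero]), ZMod.val_lt i, if_neg hi⟩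

variable (hS : S ≠ 0) (hS' : ∀ m : ℕ, 0 < m → S ^ m ≠ 1) (ht : S ^ N = t)
  (hY : Y = S ^ (1 - (N : ℤ) ^ 2))

/-- For 0 < i < n the exchange of i and i + 1 stays within the rectangle, and the Z_i are diagonal.
-/
theorem rectRep_embed_mem {x : DAHA (N * k) S t Y} (hx : x ∈ DAHA.HZ (N * k) S t Y)
    (v : SYT N k →₀ K) :
    PSYTBar.rectRep N k S t Y hS hS' ht hY x (embed K v) ∈
      LinearMap.range (embed K : (SYT N k →₀ K) →ₗ[K] _) := by
  have hsingle : ∀ f : Module.End K (PSYTBar N k →₀ K), (∀ R : SYT N k,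
      f (embed K (Finsupp.single R 1)) ∈ LinearMap.range (embed K : (SYT N k →₀ K) →ₗ[K] _)) →
      ∀ v, f (embed K v) ∈ LinearMap.range (embed K : (SYT N k →₀ K) →ₗ[K] _) := by
    intro f hf v
    induction v using Finsupp.induction_linear with
    | zero => simp
    | add v w hv hw => rw [map_add, map_add]; exact Submodule.add_mem _ hv hw
    | single R c =>
      have : Finsupp.single R c = c • Finsupp.single R (1 : K) := by simp
      rw [this, map_smul, map_smul]
      exact Submodule.smul_mem _ _ (hf R)
  have hZ : ∀ m i, ∀ R : SYT N k, (PSYTBar.opZ S m i) (embed K (Finsupp.single R 1)) ∈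
      LinearMap.range (embed K : (SYT N k →₀ K) →ₗ[K] _) := by
    intro m i R
    rw [embed_single, PSYTBar.opZ_single, ← embed_single, ← map_smul]
    exact ⟨_, rfl⟩
  induction hx using Algebra.adjoin_induction generalizing v with
  | mem x hx =>
    refine hsingle _ (fun R => ?_) v
    rcases hx with (⟨i, hi, rfl⟩ | ⟨i, rfl⟩) | ⟨i, rfl⟩
    · obtain ⟨h1, h2, h3⟩ := val_of_ne_zero hi
      rw [PSYTBar.rectRep_T, h3]
      obtain ⟨r, c, e⟩ := R.exists_entry_eq h1 h2.le
      obtain ⟨r', c', e'⟩ := R.exists_entry_eq (i := i.val + 1) (by omega) h2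
      by_cases hR : ∃ R', R.IsSwap i.val R'
      · obtain ⟨R', hR⟩ := hR
        rw [opT_toPSYT_of_isSwap ht h1 h2 e e' hR]
        exact ⟨_, rfl⟩
      · rw [opT_toPSYT_of_not_isSwap hS hS' ht h1 h2 e e' hR]
        exact ⟨_, rfl⟩
    · rw [PSYTBar.rectRep_Z]; exact hZ _ _ R
    · rw [PSYTBar.rectRep_Zinv]; exact hZ _ _ R
  | algebraMap c =>
    rw [AlgHom.commutes, Module.algebraMap_end_apply, ← map_smul]
    exact ⟨_, rfl⟩
  | add x y _ _ hx hy => rw [map_add, LinearMap.add_apply]; exact Submodule.add_mem _ (hx v) (hy v)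
  | mul x y _ _ hx hy =>
    rw [map_mul, Module.End.mul_apply]
    obtain ⟨w, hw⟩ := hy v
    rw [← hw]
    exact hx w

/-- `rect` is obtained by restricting the model to a stable subspace, transported by a linear left
inverse g of the embedding. Thus no presentation of H(𝒵) is needed. -/
theorem exists_embed_intertwining : ∃ σ : DAHA.HZ (N * k) S t Y →ₐ[K] Module.End K (SYT N k →₀ K),
    ∀ x v, embed K (σ x v) = PSYTBar.rectRep N k S t Y hS hS' ht hY x (embed K v) := by
  obtain ⟨g, hg⟩ := (embed K : (SYT N k →₀ K) →ₗ[K] _).exists_leftInverse_of_injective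
    (LinearMap.ker_eq_bot.mpr embed_injective)
  have hg' : ∀ (x : DAHA.HZ (N * k) S t Y) v, embed K (g (PSYTBar.rectRep N k S t Y hS hS' ht hY x
      (embed K v))) = PSYTBar.rectRep N k S t Y hS hS' ht hY x (embed K v) := by
    intro x v
    obtain ⟨w, hw⟩ := rectRep_embed_mem hS hS' ht hY x.2 v
    rw [← hw]
    congr 1
    exact LinearMap.congr_fun hg w
  refine ⟨AlgHom.ofLinearMap
    { toFun := fun x => g ∘ₗ (PSYTBar.rectRep N k S t Y hS hS' ht hY x) ∘ₗ embed K
      map_add' := fun x y => LinearMap.ext fun v => by simp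
      map_smul' := fun c x => LinearMap.ext fun v => by simp } ?_ ?_, fun x v => hg' x v⟩
  · refine LinearMap.ext fun v => embed_injective ?_
    refine (hg' 1 v).trans ?_
    simp
  · intro x y
    refine LinearMap.ext fun v => embed_injective ?_
    refine (hg' (x * y) v).trans ?_
    rw [Module.End.mul_apply]
    refine Eq.trans ?_ (hg' x _).symm
    change _ = PSYTBar.rectRep N k S t Y hS hS' ht hY x (embed K (g (PSYTBar.rectRep N k S t Y hS hS' ht hY y
      (embed K v))))
    rw [hg', ← Module.End.mul_apply, ← map_mul]
    rfl

theorem rep_natCast {n i : ℕ} [NeZero n] (hi : 1 ≤ i) (hi' : i < n) :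
    PSYT.rep (i : ZMod n) = i := by
  have := PSYT.rep_intCast (n := n) i
  rw [Int.emod_eq_of_lt (by omega) (by omega)] at this
  simpa using this

theorem isRectHZ_of_intertwining {σ : DAHA.HZ (N * k) S t Y →ₐ[K] Module.End K (SYT N k →₀ K)}
    (hσ : ∀ x v, embed K (σ x v) = PSYTBar.rectRep N k S t Y hS hS' ht hY x (embed K v)) :
    IsRectHZ N k S t Y σ where
  Z_one x hx := by
    refine Finsupp.lhom_ext' fun R => LinearMap.ext_ring (embed_injective ?_)
    simp only [LinearMap.comp_apply, Finsupp.lsingle_apply, Module.End.one_apply]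
    rw [hσ, hx, PSYTBar.rectRep_Z, embed_single, PSYTBar.opZ_single, PSYT.rep_one, PSYTBar.diag_mk]
    have := R.toPSYT_diagN_entry 0 0
    rw [entry_zero_zero] at this
    rw [show (1 : ℤ) = ((1 : ℕ) : ℤ) from rfl, this]
    simp
  T_swap i x hi hi' hx R R' r r' c c' hR h h' := by
    apply embed_injective
    rw [hσ, hx, PSYTBar.rectRep_T, rep_natCast hi hi', opT_toPSYT_of_isSwap ht hi hi' h h' hR]
  T_not_swap i x hi hi' hx R r r' c c' hR h h' := by
    apply embed_injective
    rw [hσ, hx, PSYTBar.rectRep_T, rep_natCast hi hi',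
      opT_toPSYT_of_not_isSwap hS hS' ht hi hi' h h' hR]

end SYT

/-! ### Uniqueness of `rect` -/

namespace DAHA

variable {K : Type*} [Field K] {N k : ℕ} [NeZero N] [NeZero k] {S t Y : K}

theorem T_mem_HZ {n : ℕ} {i : ZMod n} (hi : i ≠ 0) : (T i : DAHA n S t Y) ∈ HZ n S t Y :=
  Algebra.subset_adjoin (Or.inl (Or.inl ⟨i, hi, rfl⟩))

theorem Z_mem_HZ {n : ℕ} (i : ZMod n) : (Z i : DAHA n S t Y) ∈ HZ n S t Y :=
  Algebra.subset_adjoin (Or.inl (Or.inr ⟨i, rfl⟩))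

theorem Zinv_mem_HZ {n : ℕ} (i : ZMod n) : (Zinv i : DAHA n S t Y) ∈ HZ n S t Y :=
  Algebra.subset_adjoin (Or.inr ⟨i, rfl⟩)

theorem T_Z_T {n : ℕ} {i : ZMod n} (hi : i ≠ 0) :
    (T i * Z i * T i : DAHA n S t Y) = Z (i + 1) := by
  have := mk_rel (S := S) (t := t) (Y := Y) (DAHARel.T_Z_T i hi)
  simp only [map_mul] at this
  exact this

/-- A homomorphism on `H(𝒵)` is determined by the images of `Z_1` and of the `T_i`. -/
theorem hom_HZ_ext {n : ℕ} [NeZero n] {B : Type*} [Semiring B] [Algebra K B]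
    {σ σ' : HZ n S t Y →ₐ[K] B}
    (hZ : σ ⟨Z 1, Z_mem_HZ 1⟩ = σ' ⟨Z 1, Z_mem_HZ 1⟩)
    (hT : ∀ (i : ZMod n) (hi : i ≠ 0), σ ⟨T i, T_mem_HZ hi⟩ = σ' ⟨T i, T_mem_HZ hi⟩) : σ = σ' := by
  have hZall : ∀ m : ℕ, m < n → σ ⟨Z ((m : ZMod n) + 1), Z_mem_HZ _⟩ =
      σ' ⟨Z ((m : ZMod n) + 1), Z_mem_HZ _⟩ := by
    intro m
    induction m with
    | zero => intro _; simpa using hZ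
    | succ m ih =>
      intro hm
      have h0 : ((m + 1 : ℕ) : ZMod n) ≠ 0 := by
        intro h
        have := Nat.le_of_dvd (by omega) ((ZMod.natCast_eq_zero_iff _ _).mp h)
        omega
      have e : ((m + 1 : ℕ) : ZMod n) = (m : ZMod n) + 1 := by push_cast; rfl
      -- The relation T_i Z_i T_i = Z_{i+1} for i ≠ 0 carries the agreement from Z_1 to every Z_i.
      have key : (⟨Z (((m + 1 : ℕ) : ZMod n) + 1), Z_mem_HZ _⟩ : HZ n S t Y) =
          ⟨T ((m + 1 : ℕ) : ZMod n), T_mem_HZ h0⟩ * ⟨Z ((m : ZMod n) + 1), Z_mem_HZ _⟩ *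
            ⟨T ((m + 1 : ℕ) : ZMod n), T_mem_HZ h0⟩ := by
        apply Subtype.ext
        change Z _ = T _ * Z _ * T _
        rw [← e, T_Z_T h0]
      rw [key, map_mul, map_mul, map_mul, map_mul, hT _ h0, ih (by omega)]
  have hZ' : ∀ i : ZMod n, σ ⟨Z i, Z_mem_HZ i⟩ = σ' ⟨Z i, Z_mem_HZ i⟩ := by
    intro i
    have h1 := hZall (i - 1).val (ZMod.val_lt _)
    simpa only [ZMod.natCast_zmod_val, sub_add_cancel] using h1
  refine AlgHom.ext fun ⟨x, hx⟩ => ?_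
  induction hx using Algebra.adjoin_induction with
  | mem x hx =>
    rcases hx with (⟨i, hi, rfl⟩ | ⟨i, rfl⟩) | ⟨i, rfl⟩
    · exact hT i hi
    · exact hZ' i
    · have e1 : (⟨Zinv i, Zinv_mem_HZ i⟩ : HZ n S t Y) * ⟨Z i, Z_mem_HZ i⟩ = 1 :=
        Subtype.ext (Zinv_Z i)
      have e2 : (⟨Z i, Z_mem_HZ i⟩ : HZ n S t Y) * ⟨Zinv i, Zinv_mem_HZ i⟩ = 1 :=
        Subtype.ext (Z_Zinv i)
      have f1 := congrArg σ e1
      have f2 := congrArg σ' e2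
      rw [map_mul, map_one] at f1 f2
      rw [hZ' i] at f1
      exact left_inv_eq_right_inv f1 f2
  | algebraMap c => exact (σ.commutes c).trans (σ'.commutes c).symm
  | add x y hx hy h h' =>
    have e : (⟨x + y, Subalgebra.add_mem _ hx hy⟩ : HZ n S t Y) = ⟨x, hx⟩ + ⟨y, hy⟩ := rfl
    exact ((congrArg σ e).trans (map_add σ _ _)).trans ((congrArg₂ (· + ·) h h').trans
      ((congrArg σ' e).trans (map_add σ' _ _)).symm)
  | mul x y hx hy h h' =>
    have e : (⟨x * y, Subalgebra.mul_mem _ hx hy⟩ : HZ n S t Y) = ⟨x, hx⟩ * ⟨y, hy⟩ := rfl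
    exact ((congrArg σ e).trans (map_mul σ _ _)).trans ((congrArg₂ (· * ·) h h').trans
      ((congrArg σ' e).trans (map_mul σ' _ _)).symm)

end DAHA

theorem IsRectHZ.unique {K : Type*} [Field K] {N k : ℕ} [NeZero N] [NeZero k] {S t Y : K}
    {σ σ' : DAHA.HZ (N * k) S t Y →ₐ[K] Module.End K (SYT N k →₀ K)}
    (h : IsRectHZ N k S t Y σ) (h' : IsRectHZ N k S t Y σ') : σ = σ' := by
  refine DAHA.hom_HZ_ext (σ := σ) (σ' := σ') ?_ fun i hi => ?_
  · rw [h.Z_one _ rfl, h'.Z_one _ rfl]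
  · obtain ⟨h1, h2, -⟩ := SYT.val_of_ne_zero hi
    refine Finsupp.lhom_ext' fun R => LinearMap.ext_ring ?_
    simp only [LinearMap.comp_apply, Finsupp.lsingle_apply]
    obtain ⟨r, c, e⟩ := R.exists_entry_eq h1 h2.le
    obtain ⟨r', c', e'⟩ := R.exists_entry_eq (i := i.val + 1) (by omega) h2
    have hi' : ((⟨DAHA.T i, DAHA.T_mem_HZ hi⟩ : DAHA.HZ (N * k) S t Y) : DAHA (N * k) S t Y) =
        DAHA.T ((i.val : ℕ) : ZMod (N * k)) := by
      rw [ZMod.natCast_zmod_val]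
    by_cases hR : ∃ R', R.IsSwap i.val R'
    · obtain ⟨R', hR⟩ := hR
      rw [h.T_swap _ _ h1 h2 hi' R R' r r' c c' hR e e',
        h'.T_swap _ _ h1 h2 hi' R R' r r' c c' hR e e']
    · rw [h.T_not_swap _ _ h1 h2 hi' R r r' c c' hR e e',
        h'.T_not_swap _ _ h1 h2 hi' R r r' c c' hR e e']

/-! ## Induced modules -/

namespace IndMod

variable {K A V : Type*} [Field K] [Ring A] [Algebra K A] [AddCommGroup V] [Module K V]
  {B : Subalgebra K A} {σ : B →ₐ[K] Module.End K V}
  {M : Type*} [AddCommGroup M] [Module K M] [Module A M] [IsScalarTower K A M]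

/-- The element `a ⊗ v` of the induced module. -/
def tmul (σ : B →ₐ[K] Module.End K V) (a : A) (v : V) : IndMod B σ :=
  Submodule.Quotient.mk (a ⊗ₜ[K] v)

theorem smul_tmul (a b : A) (v : V) : a • tmul σ b v = tmul σ (a * b) v := rfl

theorem tmul_add (a : A) (v w : V) : tmul σ a (v + w) = tmul σ a v + tmul σ a w := by
  rw [tmul, TensorProduct.tmul_add]; rfl

theorem tmul_smul (a : A) (c : K) (v : V) : tmul σ a (c • v) = c • tmul σ a v := by
  rw [tmul, TensorProduct.tmul_smul]; rfl

theorem smul_one_tmul (b : B) (v : V) : (b : A) • tmul σ 1 v = tmul σ 1 (σ b v) := by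
  rw [smul_tmul, mul_one]
  exact (Submodule.Quotient.eq _).mpr (Submodule.subset_span ⟨b, v, rfl⟩)

theorem induction_tmul {P : IndMod B σ → Prop} (h0 : P 0) (htmul : ∀ a v, P (tmul σ a v))
    (hadd : ∀ x y, P x → P y → P (x + y)) (x : IndMod B σ) : P x := by
  obtain ⟨y, rfl⟩ := Submodule.Quotient.mk_surjective _ x
  induction y using TensorProduct.induction_on with
  | zero => exact h0
  | tmul a v => exact htmul a v
  | add y z hy hz => exact hadd _ _ hy hz

/-- The homomorphism of `A`-modules induced by a homomorphism of `B`-modules. -/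
noncomputable def lift (φ : V →ₗ[K] M) (hφ : ∀ (b : B) (v : V), φ (σ b v) = (b : A) • φ v) :
    IndMod B σ →ₗ[A] M :=
  Submodule.liftQ _ (TensorProduct.AlgebraTensorModule.lift (LinearMap.toSpanSingleton A _ φ)) <| by
    rw [Submodule.span_le]
    rintro _ ⟨b, v, rfl⟩
    simp [hφ]

theorem lift_tmul (φ : V →ₗ[K] M) (hφ : ∀ (b : B) (v : V), φ (σ b v) = (b : A) • φ v) (a : A)
    (v : V) : lift φ hφ (tmul σ a v) = a • φ v := by
  rw [lift, tmul, Submodule.liftQ_apply]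
  simp

/-- If `v` generates `V` then `1 ⊗ v` generates the induced module. -/
theorem exists_smul_eq {v : V} (hv : ∀ U : Submodule K V, (∀ b, ∀ u ∈ U, σ b u ∈ U) → v ∈ U → U = ⊤)
    (x : IndMod B σ) : ∃ a : A, a • tmul σ 1 v = x := by
  rw [← Submodule.mem_span_singleton]
  induction x using induction_tmul with
  | h0 => exact Submodule.zero_mem _
  | hadd x y hx hy => exact Submodule.add_mem _ hx hy
  | htmul a w =>
    -- The vectors w for which 1 ⊗ w lies in the submodule generated by 1 ⊗ v form a B-stable
    -- subspace containing v.
    let U : Submodule K V :=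
      { carrier := {w | tmul σ 1 w ∈ Submodule.span A {tmul σ 1 v}}
        zero_mem' := by
          have h : tmul σ 1 0 = 0 := by rw [tmul, TensorProduct.tmul_zero]; rfl
          rw [Set.mem_ofPred_eq, h]
          exact Submodule.zero_mem _
        add_mem' := fun {u w} hu hw => by
          rw [Set.mem_ofPred_eq] at *
          rw [tmul_add]
          exact Submodule.add_mem _ hu hw
        smul_mem' := fun c w hw => by
          rw [Set.mem_ofPred_eq] at *
          rw [tmul_smul]
          exact Submodule.smul_of_tower_mem _ c hw }
    have htop : U = ⊤ := hv U (fun b u hu => by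
      have hu' : tmul σ 1 u ∈ Submodule.span A {tmul σ 1 v} := hu
      have h := Submodule.smul_mem _ (b : A) hu'
      rw [smul_one_tmul] at h
      exact h) (Submodule.mem_span_singleton_self (tmul σ 1 v))
    have hw : w ∈ U := htop ▸ Submodule.mem_top
    have : tmul σ a w = a • tmul σ 1 w := by rw [smul_tmul, mul_one]
    rw [this]
    exact Submodule.smul_mem _ _ hw

end IndMod

/-! ## The maximal semisimple quotient -/

section Rect

variable {K : Type*} [Field K] {N k : ℕ} [NeZero N] [NeZero k] {S t Y : K}
  {σ : DAHA.HZ (N * k) S t Y →ₐ[K] Module.End K (SYT N k →₀ K)}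

/-- The module `rect` is generated by the vector `v_{R₀}`. -/
theorem IsRectHZ.eq_top (hS : S ≠ 0) (hS' : ∀ m : ℕ, 0 < m → S ^ m ≠ 1) (ht : S ^ N = t)
    (h : IsRectHZ N k S t Y σ) (U : Submodule K (SYT N k →₀ K)) (hU : ∀ b, ∀ u ∈ U, σ b u ∈ U)
    (h0 : Finsupp.single (SYT.R₀ N k) 1 ∈ U) : U = ⊤ := by
  have hN : (N : ℤ) ≠ 0 := by exact_mod_cast NeZero.ne N
  have hall : ∀ R : SYT N k, Finsupp.single R 1 ∈ U := by
    intro R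
    induction R using SYT.induction_isSwap with
    | h0 => exact h0
    | hswap R R' i hi hi' hR ih =>
      obtain ⟨r, c, e⟩ := R.exists_entry_eq hi hi'.le
      obtain ⟨r', c', e'⟩ := R.exists_entry_eq (i := i + 1) (by omega) hi'
      have hi0 : ((i : ℕ) : ZMod (N * k)) ≠ 0 := by
        intro H
        have := Nat.le_of_dvd hi ((ZMod.natCast_eq_zero_iff _ _).mp H)
        omega
      have h1 := hU ⟨_, DAHA.T_mem_HZ hi0⟩ _ ih
      rw [h.T_swap i _ hi hi' rfl R R' r r' c c' hR e e'] at h1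
      -- Without its diagonal term, T_i v_R is a multiple of v_{R'}. The contents differ by at least
      -- 2, so the coefficient is non-zero.
      have h2 := (Submodule.add_mem_iff_right U (U.smul_mem _ ih)).mp h1
      have hc := (hR.free hi hi').content_sub
      rw [SYT.content_sub e e'] at hc
      generalize (((c : ℕ) : ℤ) - (r : ℕ)) - (((c' : ℕ) : ℤ) - (r' : ℕ)) = d at h2 hc
      have hne : ∀ m : ℤ, d ≠ m → (N : ℤ) * d ≠ N * m := fun m hm H => hm (mul_left_cancel₀ hN H)
      have h3 := swapCoeff_ne_zero (e := N * d) hS hS' ht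
        (by simpa using hne 0 (by omega)) (by simpa using hne 1 (by omega))
        (by simpa using hne (-1) (by omega))
      rw [swapCoeff, if_neg (by simpa using hne (-1) (by omega)), SYT.diagCoeff_mul_natCast ht] at h3
      have h4 := U.smul_mem (t⁻¹ + seminormalCoeff t d)⁻¹ h2
      rwa [smul_smul, inv_mul_cancel₀ h3, one_smul] at h4
  refine eq_top_iff.mpr fun v _ => ?_
  induction v using Finsupp.induction_linear with
  | zero => exact U.zero_mem
  | add f g hf hg => exact U.add_mem (hf trivial) (hg trivial)
  | single R c =>
    have := U.smul_mem c (hall R)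
    simpa using this

/-! ### Column antisymmetric vectors in the induced module -/

namespace DAHA

variable {M : Type*} [AddCommGroup M] [Module K M] [Module (DAHA (N * k) S t Y) M]
  [IsScalarTower K (DAHA (N * k) S t Y) M]

variable (N k S t Y M) in
/-- The vectors of weight `wt(R₀)` that are antisymmetric for the column group. -/
def columnSpace : Submodule K M where
  carrier := {x | x ∈ weightSpace (N * k) S t Y M ((PSYT.R₀ N k).wt S) ∧
    ∀ i : ℤ, ¬ (N : ℤ) ∣ i → (Ti i : DAHA (N * k) S t Y) • x = (-t⁻¹) • x}
  zero_mem' := ⟨Submodule.zero_mem _, fun i _ => by simp⟩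
  add_mem' hx hy := ⟨Submodule.add_mem _ hx.1 hy.1, fun i hi => by
    rw [smul_add, hx.2 i hi, hy.2 i hi, smul_add]⟩
  smul_mem' c x hx := ⟨Submodule.smul_mem _ c hx.1, fun i hi => by
    rw [smul_comm, hx.2 i hi, smul_comm]⟩

theorem pi_pow_smul_mem_columnSpace (hS : S ≠ 0) {x : M} (hx : x ∈ columnSpace N k S t Y M) :
    (pi ^ N : DAHA (N * k) S t Y) • x ∈ columnSpace N k S t Y M := by
  refine ⟨weight_pi_pow_smul hS hx.1, fun i hi => ?_⟩
  have h := pi_pow_Ti (n := N * k) (S := S) (t := t) (Y := Y) N (i - N)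
  rw [sub_add_cancel] at h
  rw [← mul_smul, ← h, mul_smul, hx.2 (i - N) (by rwa [dvd_sub_self_right]), smul_comm]

variable {ρ : DAHA (N * k) S t Y →ₐ[K] Module.End K (PSYTBar N k →₀ K)}
  {a : rootsOfUnity (N * k) K}

/-- A simple module with a non-zero column antisymmetric vector of weight `wt(R₀)` is a twist of
the rectangular representation. -/
theorem _root_.IsRectRep.exists_equiv_twist_of_columnSpace
    (ha : IsPrimitiveRoot ((a : Kˣ) : K) (N * k)) (hS : S ≠ 0)
    (hS' : ∀ m : ℕ, 0 < m → S ^ m ≠ 1) (ht : S ^ N = t) (h : IsRectRep N k S t Y ρ)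
    [IsSimpleModule (DAHA (N * k) S t Y) M] {x : M} (hx : x ∈ columnSpace N k S t Y M)
    (hx0 : x ≠ 0) :
    ∃ j : Fin k, Nonempty (M ≃ₗ[DAHA (N * k) S t Y] TwistMod ρ (a ^ (j : ℕ))) := by
  obtain ⟨j, y, hy, hy0, he⟩ := exists_eigenvector (S := S) (t := t) (Y := Y) ha
    (V := columnSpace N k S t Y M) (fun v hv => pi_pow_smul_mem_columnSpace hS hv) hx hx0
  exact ⟨j, h.nonempty_equiv_twist hS hS' ht hy0 ⟨hy.1, hy.2, he⟩⟩

theorem twist_of_mem_HZ (b : rootsOfUnity (N * k) K) {x : DAHA (N * k) S t Y}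
    (hx : x ∈ HZ (N * k) S t Y) : twist b x = x := by
  induction hx using Algebra.adjoin_induction with
  | mem x hx =>
    rcases hx with (⟨i, hi, rfl⟩ | ⟨i, rfl⟩) | ⟨i, rfl⟩
    · exact twist_T b i
    · exact twist_Z b i
    · exact twist_Zinv b i
  | algebraMap c => exact AlgHom.commutes _ c
  | add x y _ _ hx hy => rw [map_add, hx, hy]
  | mul x y _ _ hx hy => rw [map_mul, hx, hy]

end DAHA

/-- By uniqueness, any `rect` is the one obtained from the model by restriction. -/
theorem IsRectHZ.intertwining (hS : S ≠ 0) (hS' : ∀ m : ℕ, 0 < m → S ^ m ≠ 1) (ht : S ^ N = t)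
    (hY : Y = S ^ (1 - (N : ℤ) ^ 2)) (h : IsRectHZ N k S t Y σ) (x : DAHA.HZ (N * k) S t Y)
    (v : SYT N k →₀ K) : SYT.embed K (σ x v) =
      PSYTBar.rectRep N k S t Y hS hS' ht hY x (SYT.embed K v) := by
  obtain ⟨σ', hσ'⟩ := SYT.exists_embed_intertwining (k := k) hS hS' ht hY
  rw [h.unique (SYT.isRectHZ_of_intertwining hS hS' ht hY hσ')]
  exact hσ' x v

/-- The generator of the induced module is antisymmetric for the column group and has the weight
`wt(R₀)`. -/
theorem IsRectHZ.tmul_mem_columnSpace (hS : S ≠ 0) (hS' : ∀ m : ℕ, 0 < m → S ^ m ≠ 1)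
    (ht : S ^ N = t) (hY : Y = S ^ (1 - (N : ℤ) ^ 2)) (h : IsRectHZ N k S t Y σ) :
    IndMod.tmul σ 1 (Finsupp.single (SYT.R₀ N k) 1) ∈
      DAHA.columnSpace N k S t Y (IndMod (DAHA.HZ (N * k) S t Y) σ) := by
  have hρ := PSYTBar.isRectRep_rectRep (k := k) hS hS' ht hY
  -- Scalars by which elements of H(𝒵) act on v_{R₀} in the model are pulled back to `rect` along
  -- the embedding and then pass to 1 ⊗ v_{R₀}.
  have key : ∀ (x : DAHA.HZ (N * k) S t Y) (c : K),
      PSYTBar.rectRep N k S t Y hS hS' ht hY x (Finsupp.single ⟦PSYT.R₀ N k⟧ 1) =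
        c • Finsupp.single ⟦PSYT.R₀ N k⟧ 1 →
      (x : DAHA (N * k) S t Y) • IndMod.tmul σ 1 (Finsupp.single (SYT.R₀ N k) 1) =
        c • IndMod.tmul σ 1 (Finsupp.single (SYT.R₀ N k) 1) := by
    intro x c hx
    rw [IndMod.smul_one_tmul, ← IndMod.tmul_smul]
    congr 1
    apply SYT.embed_injective
    rw [h.intertwining hS hS' ht hY, map_smul, SYT.embed_single, SYT.mk_toPSYT_R₀, hx]
  refine ⟨fun i => key ⟨_, DAHA.Z_mem_HZ i⟩ _ (hρ.weight _ i), fun i hi => ?_⟩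
  have hi0 : ((i : ℤ) : ZMod (N * k)) ≠ 0 := by
    rw [Ne, ZMod.intCast_zmod_eq_zero_iff_dvd]
    intro H
    refine hi (dvd_trans ?_ H)
    push_cast
    exact dvd_mul_right _ _
  refine key ⟨_, DAHA.T_mem_HZ hi0⟩ _ ?_
  exact DAHA.Ti_smul_of_supp_subset (M := RepMod (PSYTBar.rectRep N k S t Y hS hS' ht hY)) hS hS' ht
    (hρ.hasWeights.supp_eq hS).subset hρ.hasWeights.weight_columnVector hi

/-! ### Simple quotients and the radical of the induced module -/

namespace DAHA

variable {ρ : DAHA (N * k) S t Y →ₐ[K] Module.End K (PSYTBar N k →₀ K)}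
  {a : rootsOfUnity (N * k) K}

/-- A non-zero homomorphism from the induced module to a twist. -/
theorem exists_hom_twist (hS : S ≠ 0) (hS' : ∀ m : ℕ, 0 < m → S ^ m ≠ 1)
    (ht : S ^ N = t) (hY : Y = S ^ (1 - (N : ℤ) ^ 2)) (hσ : IsRectHZ N k S t Y σ)
    (hρ : IsRectRep N k S t Y ρ) (b : rootsOfUnity (N * k) K) :
    ∃ f : IndMod (HZ (N * k) S t Y) σ →ₗ[DAHA (N * k) S t Y] TwistMod ρ b,
      f (IndMod.tmul σ 1 (Finsupp.single (SYT.R₀ N k) 1)) = columnVector (ρ.comp (twist b)) := by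
  have hmodel := PSYTBar.isRectRep_rectRep (k := k) hS hS' ht hY
  obtain ⟨e⟩ := hmodel.nonempty_equiv hS hS' ht hρ
  let φ : (SYT N k →₀ K) →ₗ[K] TwistMod ρ b := (e.toLinearMap.restrictScalars K).comp
    (SYT.embed K : _ →ₗ[K] RepMod (PSYTBar.rectRep N k S t Y hS hS' ht hY))
  have hφ : ∀ (x : HZ (N * k) S t Y) v, φ (σ x v) = (x : DAHA (N * k) S t Y) • φ v := by
    intro x v
    have h1 : φ (σ x v) = e (SYT.embed K (σ x v) :) := rfl
    rw [h1, hσ.intertwining hS hS' ht hY]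
    change _ = ρ (twist b x) _
    -- The twist fixes H(𝒵), so one map defined on `rect` is H(𝒵)-linear into every twist.
    rw [twist_of_mem_HZ b x.2]
    exact e.map_smul (x : DAHA (N * k) S t Y) (SYT.embed K v :)
  let v₀ : SYT N k →₀ K := Finsupp.single (SYT.R₀ N k) 1
  have hv₀ : φ v₀ = (e (columnVector _) :) := by
    change e (SYT.embed K (Finsupp.single (SYT.R₀ N k) 1) :) = _
    rw [SYT.embed_single, SYT.mk_toPSYT_R₀]
    rfl
  -- An isomorphism preserves the one-dimensional weight space, so v_{R₀} goes to a non-zero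
  -- multiple of v_{R₀}, which is then normalized.
  obtain ⟨c, hc⟩ := hρ.hasWeights.eq_smul_columnVector hS hS' (v := e (columnVector _))
    (fun i => by
      rw [← map_smul, hmodel.hasWeights.weight_columnVector]
      exact e.toLinearMap.map_smul_of_tower _ _)
  have hc0 : c ≠ 0 := by
    rintro rfl
    rw [zero_smul, LinearEquiv.map_eq_zero_iff] at hc
    exact columnVector_ne_zero hc
  refine ⟨IndMod.lift (c⁻¹ • φ) fun x v => ?_, ?_⟩
  · rw [LinearMap.smul_apply, LinearMap.smul_apply, hφ, smul_comm]
  · rw [IndMod.lift_tmul, one_smul, LinearMap.smul_apply, inv_smul_eq_iff₀ hc0]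
    exact hv₀.trans hc

/-- Every simple quotient of the induced module factors through one of the twists. -/
theorem exists_ker_le (ha : IsPrimitiveRoot ((a : Kˣ) : K) (N * k)) (hS : S ≠ 0)
    (hS' : ∀ m : ℕ, 0 < m → S ^ m ≠ 1)
    (ht : S ^ N = t) (hY : Y = S ^ (1 - (N : ℤ) ^ 2)) (hσ : IsRectHZ N k S t Y σ)
    (hρ : IsRectRep N k S t Y ρ)
    {f : ∀ j : Fin k, IndMod (HZ (N * k) S t Y) σ →ₗ[DAHA (N * k) S t Y] TwistMod ρ (a ^ (j : ℕ))}
    (hf : ∀ j, f j (IndMod.tmul σ 1 (Finsupp.single (SYT.R₀ N k) 1)) = columnVector _)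
    (W : Submodule (DAHA (N * k) S t Y) (IndMod (HZ (N * k) S t Y) σ)) (hW : IsCoatom W) :
    ∃ j, LinearMap.ker (f j) ≤ W := by
  have hgen := IndMod.exists_smul_eq (σ := σ) (hσ.eq_top hS hS' ht)
  set x₀ := IndMod.tmul σ 1 (Finsupp.single (SYT.R₀ N k) 1) with hx₀
  have : IsSimpleModule (DAHA (N * k) S t Y) (IndMod (HZ (N * k) S t Y) σ ⧸ W) :=
    isSimpleModule_iff_isCoatom.mpr hW
  obtain ⟨hx1, hx2⟩ := hσ.tmul_mem_columnSpace hS hS' ht hY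
  have hq0 : W.mkQ x₀ ≠ 0 := by
    intro h
    apply hW.1
    refine eq_top_iff.mpr fun x _ => ?_
    obtain ⟨b, rfl⟩ := hgen x
    exact W.smul_mem b ((Submodule.Quotient.mk_eq_zero W).mp h)
  have hq : W.mkQ x₀ ∈ columnSpace N k S t Y (IndMod (HZ (N * k) S t Y) σ ⧸ W) := by
    refine ⟨fun i => ?_, fun i hi => ?_⟩
    · rw [← map_smul, hx1 i, LinearMap.map_smul_of_tower]
    · rw [← map_smul, hx2 i hi, LinearMap.map_smul_of_tower]
  obtain ⟨j, ⟨e⟩⟩ := hρ.exists_equiv_twist_of_columnSpace ha hS hS' ht hq hq0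
  refine ⟨j, fun x hx => ?_⟩
  -- The class of x₀ modulo W corresponds to a multiple of f_j(x₀). Since x₀ generates, any b with b
  -- f_j(x₀) = 0 gives b x₀ ∈ W.
  obtain ⟨c, hc⟩ := (hρ.hasWeights.twist (a ^ (j : ℕ))).eq_smul_columnVector hS hS'
    (v := e (W.mkQ x₀)) (fun i => by
      rw [← map_smul, hq.1 i]
      exact e.toLinearMap.map_smul_of_tower _ _)
  obtain ⟨b, rfl⟩ := hgen x
  rw [LinearMap.mem_ker, map_smul, hf] at hx
  have h : e (W.mkQ (b • x₀)) = 0 := by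
    rw [map_smul, map_smul, hc, smul_comm, hx, smul_zero]
  rw [LinearEquiv.map_eq_zero_iff] at h
  exact (Submodule.Quotient.mk_eq_zero W).mp h

theorem twist_scalar_injective (ha : IsPrimitiveRoot ((a : Kˣ) : K) (N * k)) :
    Function.Injective fun j : Fin k =>
      (((a ^ (j : ℕ) : rootsOfUnity (N * k) K) : Kˣ) : K) ^ N := by
  intro i j h
  have e : ∀ j : Fin k, (((a ^ (j : ℕ) : rootsOfUnity (N * k) K) : Kˣ) : K) ^ N =
      (((a : Kˣ) : K) ^ N) ^ (j : ℕ) := by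
    intro j
    push_cast
    exact pow_right_comm _ _ _
  simp only [e] at h
  exact Fin.ext ((isPrimitiveRoot_pow ha).pow_inj i.2 j.2 h)

/-- The map to the sum of the twists sends the generator to the tuple of column vectors. It is onto
because π^N separates the summands. Its kernel is contained in every maximal submodule by
`exists_ker_le`, so every semisimple quotient factors through it. -/
theorem isMaximalSemisimpleQuotient (ha : IsPrimitiveRoot ((a : Kˣ) : K) (N * k)) (hS : S ≠ 0)
    (hS' : ∀ m : ℕ, 0 < m → S ^ m ≠ 1)
    (ht : S ^ N = t) (hY : Y = S ^ (1 - (N : ℤ) ^ 2)) (hσ : IsRectHZ N k S t Y σ)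
    (hρ : IsRectRep N k S t Y ρ) :
    IsMaximalSemisimpleQuotient (DAHA (N * k) S t Y) (IndMod (HZ (N * k) S t Y) σ)
      (DirectSum (Fin k) fun j => TwistMod ρ (a ^ (j : ℕ))) := by
  have hsimple : ∀ j : Fin k, IsSimpleModule (DAHA (N * k) S t Y) (TwistMod ρ (a ^ (j : ℕ))) :=
    fun j => isSimpleModule_twist hρ.irreducible _
  choose f hf using fun j : Fin k => exists_hom_twist hS hS' ht hY hσ hρ (a ^ (j : ℕ))
  let F : IndMod (HZ (N * k) S t Y) σ →ₗ[DAHA (N * k) S t Y]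
      DirectSum (Fin k) fun j => TwistMod ρ (a ^ (j : ℕ)) :=
    ∑ j, (DirectSum.lof (DAHA (N * k) S t Y) (Fin k) (fun j => TwistMod ρ (a ^ (j : ℕ))) j).comp (f j)
  have hF : ∀ x, F x = ∑ j, DirectSum.lof (DAHA (N * k) S t Y) (Fin k)
      (fun j => TwistMod ρ (a ^ (j : ℕ))) j (f j x) := fun x => by
    simp [F]
  refine ⟨inferInstanceAs (IsSemisimpleModule _ (Π₀ j : Fin k, TwistMod ρ (a ^ (j : ℕ)))),
    F, ?_, ?_⟩
  · rw [← LinearMap.range_eq_top, eq_top_iff]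
    rintro y -
    induction y using DirectSum.induction_on with
    | zero => exact Submodule.zero_mem _
    | add y z hy hz => exact Submodule.add_mem _ hy hz
    | of j y =>
      obtain ⟨b, rfl⟩ := (isSimpleModule_iff_toSpanSingleton_surjective.mp (hsimple j)).2
        (columnVector _) columnVector_ne_zero y
      let β : Fin k → K := fun j => (((a ^ (j : ℕ) : rootsOfUnity (N * k) K) : Kˣ) : K) ^ N
      -- Lagrange interpolation at the distinct eigenvalues of π^N: P(π^N) divided by P(β_j)
      -- projects the image of the generator to the j-th summand.
      let P : Polynomial K := ∏ i ∈ Finset.univ.erase j, (Polynomial.X - Polynomial.C (β i))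
      have hP : P.eval (β j) ≠ 0 := by
        rw [Polynomial.eval_prod, Finset.prod_ne_zero_iff]
        intro i hi
        rw [Polynomial.eval_sub, Polynomial.eval_X, Polynomial.eval_C, sub_ne_zero]
        exact fun H => (Finset.ne_of_mem_erase hi) (twist_scalar_injective ha H).symm
      have hP' : ∀ i, i ≠ j → P.eval (β i) = 0 := by
        intro i hi
        rw [Polynomial.eval_prod]
        refine Finset.prod_eq_zero (Finset.mem_erase.mpr ⟨hi, Finset.mem_univ i⟩) ?_
        simp
      refine ⟨(b * (P.eval (β j))⁻¹ • Polynomial.aeval (pi ^ N : DAHA (N * k) S t Y) P) •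
        IndMod.tmul σ 1 (Finsupp.single (SYT.R₀ N k) 1), ?_⟩
      rw [map_smul, hF]
      have hterm : ∀ i : Fin k, (P.eval (β j))⁻¹ • Polynomial.aeval (pi ^ N : DAHA (N * k) S t Y) P •
          columnVector (ρ.comp (twist (a ^ (i : ℕ)))) =
          ((P.eval (β j))⁻¹ * P.eval (β i)) • columnVector (ρ.comp (twist (a ^ (i : ℕ)))) := by
        intro i
        rw [aeval_smul_of_smul_eq (M := TwistMod ρ (a ^ (i : ℕ)))
          (hρ.isColumnVector_twist hS hS' ht (a ^ (i : ℕ))).pi_pow, smul_smul]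
      rw [Finset.smul_sum, Finset.sum_eq_single j]
      · rw [← map_smul, hf, mul_smul, smul_assoc, hterm, inv_mul_cancel₀ hP, one_smul]
        rfl
      · intro i _ hi
        rw [← map_smul, hf, mul_smul, smul_assoc, hterm, hP' i hi, mul_zero, zero_smul, smul_zero,
          map_zero]
      · exact fun h => absurd (Finset.mem_univ j) h
  · intro W hW
    -- The radical is the intersection of the maximal submodules, and every homomorphism to a
    -- semisimple module kills it.
    have hker : LinearMap.ker F ≤ Module.jacobson (DAHA (N * k) S t Y)
        (IndMod (HZ (N * k) S t Y) σ) := by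
      refine le_sInf fun m hm => ?_
      obtain ⟨j, hj⟩ := exists_ker_le ha hS hS' ht hY hσ hρ hf m hm
      refine le_trans (fun x hx => ?_) hj
      rw [LinearMap.mem_ker] at hx ⊢
      have h := congrArg (DirectSum.component (DAHA (N * k) S t Y) (Fin k)
        (fun j => TwistMod ρ (a ^ (j : ℕ))) j) hx
      rw [hF, map_sum, map_zero, Finset.sum_eq_single j] at h
      · rwa [DirectSum.component.lof_self] at h
      · intro i _ hi
        rw [DirectSum.component.of, dif_neg hi]
      · exact fun h => absurd (Finset.mem_univ j) h
    have := IsSemisimpleModule.jacobson_le_ker _ _ _ _ W.mkQ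
    rw [Submodule.ker_mkQ] at this
    exact hker.trans this

end DAHA

end Rect

theorem theorem6p9 {K : Type*} [Field K] [CharZero K] (N k : ℕ) [NeZero N] [NeZero k]
    (S t Y : K) (hS : S ≠ 0) (hS' : ∀ m : ℕ, 0 < m → S ^ m ≠ 1)
    (ht : S ^ N = t) (hY : Y = S ^ (1 - (N : ℤ) ^ 2))
    (a : rootsOfUnity (N * k) K) (ha : IsPrimitiveRoot ((a : Kˣ) : K) (N * k)) :
    -- the modules `rect` and `L̄(k^N)` exist and are unique
    (∃! σ : DAHA.HZ (N * k) S t Y →ₐ[K] Module.End K (SYT N k →₀ K), IsRectHZ N k S t Y σ) ∧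
    (∃ ρ : DAHA (N * k) S t Y →ₐ[K] Module.End K (PSYTBar N k →₀ K), IsRectRep N k S t Y ρ) ∧
    (∀ ρ ρ' : DAHA (N * k) S t Y →ₐ[K] Module.End K (PSYTBar N k →₀ K),
      IsRectRep N k S t Y ρ → IsRectRep N k S t Y ρ' →
        Nonempty (RepMod ρ ≃ₗ[DAHA (N * k) S t Y] RepMod ρ')) ∧
    ∀ (σ : DAHA.HZ (N * k) S t Y →ₐ[K] Module.End K (SYT N k →₀ K))
      (ρ : DAHA (N * k) S t Y →ₐ[K] Module.End K (PSYTBar N k →₀ K)),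
      IsRectHZ N k S t Y σ → IsRectRep N k S t Y ρ →
      -- the maximal semisimple quotient of the induced module
      IsMaximalSemisimpleQuotient (DAHA (N * k) S t Y) (IndMod (DAHA.HZ (N * k) S t Y) σ)
        (DirectSum (Fin k) fun j => DAHA.TwistMod ρ (a ^ (j : ℕ))) ∧
      -- isomorphisms between twists
      (∀ b c : rootsOfUnity (N * k) K,
        Nonempty (DAHA.TwistMod ρ b ≃ₗ[DAHA (N * k) S t Y]
          DAHA.TwistMod ρ c) ↔
        ((b : Kˣ) : K) ^ N = ((c : Kˣ) : K) ^ N) ∧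
      -- the `k` twists are pairwise non-isomorphic, and all twists have the support of `L̄(k^N)`
      (∀ j j' : Fin k, j ≠ j' →
        IsEmpty (DAHA.TwistMod ρ (a ^ (j : ℕ)) ≃ₗ[DAHA (N * k) S t Y]
          DAHA.TwistMod ρ (a ^ (j' : ℕ)))) ∧
      (∀ b : rootsOfUnity (N * k) K,
        DAHA.supp (N * k) S t Y (DAHA.TwistMod ρ b) =
          DAHA.supp (N * k) S t Y (RepMod ρ)) ∧
      -- in the twist by `b`, the vector `v_{R₀}` is scaled by `π^N` with the factor `b^N`
      (∀ b : rootsOfUnity (N * k) K,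
        (ρ.comp (DAHA.twist b)) (DAHA.pi ^ N) (Finsupp.single ⟦PSYT.R₀ N k⟧ 1) =
          ((b : Kˣ) : K) ^ N • Finsupp.single ⟦PSYT.R₀ N k⟧ 1) ∧
      -- every simple module with this support is one of the `k` twists, and which one it is
      -- can be read off from the scalar by which `π^N` acts on the line of weight `wt(R₀)`
      (∀ (M : Type*) [AddCommGroup M] [Module K M] [Module (DAHA (N * k) S t Y) M]
        [IsScalarTower K (DAHA (N * k) S t Y) M],
        IsSimpleModule (DAHA (N * k) S t Y) M →
        DAHA.supp (N * k) S t Y M =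
          DAHA.supp (N * k) S t Y (RepMod ρ) →
        (∃ j : Fin k, Nonempty (M ≃ₗ[DAHA (N * k) S t Y]
          DAHA.TwistMod ρ (a ^ (j : ℕ)))) ∧
        Module.finrank K
          (DAHA.weightSpace (N * k) S t Y M ((PSYT.R₀ N k).wt S)) = 1 ∧
        ∀ b : rootsOfUnity (N * k) K,
          Nonempty (M ≃ₗ[DAHA (N * k) S t Y] DAHA.TwistMod ρ b) ↔
          ∀ v ∈ DAHA.weightSpace (N * k) S t Y M ((PSYT.R₀ N k).wt S),
            (DAHA.pi ^ N : DAHA (N * k) S t Y) • v = ((b : Kˣ) : K) ^ N • v) := by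
  have hmodel := PSYTBar.isRectRep_rectRep (k := k) hS hS' ht hY
  obtain ⟨σ₀, hσ₀⟩ := SYT.exists_embed_intertwining (k := k) hS hS' ht hY
  refine ⟨⟨σ₀, SYT.isRectHZ_of_intertwining hS hS' ht hY hσ₀, fun σ hσ =>
      hσ.unique (SYT.isRectHZ_of_intertwining hS hS' ht hY hσ₀)⟩,
    ⟨_, hmodel⟩, fun ρ ρ' hρ hρ' => hρ.nonempty_equiv hS hS' ht hρ', fun σ ρ hσ hρ => ?_⟩
  refine ⟨DAHA.isMaximalSemisimpleQuotient ha hS hS' ht hY hσ hρ,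
    hρ.nonempty_twist_equiv_iff hS hS' ht, fun j j' hj => ⟨fun e => hj ?_⟩, fun b => ?_,
    hρ.twist_pi_pow_columnVector, fun M _ _ _ _ hM hsupp => ?_⟩
  · exact DAHA.twist_scalar_injective ha ((hρ.nonempty_twist_equiv_iff hS hS' ht _ _).mp ⟨e⟩)
  · rw [hρ.hasWeights.supp_eq hS, (hρ.hasWeights.twist b).supp_eq hS]
  · obtain ⟨j, ⟨e⟩⟩ := hρ.exists_equiv_twist (M := M) ha hS hS' ht hsupp
    exact ⟨⟨j, ⟨e⟩⟩, hρ.finrank_weightSpace hS hS' e,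
      hρ.nonempty_equiv_twist_iff hS hS' ht hsupp⟩
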